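/- Let $N\ge 3$, $2^*=\frac{2N}{N-2}$, and let $f\in C^1([0,\infty))$ satisfy $f(0)=0$, $f(s)>0$ for $s>0$, and, for some $\alpha,\beta\in(2,2^*)$ and $\mu_1,\mu_2>0$, $$\lim_{t\to0^+}\frac{f'(t)}{t^{\alpha-2}}=\mu_1(\alpha-1),\qquad \lim_{t\to+\infty}\frac{f'(t)}{t^{\beta-2}}=\mu_2(\beta-1).$$ Extend $f$ by $0$ to $(-\infty,0)$ and put $F(s)=\int_0^s f(t)\,dt$. For $k>0$ let $g=g_k:\mathbb R\to\mathbb R$ be the even function with $$g(t)=\sqrt{1-kt^2}\ \text{ for } 0\le t<\sqrt{\tfrac1{3k}},\qquad g(t)=\frac{1}{3\sqrt{2k}\,t}+\sqrt{\tfrac16}\ \text{ for } t\ge\sqrt{\tfrac1{3k}},$$ let $G(t)=\int_0^t g(s)\,ds$, an increasing bijection of $\mathbb R$, and let $G^{-1}$ be its inverse. For $\lambda>0$ consider $$-\Delta v+\lambda\,\frac{G^{-1}(v)}{g(G^{-1}(v))}=\frac{f(G^{-1}(v))}{g(G^{-1}(v))}\quad\text{in }\mathbb R^N,\qquad v\in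 H^1(\mathbb R^N), \tag{2.7}$$ in the weak sense, its energy functional on $H^1(\mathbb R^N)$ $$I_{\lambda}(v)=\frac12\int_{\mathbb R^N}|\nabla v|^2\,dx+\frac\lambda2\int_{\mathbb R^N}|G^{-1}(v)|^2\,dx-\int_{\mathbb R^N}F(G^{-1}(v))\,dx,$$ and its mountain pass level $$m_\lambda=\inf_{\gamma\in\Gamma_\lambda}\max_{t\in[0,1]}I_\lambda(\gamma(t)),\qquad \Gamma_\lambda=\{\gamma\in C([0,1],H^1(\mathbb R^N)):\gamma(0)=0,\ I_\lambda(\gamma(1))<0\}.$$ Then for every $\lambda>0$ there is a constant $C_1>0$, independent of $k$, such that for every $k>0$ every positive solution $v_\lambda\in H^1(\mathbb R^N)$ of (2.7) with $I_\lambda(v_\lambda)=m_\lambda$ satisfies $v_\lambda\in L^\infty(\mathbb R^N)$ and $\|v_\lambda\|_\infty\le C_1$. -/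

import Mathlib

open MeasureTheory Set Filter Topology
open scoped ContDiff

noncomputable section

namespace QLS

/-- `ℝᴺ` with its Euclidean norm. -/
abbrev E (N : ℕ) := EuclideanSpace ℝ (Fin N)

/-- Test functions: smooth and compactly supported. -/
def IsTest {N : ℕ} (φ : E N → ℝ) : Prop := ContDiff ℝ ∞ φ ∧ HasCompactSupport φ

/-- `w` is the weak (distributional) gradient of `v`. -/
def IsWeakGradient {N : ℕ} (v : E N → ℝ) (w : E N → E N) : Prop :=
  ∀ φ : E N → ℝ, IsTest φ → ∀ y : E N,
    ∫ x, v x * fderiv ℝ φ x y = - ∫ x, φ x * inner ℝ (w x) y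

theorem IsTest.memLp {N : ℕ} {φ : E N → ℝ} (hφ : IsTest φ) : MemLp φ 2 volume :=
  hφ.1.continuous.memLp_of_hasCompactSupport hφ.2

theorem IsTest.memLp_fderiv {N : ℕ} {φ : E N → ℝ} (hφ : IsTest φ) (y : E N) :
    MemLp (fun x => fderiv ℝ φ x y) 2 volume := by
  refine Continuous.memLp_of_hasCompactSupport ?_ ?_
  · exact (hφ.1.continuous_fderiv (by simp)).clm_apply continuous_const
  · exact (hφ.2.fderiv (𝕜 := ℝ)).comp_left (g := fun L : E N →L[ℝ] ℝ => L y) rfl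

theorem IsTest.integrable_left {N : ℕ} {φ : E N → ℝ} (hφ : IsTest φ) (y : E N)
    (v : Lp ℝ 2 (volume : Measure (E N))) :
    Integrable (fun x => v x * fderiv ℝ φ x y) volume :=
  (Lp.memLp v).integrable_mul (hφ.memLp_fderiv y)

theorem IsTest.integrable_right {N : ℕ} {φ : E N → ℝ} (hφ : IsTest φ) (y : E N)
    (w : Lp (E N) 2 (volume : Measure (E N))) :
    Integrable (fun x => φ x * inner ℝ (w x) y) volume :=
  hφ.memLp.integrable_mul ((Lp.memLp w).inner_const y)

/-- The Sobolev space `H¹(ℝᴺ)`, as the space of pairs `(v, ∇v)` of square-integrable classes in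
which the second is the weak gradient of the first. The norm inherited from the product,
`max ‖v‖₂ ‖∇v‖₂`, is equivalent to the usual one. -/
def H1 (N : ℕ) :
    Submodule ℝ (Lp ℝ 2 (volume : Measure (E N)) × Lp (E N) 2 (volume : Measure (E N))) where
  carrier := {p | IsWeakGradient (p.1 : E N → ℝ) (p.2 : E N → E N)}
  zero_mem' := by
    intro φ hφ y
    have h1 : ∫ x, ((0 : Lp ℝ 2 (volume : Measure (E N))) : E N → ℝ) x * fderiv ℝ φ x y = 0 := by
      refine integral_eq_zero_of_ae ?_
      filter_upwards [Lp.coeFn_zero ℝ 2 (volume : Measure (E N))] with x hx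
      simp
    have h2 : ∫ x, φ x *
        inner ℝ (((0 : Lp (E N) 2 (volume : Measure (E N))) : E N → E N) x) y = 0 := by
      refine integral_eq_zero_of_ae ?_
      filter_upwards [Lp.coeFn_zero (E N) 2 (volume : Measure (E N))] with x hx
      simp
    simp only [Prod.fst_zero, Prod.snd_zero, h1, h2, neg_zero]
  add_mem' := by
    intro p q hp hq φ hφ y
    have h1 : ∫ x, ((p.1 + q.1 : Lp ℝ 2 (volume : Measure (E N))) : E N → ℝ) x * fderiv ℝ φ x y
        = (∫ x, p.1 x * fderiv ℝ φ x y) + ∫ x, q.1 x * fderiv ℝ φ x y := by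
      rw [← integral_add (hφ.integrable_left y _) (hφ.integrable_left y _)]
      refine integral_congr_ae ?_
      filter_upwards [Lp.coeFn_add p.1 q.1] with x hx
      rw [hx, Pi.add_apply, add_mul]
    have h2 : ∫ x, φ x *
        inner ℝ (((p.2 + q.2 : Lp (E N) 2 (volume : Measure (E N))) : E N → E N) x) y
        = (∫ x, φ x * inner ℝ (p.2 x) y) + ∫ x, φ x * inner ℝ (q.2 x) y := by
      rw [← integral_add (hφ.integrable_right y _) (hφ.integrable_right y _)]
      refine integral_congr_ae ?_
      filter_upwards [Lp.coeFn_add p.2 q.2] with x hx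
      rw [hx, Pi.add_apply, inner_add_left, mul_add]
    simp only [Prod.fst_add, Prod.snd_add, h1, h2, hp φ hφ y, hq φ hφ y]
    ring
  smul_mem' := by
    intro c p hp φ hφ y
    have h1 : ∫ x, ((c • p.1 : Lp ℝ 2 (volume : Measure (E N))) : E N → ℝ) x * fderiv ℝ φ x y
        = c * ∫ x, p.1 x * fderiv ℝ φ x y := by
      rw [← integral_const_mul]
      refine integral_congr_ae ?_
      filter_upwards [Lp.coeFn_smul c p.1] with x hx
      rw [hx, Pi.smul_apply, smul_eq_mul, mul_assoc]
    have h2 : ∫ x, φ x *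
        inner ℝ (((c • p.2 : Lp (E N) 2 (volume : Measure (E N))) : E N → E N) x) y
        = c * ∫ x, φ x * inner ℝ (p.2 x) y := by
      rw [← integral_const_mul]
      refine integral_congr_ae ?_
      filter_upwards [Lp.coeFn_smul c p.2] with x hx
      rw [hx, Pi.smul_apply, real_inner_smul_left]
      ring
    simp only [Prod.smul_fst, Prod.smul_snd, h1, h2, hp φ hφ y]
    ring

/-- The function underlying an element of `H¹(ℝᴺ)`. -/
def fn {N : ℕ} (v : H1 N) : E N → ℝ := v.1.1

/-- The weak gradient of an element of `H¹(ℝᴺ)`. -/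
def grad {N : ℕ} (v : H1 N) : E N → E N := v.1.2

/-- The even function `g` with parameter `k > 0`: `√(1 - k t²)` for `|t| < √(1/(3k))` and
`1 / (3 √(2k) |t|) + √(1/6)` otherwise. -/
def g (k t : ℝ) : ℝ :=
  if |t| < √(1 / (3 * k)) then √(1 - k * t ^ 2)
  else 1 / (3 * √(2 * k) * |t|) + √(1 / 6)

/-- `G(t) = ∫₀ᵗ g(s) ds`. -/
def G (k t : ℝ) : ℝ := ∫ s in (0 : ℝ)..t, g k s

/-- The inverse `G⁻¹`; for `k > 0` the function `G` is an increasing bijection of `ℝ`. -/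
def Ginv (k : ℝ) : ℝ → ℝ := Function.invFun (G k)

/-- Condition (F₁): `f ∈ C¹[0, ∞)`, `f(0) = 0` and `f > 0` on `(0, ∞)`. -/
def CondF1 (f : ℝ → ℝ) : Prop :=
  ContDiffOn ℝ 1 f (Ici 0) ∧ f 0 = 0 ∧ ∀ s, 0 < s → 0 < f s

/-- Condition (F₂): power behaviour of `f'` at `0⁺` and at `+∞` with subcritical exponents. -/
def CondF2 (N : ℕ) (f : ℝ → ℝ) : Prop :=
  ∃ α β μ₁ μ₂ : ℝ, 0 < μ₁ ∧ 0 < μ₂ ∧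
    2 < α ∧ α < 2 * N / (N - 2) ∧ 2 < β ∧ β < 2 * N / (N - 2) ∧
    Tendsto (fun t : ℝ => deriv f t / t ^ (α - 2)) (𝓝[>] 0) (𝓝 (μ₁ * (α - 1))) ∧
    Tendsto (fun t : ℝ => deriv f t / t ^ (β - 2)) atTop (𝓝 (μ₂ * (β - 1)))

/-- `f`, given on `[0, ∞)` with `f(0) = 0`, extended by zero to the negative half-line. -/
def ext (f : ℝ → ℝ) (s : ℝ) : ℝ := f (max s 0)

/-- The primitive `F(s) = ∫₀ˢ f(t) dt`. -/
def F (f : ℝ → ℝ) (s : ℝ) : ℝ := ∫ t in (0 : ℝ)..s, ext f t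

/-- `v ∈ H¹(ℝᴺ)` is a weak solution of
`-Δv + lam * G⁻¹(v) / g(G⁻¹(v)) = f(G⁻¹(v)) / g(G⁻¹(v))` in `ℝᴺ`. -/
def IsWeakSolution {N : ℕ} (f : ℝ → ℝ) (lam k : ℝ) (v : H1 N) : Prop :=
  ∀ φ : E N → ℝ, IsTest φ →
    ∫ x, (fderiv ℝ φ x (grad v x)
        + lam * (Ginv k (fn v x) / g k (Ginv k (fn v x))) * φ x)
      = ∫ x, ext f (Ginv k (fn v x)) / g k (Ginv k (fn v x)) * φ x

/-- The energy functional
`I(v) = ½ ∫ |∇v|² + (lam / 2) ∫ |G⁻¹(v)|² - ∫ F(G⁻¹(v))` on `H¹(ℝᴺ)`. -/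
def energy {N : ℕ} (f : ℝ → ℝ) (lam k : ℝ) (v : H1 N) : ℝ :=
  1 / 2 * (∫ x, ‖grad v x‖ ^ 2) + lam / 2 * (∫ x, Ginv k (fn v x) ^ 2)
    - (∫ x, F f (Ginv k (fn v x)))

/-- The admissible paths: continuous `γ : [0,1] → H¹(ℝᴺ)` with `γ(0) = 0` and `I(γ(1)) < 0`. -/
def paths (N : ℕ) (f : ℝ → ℝ) (lam k : ℝ) : Set C(unitInterval, H1 N) :=
  {γ | γ 0 = 0 ∧ energy f lam k (γ 1) < 0}

/-- The mountain pass level `inf_γ max_t I(γ(t))`. -/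
def mpLevel (N : ℕ) (f : ℝ → ℝ) (lam k : ℝ) : ℝ :=
  ⨅ γ : paths N f lam k, ⨆ t : unitInterval, energy f lam k (γ.1 t)

/-- `v` is a positive solution at the mountain pass level. -/
structure IsMPSolution {N : ℕ} (f : ℝ → ℝ) (lam k : ℝ) (v : H1 N) : Prop where
  pos : ∀ᵐ x, 0 < fn v x
  sol : IsWeakSolution f lam k v
  level : energy f lam k v = mpLevel N f lam k

end QLS

end

/-!
The point is that every constant can be chosen independently of `k`, because `1/3 ≤ g ≤ 1` for all
`k`.

A gradient bound: the energy along a ray `c • φ`, `c ∈ [0, S]`, is bounded above uniformly in `k`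
and negative at the end, so `m_λ ≤ C`. The Pohozaev identity turns `I(v) = m_λ` into
`∫ |∇v|² = N m_λ ≤ N C`. To avoid `H²` regularity, the identity is obtained by testing the equation
with `η (v(t ·) - v)`, for a cutoff `η`, and letting `t → 1`, rather than with `x · ∇v`.

From the gradient to the supremum: since `f` is superlinear at zero and subcritical at infinity,
`f(u) ≤ λ u + K u^(q-1)` for some `q < 2*`, so `v` is a subsolution of `-Δv ≤ K' v^(q-1)` with `K'`
independent of `k`. De Giorgi's iteration on the superlevel sets of `v` then bounds `v` in terms of
`‖∇v‖₂` alone: subcriticality and the Sobolev inequality supply the smallness that starts it.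
-/

noncomputable section

namespace QLS

section LpSpaces

variable {α H : Type*} [MeasurableSpace α] [NormedAddCommGroup H] {μ : Measure α}

theorem eLpNorm_rpow_toReal_eq_lintegral {p : ENNReal} (hp0 : p ≠ 0) (hp : p ≠ ⊤) (d : α → H) :
    eLpNorm d p μ ^ p.toReal = ∫⁻ x, ‖d x‖ₑ ^ p.toReal ∂μ := by
  rw [eLpNorm_eq_lintegral_rpow_enorm_toReal hp0 hp, ← ENNReal.rpow_mul,
    one_div_mul_cancel (ENNReal.toReal_pos hp0 hp).ne', ENNReal.rpow_one]

theorem eLpNorm_two_pow_two (d : α → H) : eLpNorm d 2 μ ^ 2 = ∫⁻ x, ‖d x‖ₑ ^ 2 ∂μ := by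
  simpa using eLpNorm_rpow_toReal_eq_lintegral (μ := μ) two_ne_zero ENNReal.ofNat_ne_top d

theorem ofReal_integral_norm_sq {d : α → H} (hd : MemLp d 2 μ) :
    ENNReal.ofReal (∫ x, ‖d x‖ ^ 2 ∂μ) = eLpNorm d 2 μ ^ 2 := by
  rw [eLpNorm_two_pow_two, ofReal_integral_eq_lintegral_ofReal hd.norm.integrable_sq
    (ae_of_all _ fun x => by positivity)]
  exact lintegral_congr fun x => by rw [ENNReal.ofReal_pow (norm_nonneg _), ofReal_norm]

theorem tendsto_eLpNorm_zero_of_dominated {p : ENNReal} (hp0 : p ≠ 0) (hp : p ≠ ⊤)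
    {d : ℕ → α → H} {b : α → ℝ} (hd : ∀ n, AEStronglyMeasurable (d n) μ) (hb : MemLp b p μ)
    (hle : ∀ n, ∀ᵐ x ∂μ, ‖d n x‖ ≤ b x)
    (hlim : ∀ᵐ x ∂μ, Tendsto (fun n => d n x) atTop (𝓝 0)) :
    Tendsto (fun n => eLpNorm (d n) p μ) atTop (𝓝 0) := by
  have hp' := ENNReal.toReal_pos hp0 hp
  have hint : Tendsto (fun n => ∫⁻ x, ‖d n x‖ₑ ^ p.toReal ∂μ) atTop (𝓝 (∫⁻ _, 0 ∂μ)) := by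
    refine tendsto_lintegral_of_dominated_convergence' (fun x => ‖b x‖ₑ ^ p.toReal)
      (fun n => (hd n).enorm.pow_const _) (fun n => ?_) ?_ ?_
    · filter_upwards [hle n] with x hx
      gcongr
      rw [enorm_le_iff_norm_le]
      exact hx.trans (le_abs_self _)
    · rw [← eLpNorm_rpow_toReal_eq_lintegral hp0 hp]
      exact (ENNReal.rpow_lt_top_of_nonneg hp'.le hb.2.ne).ne
    · filter_upwards [hlim] with x hx
      simpa [hp'] using hx.enorm.ennrpow_const p.toReal
  simp only [lintegral_zero, ← eLpNorm_rpow_toReal_eq_lintegral hp0 hp] at hint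
  have hroot := hint.ennrpow_const p.toReal⁻¹
  rw [ENNReal.zero_rpow_of_pos (inv_pos.2 hp')] at hroot
  exact hroot.congr fun n => ENNReal.rpow_rpow_inv hp'.ne' _

theorem enorm_integral_smul_rpow_le [NormedSpace ℝ H] {p : ENNReal} (hp1 : 1 ≤ p) (hp : p ≠ ⊤)
    {ρ : α → ℝ} (hρ : AEMeasurable ρ μ) (hρ1 : ∫⁻ y, ‖ρ y‖ₑ ∂μ = 1) {d : α → H}
    (hd : AEStronglyMeasurable d μ) :
    ‖∫ y, ρ y • d y ∂μ‖ₑ ^ p.toReal ≤ ∫⁻ y, ‖ρ y‖ₑ * ‖d y‖ₑ ^ p.toReal ∂μ := by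
  let ν : Measure α := μ.withDensity fun y => ‖ρ y‖ₑ
  have hν : IsProbabilityMeasure ν := ⟨by simp [ν, hρ1]⟩
  have hdν : AEStronglyMeasurable d ν := hd.mono_ac (withDensity_absolutelyContinuous _ _)
  have hmean : ‖∫ y, ρ y • d y ∂μ‖ₑ ≤ eLpNorm d 1 ν := by
    refine (enorm_integral_le_lintegral_enorm _).trans ?_
    rw [eLpNorm_one_eq_lintegral_enorm,
      lintegral_withDensity_eq_lintegral_mul₀ hρ.enorm hd.enorm]
    simp [enorm_smul]
  calc ‖∫ y, ρ y • d y ∂μ‖ₑ ^ p.toReal ≤ eLpNorm d p ν ^ p.toReal := by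
        gcongr
        exact hmean.trans (eLpNorm_le_eLpNorm_of_exponent_le hp1 hdν)
    _ = ∫⁻ y, ‖ρ y‖ₑ * ‖d y‖ₑ ^ p.toReal ∂μ := by
        rw [eLpNorm_rpow_toReal_eq_lintegral (one_pos.trans_le hp1).ne' hp,
          lintegral_withDensity_eq_lintegral_mul₀ hρ.enorm (by fun_prop)]
        simp

end LpSpaces

section Mollification

variable {V H : Type*} [NormedAddCommGroup V] [NormedSpace ℝ V] [FiniteDimensional ℝ V]
  [MeasurableSpace V] [BorelSpace V] {μ : Measure V} [μ.IsAddHaarMeasure] [NormedAddCommGroup H]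
  {p : ENNReal}

theorem tendsto_eLpNorm_translate_sub (hp1 : 1 ≤ p) (hp : p ≠ ⊤) {w : V → H} (hw : MemLp w p μ) :
    Tendsto (fun y => eLpNorm (fun x => w (x - y) - w x) p μ) (𝓝 0) (𝓝 0) := by
  have : Fact (1 ≤ p) := ⟨hp1⟩
  have : Fact (p ≠ ⊤) := ⟨hp⟩
  have hcont : Continuous fun y : V => DomAddAct.mk (-y) +ᵥ hw.toLp w :=
    (DomAddAct.continuous_mk.comp (continuous_neg (G := V))).vadd continuous_const
  have hlim := hcont.tendsto 0
  rw [neg_zero, DomAddAct.mk_zero, zero_vadd, Lp.tendsto_Lp_iff_tendsto_eLpNorm] at hlim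
  refine hlim.congr fun y => eLpNorm_congr_ae ?_
  have hshift := (measurePreserving_vadd (-y) μ).quasiMeasurePreserving.ae hw.coeFn_toLp
  filter_upwards [DomAddAct.vadd_Lp_ae_eq (DomAddAct.mk (-y)) (hw.toLp w), hshift] with x hact hx
  simp_all [neg_add_eq_sub]

variable [NormedSpace ℝ H] [CompleteSpace H] {ρ : V → ℝ} {w : V → H}

theorem convolution_sub_self_eq_integral (hp1 : 1 ≤ p) (hρ : Continuous ρ)
    (hρc : HasCompactSupport ρ) (hρ1 : ∫ y, ρ y ∂μ = 1) (hw : MemLp w p μ) (x : V) :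
    convolution ρ w (ContinuousLinearMap.lsmul ℝ ℝ) μ x - w x
      = ∫ y, ρ y • (w (x - y) - w x) ∂μ := by
  have hx : Integrable (fun y => ρ y • w (x - y)) μ :=
    hρc.convolutionExists_left (ContinuousLinearMap.lsmul ℝ ℝ) hρ (hw.locallyIntegrable hp1) x
  simp_rw [smul_sub]
  rw [integral_sub hx ((hρ.integrable_of_hasCompactSupport hρc).smul_const _), integral_smul_const,
    hρ1, one_smul]
  rfl

theorem eLpNorm_convolution_sub_le (hp1 : 1 ≤ p) (hp : p ≠ ⊤) (hρ : Continuous ρ)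
    (hρc : HasCompactSupport ρ) (hρ0 : ∀ y, 0 ≤ ρ y) (hρ1 : ∫ y, ρ y ∂μ = 1)
    (hw : MemLp w p μ) {δ : ENNReal}
    (hδ : ∀ y, ρ y ≠ 0 → eLpNorm (fun x => w (x - y) - w x) p μ ≤ δ) :
    eLpNorm (fun x => convolution ρ w (ContinuousLinearMap.lsmul ℝ ℝ) μ x - w x) p μ ≤ δ := by
  have hp0 : p ≠ 0 := (one_pos.trans_le hp1).ne'
  have hρi : Integrable ρ μ := hρ.integrable_of_hasCompactSupport hρc
  have hρ1' : ∫⁻ y, ‖ρ y‖ₑ ∂μ = 1 := by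
    rw [lintegral_congr fun y => Real.enorm_of_nonneg (hρ0 y),
      ← ofReal_integral_eq_lintegral_ofReal hρi (ae_of_all _ hρ0), hρ1, ENNReal.ofReal_one]
  have hmeas : AEStronglyMeasurable (fun z : V × V => w (z.1 - z.2) - w z.1) (μ.prod μ) :=
    (hw.1.comp_quasiMeasurePreserving (quasiMeasurePreserving_sub_of_right_invariant _ _)).sub
      hw.1.comp_fst
  have hslice : ∀ x, AEStronglyMeasurable (fun y => w (x - y) - w x) μ := fun x =>
    (hw.1.comp_quasiMeasurePreserving (quasiMeasurePreserving_sub_left _ x)).sub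
      aestronglyMeasurable_const
  refine (ENNReal.rpow_le_rpow_iff (ENNReal.toReal_pos hp0 hp)).1 ?_
  rw [eLpNorm_rpow_toReal_eq_lintegral hp0 hp]
  calc ∫⁻ x, ‖convolution ρ w (ContinuousLinearMap.lsmul ℝ ℝ) μ x - w x‖ₑ ^ p.toReal ∂μ
      ≤ ∫⁻ x, ∫⁻ y, ‖ρ y‖ₑ * ‖w (x - y) - w x‖ₑ ^ p.toReal ∂μ ∂μ :=
        lintegral_mono fun x => by
          rw [convolution_sub_self_eq_integral hp1 hρ hρc hρ1 hw]
          exact enorm_integral_smul_rpow_le hp1 hp hρ.aemeasurable hρ1' (hslice x)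
    _ = ∫⁻ y, ∫⁻ x, ‖ρ y‖ₑ * ‖w (x - y) - w x‖ₑ ^ p.toReal ∂μ ∂μ :=
        lintegral_lintegral_swap <| (hρ.measurable.enorm.comp measurable_snd).aemeasurable.mul
          (hmeas.enorm.pow_const _)
    _ ≤ ∫⁻ y, ‖ρ y‖ₑ * δ ^ p.toReal ∂μ := lintegral_mono fun y => by
        rw [lintegral_const_mul' _ _ (by simp), ← eLpNorm_rpow_toReal_eq_lintegral hp0 hp]
        by_cases hy : ρ y = 0
        · simp [hy]
        · gcongr
          exact hδ y hy
    _ = δ ^ p.toReal := by rw [lintegral_mul_const _ hρ.measurable.enorm, hρ1', one_mul]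

end Mollification

/-! ### Sobolev functions and their approximation -/

section Gradient

variable {V : Type*} [NormedAddCommGroup V] [InnerProductSpace ℝ V] [CompleteSpace V]
  {u : V → ℝ}

theorem continuous_gradient (hu : ContDiff ℝ 1 u) : Continuous (gradient u) :=
  (InnerProductSpace.toDual ℝ V).symm.continuous.comp (hu.continuous_fderiv one_ne_zero)

theorem norm_gradient (u : V → ℝ) (x : V) : ‖gradient u x‖ = ‖fderiv ℝ u x‖ :=
  (InnerProductSpace.toDual ℝ V).symm.norm_map _

theorem hasCompactSupport_gradient (hu : HasCompactSupport u) : HasCompactSupport (gradient u) :=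
  (hu.fderiv (𝕜 := ℝ)).comp_left (map_zero (InnerProductSpace.toDual ℝ V).symm)

end Gradient

section SobolevSpace

variable {N : ℕ} {v v' : E N → ℝ} {w w' : E N → E N} {φ η : E N → ℝ}

theorem IsTest.contDiff_one (hφ : IsTest φ) : ContDiff ℝ 1 φ := hφ.1.of_le (by simp)

theorem IsTest.differentiable (hφ : IsTest φ) : Differentiable ℝ φ :=
  hφ.contDiff_one.differentiable one_ne_zero

theorem IsTest.continuous_gradient (hφ : IsTest φ) : Continuous (gradient φ) :=
  QLS.continuous_gradient hφ.contDiff_one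

theorem IsTest.memLp_top (hφ : IsTest φ) : MemLp φ ⊤ volume :=
  hφ.1.continuous.memLp_of_hasCompactSupport hφ.2

theorem IsTest.memLp_gradient_top (hφ : IsTest φ) : MemLp (gradient φ) ⊤ volume :=
  hφ.continuous_gradient.memLp_of_hasCompactSupport (hasCompactSupport_gradient hφ.2)

theorem IsTest.mul (hφ : IsTest φ) (hη : IsTest η) : IsTest fun x => φ x * η x :=
  ⟨hφ.1.mul hη.1, hφ.2.mul_right⟩

theorem IsTest.comp_sub_left (hφ : IsTest φ) (x : E N) : IsTest fun z => φ (x - z) :=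
  ⟨hφ.1.comp (contDiff_const.sub contDiff_id), hφ.2.comp_homeomorph (Homeomorph.subLeft x)⟩

/-- `v` belongs to the Sobolev space `H¹(ℝᴺ)` and has weak gradient `w`. In contrast to the
elements of `H1 N`, which are pairs of classes, `v` and `w` are functions. -/
structure MemH1 (v : E N → ℝ) (w : E N → E N) : Prop where
  memLp : MemLp v 2 volume
  memLp_grad : MemLp w 2 volume
  isWeakGradient : IsWeakGradient v w

theorem memH1_of_contDiff {u : E N → ℝ} (hu : ContDiff ℝ 1 u) (huc : HasCompactSupport u) :
    MemH1 u (gradient u) where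
  memLp := hu.continuous.memLp_of_hasCompactSupport huc
  memLp_grad :=
    (continuous_gradient hu).memLp_of_hasCompactSupport (hasCompactSupport_gradient huc)
  isWeakGradient φ hφ y := by
    have hu' : Continuous fun x => fderiv ℝ u x y :=
      (hu.continuous_fderiv one_ne_zero).clm_apply continuous_const
    have hφ' : Continuous fun x => fderiv ℝ φ x y :=
      (hφ.contDiff_one.continuous_fderiv one_ne_zero).clm_apply continuous_const
    simp only [inner_gradient_left, mul_comm (φ _)]
    exact integral_mul_fderiv_eq_neg_fderiv_mul_of_integrable (μ := volume)
      ((hu'.mul hφ.1.continuous).integrable_of_hasCompactSupport hφ.2.mul_left)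
      ((hu.continuous.mul hφ').integrable_of_hasCompactSupport huc.mul_right)
      ((hu.continuous.mul hφ.1.continuous).integrable_of_hasCompactSupport hφ.2.mul_left)
      (fun x _ => hu.differentiable one_ne_zero x) (fun x _ => hφ.differentiable x)

theorem IsTest.memH1 (hφ : IsTest φ) : MemH1 φ (gradient φ) :=
  memH1_of_contDiff hφ.contDiff_one hφ.2

theorem MemH1.integrable_mul_fderiv (h : MemH1 v w) (hφ : IsTest φ) (y : E N) :
    Integrable (fun x => v x * fderiv ℝ φ x y) volume :=
  h.memLp.integrable_mul (hφ.memLp_fderiv y)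

theorem MemH1.integrable_mul_inner (h : MemH1 v w) (hφ : IsTest φ) (y : E N) :
    Integrable (fun x => φ x * inner ℝ (w x) y) volume :=
  hφ.memLp.integrable_mul (h.memLp_grad.inner_const y)

theorem MemH1.congr (h : MemH1 v w) (hv : v =ᵐ[volume] v') (hw : w =ᵐ[volume] w') :
    MemH1 v' w' where
  memLp := h.memLp.ae_eq hv
  memLp_grad := h.memLp_grad.ae_eq hw
  isWeakGradient φ hφ y := by
    have hleft : ∫ x, v' x * fderiv ℝ φ x y = ∫ x, v x * fderiv ℝ φ x y :=
      integral_congr_ae (by filter_upwards [hv] with x hx; rw [hx])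
    have hright : ∫ x, φ x * inner ℝ (w' x) y = ∫ x, φ x * inner ℝ (w x) y :=
      integral_congr_ae (by filter_upwards [hw] with x hx; rw [hx])
    rw [hleft, hright, h.isWeakGradient φ hφ y]

theorem MemH1.sub (h : MemH1 v w) (h' : MemH1 v' w') :
    MemH1 (fun x => v x - v' x) (fun x => w x - w' x) where
  memLp := h.memLp.sub h'.memLp
  memLp_grad := h.memLp_grad.sub h'.memLp_grad
  isWeakGradient φ hφ y := by
    simp only [sub_mul, inner_sub_left, mul_sub]
    rw [integral_sub (h.integrable_mul_fderiv hφ y) (h'.integrable_mul_fderiv hφ y),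
      integral_sub (h.integrable_mul_inner hφ y) (h'.integrable_mul_inner hφ y),
      h.isWeakGradient φ hφ y, h'.isWeakGradient φ hφ y]
    ring

theorem MemH1.mul_isTest (h : MemH1 v w) (hη : IsTest η) :
    MemH1 (fun x => η x * v x) (fun x => η x • w x + v x • gradient η x) := by
  have hηv : MemLp (fun x => η x * v x) 2 volume := h.memLp.mul hη.memLp_top
  have hηw : MemLp (fun x => η x • w x) 2 volume := h.memLp_grad.smul hη.memLp_top
  have hvη : MemLp (fun x => v x • gradient η x) 2 volume := hη.memLp_gradient_top.smul h.memLp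
  refine ⟨hηv, hηw.add hvη, fun φ hφ y => ?_⟩
  have hleibniz : ∀ x, fderiv ℝ (fun x => η x * φ x) x y
      = η x * fderiv ℝ φ x y + φ x * fderiv ℝ η x y := fun x => by
    simp [fderiv_fun_mul (hη.differentiable x) (hφ.differentiable x)]
  have hi₁ : Integrable (fun x => η x * v x * fderiv ℝ φ x y) volume :=
    hηv.integrable_mul (hφ.memLp_fderiv y)
  have hi₂ : Integrable (fun x => φ x * inner ℝ (v x • gradient η x) y) volume :=
    hφ.memLp.integrable_mul (hvη.inner_const y)
  have hi₃ : Integrable (fun x => φ x * inner ℝ (η x • w x) y) volume :=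
    hφ.memLp.integrable_mul (hηw.inner_const y)
  have hleft : ∫ x, v x * fderiv ℝ (fun x => η x * φ x) x y
      = (∫ x, η x * v x * fderiv ℝ φ x y) + ∫ x, φ x * inner ℝ (v x • gradient η x) y := by
    rw [← integral_add hi₁ hi₂]
    refine integral_congr_ae (ae_of_all _ fun x => ?_)
    simp only [hleibniz, real_inner_smul_left, inner_gradient_left]
    ring
  have hright : ∫ x, η x * φ x * inner ℝ (w x) y = ∫ x, φ x * inner ℝ (η x • w x) y := by
    simp only [real_inner_smul_left, mul_left_comm, mul_assoc]
  have hweak := h.isWeakGradient _ (hη.mul hφ) y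
  rw [hleft, hright] at hweak
  simp only [inner_add_left, mul_add]
  rw [integral_add hi₃ hi₂]
  linarith

theorem fderiv_comp_sub_left (hφ : Differentiable ℝ φ) (x z y : E N) :
    fderiv ℝ (fun z => φ (x - z)) z y = - fderiv ℝ φ (x - z) y := by
  have hsub : HasFDerivAt (fun z : E N => x - z) (-ContinuousLinearMap.id ℝ (E N)) z := by
    simpa using (hasFDerivAt_id z).const_sub x
  have hcomp : HasFDerivAt (fun z => φ (x - z))
      ((fderiv ℝ φ (x - z)).comp (-ContinuousLinearMap.id ℝ (E N))) z :=
    (hφ (x - z)).hasFDerivAt.comp z hsub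
  rw [hcomp.fderiv]
  simp

theorem MemH1.gradient_convolution (h : MemH1 v w) (hφ : IsTest φ) (x : E N) :
    gradient (convolution φ v (ContinuousLinearMap.lsmul ℝ ℝ) volume) x
      = convolution φ w (ContinuousLinearMap.lsmul ℝ ℝ) volume x := by
  have hv : LocallyIntegrable v volume := h.memLp.locallyIntegrable one_le_two
  have hw : LocallyIntegrable w volume := h.memLp_grad.locallyIntegrable one_le_two
  have hderiv := hφ.2.hasFDerivAt_convolution_left (ContinuousLinearMap.lsmul ℝ ℝ)
    hφ.contDiff_one hv x
  have hex := (hφ.2.fderiv (𝕜 := ℝ)).convolutionExists_left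
    ((ContinuousLinearMap.lsmul ℝ ℝ).precompL (E N))
    (hφ.contDiff_one.continuous_fderiv one_ne_zero) hv x
  have hint : Integrable (fun z => φ (x - z) • w z) volume :=
    (hφ.2.convolutionExists_left (ContinuousLinearMap.lsmul ℝ ℝ) hφ.1.continuous hw
      x).integrable_swap
  refine ext_inner_right ℝ fun y => ?_
  rw [inner_gradient_left, hderiv.fderiv, convolution_eq_swap,
    ContinuousLinearMap.integral_apply hex.integrable_swap]
  calc ∫ z, ((ContinuousLinearMap.lsmul ℝ ℝ).precompL (E N)) (fderiv ℝ φ (x - z)) (v z) y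
      = - ∫ z, v z * fderiv ℝ (fun z => φ (x - z)) z y := by
        rw [← integral_neg]
        refine integral_congr_ae (ae_of_all _ fun z => ?_)
        simp [fderiv_comp_sub_left hφ.differentiable, ContinuousLinearMap.precompL_apply, mul_comm]
    _ = ∫ z, φ (x - z) * inner ℝ (w z) y := by
        rw [h.isWeakGradient _ (hφ.comp_sub_left x) y, neg_neg]
    _ = ∫ z, inner ℝ y (φ (x - z) • w z) := by
        simp only [real_inner_smul_right, real_inner_comm]
    _ = inner ℝ (convolution φ w (ContinuousLinearMap.lsmul ℝ ℝ) volume x) y := by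
        rw [integral_inner hint, real_inner_comm, convolution_eq_swap]
        rfl

theorem MemH1.exists_isTest_of_hasCompactSupport (h : MemH1 v w) (hv : HasCompactSupport v)
    {ε : ENNReal} (hε : 0 < ε) :
    ∃ φ : E N → ℝ, IsTest φ ∧ eLpNorm (fun x => φ x - v x) 2 volume ≤ ε ∧
      eLpNorm (fun x => gradient φ x - w x) 2 volume ≤ ε := by
  have htranslate := ((tendsto_eLpNorm_translate_sub one_le_two ENNReal.ofNat_ne_top
    h.memLp).eventually (gt_mem_nhds hε)).and ((tendsto_eLpNorm_translate_sub one_le_two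
      ENNReal.ofNat_ne_top h.memLp_grad).eventually (gt_mem_nhds hε))
  obtain ⟨r, hr, hball⟩ := Metric.eventually_nhds_iff_ball.1 htranslate
  let B : ContDiffBump (0 : E N) := ⟨r / 2, r, by positivity, by linarith⟩
  let ρ : E N → ℝ := B.normed volume
  have hρ : IsTest ρ := ⟨B.contDiff_normed, B.hasCompactSupport_normed⟩
  have hsupp : ∀ y, ρ y ≠ 0 → y ∈ Metric.ball (0 : E N) r := fun y (hy : y ∈ ρ.support) => by
    rwa [B.support_normed_eq] at hy
  refine ⟨convolution ρ v (ContinuousLinearMap.lsmul ℝ ℝ) volume, ⟨?_, ?_⟩, ?_, ?_⟩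
  · exact hρ.2.contDiff_convolution_left _ hρ.1 (h.memLp.locallyIntegrable one_le_two)
  · exact hρ.2.convolution _ hv
  · exact eLpNorm_convolution_sub_le one_le_two ENNReal.ofNat_ne_top hρ.1.continuous hρ.2
      B.nonneg_normed B.integral_normed h.memLp fun y hy => (hball y (hsupp y hy)).1.le
  · simp_rw [h.gradient_convolution hρ]
    exact eLpNorm_convolution_sub_le one_le_two ENNReal.ofNat_ne_top hρ.1.continuous hρ.2
      B.nonneg_normed B.integral_normed h.memLp_grad fun y hy => (hball y (hsupp y hy)).2.le

end SobolevSpace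

/-- A smooth cutoff, equal to one on the unit ball and supported in the ball of radius two. -/
def cutoffBump (N : ℕ) : ContDiffBump (0 : E N) := ⟨1, 2, one_pos, one_lt_two⟩

/-- The cutoff rescaled to equal one on the ball of radius `R`. -/
def cutoff {N : ℕ} (R : ℝ) (x : E N) : ℝ := cutoffBump N (R⁻¹ • x)

section Cutoff

variable {N : ℕ} {R : ℝ} {x : E N}

theorem isTest_cutoffBump (N : ℕ) : IsTest (cutoffBump N) :=
  ⟨(cutoffBump N).contDiff, (cutoffBump N).hasCompactSupport⟩

theorem isTest_cutoff (hR : 0 < R) : IsTest (cutoff R : E N → ℝ) :=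
  ⟨(cutoffBump N).contDiff.comp (contDiff_const_smul _),
    (cutoffBump N).hasCompactSupport.comp_homeomorph
      (Homeomorph.smulOfNeZero R⁻¹ (inv_ne_zero hR.ne'))⟩

theorem cutoff_nonneg (R : ℝ) (x : E N) : 0 ≤ cutoff R x := (cutoffBump N).nonneg

theorem cutoff_le_one (R : ℝ) (x : E N) : cutoff R x ≤ 1 := (cutoffBump N).le_one

theorem norm_cutoff_le_one (R : ℝ) (x : E N) : ‖cutoff R x‖ ≤ 1 := by
  rw [Real.norm_of_nonneg (cutoff_nonneg R x)]
  exact cutoff_le_one R x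

theorem cutoff_eq_one (hR : 0 < R) (hx : ‖x‖ ≤ R) : cutoff R x = 1 := by
  refine (cutoffBump N).one_of_mem_closedBall ?_
  rw [mem_closedBall_zero_iff, norm_smul, norm_inv, Real.norm_of_nonneg hR.le]
  change R⁻¹ * ‖x‖ ≤ 1
  rwa [inv_mul_le_iff₀ hR, mul_one]

theorem cutoff_eq_zero (hR : 0 < R) (hx : 2 * R ≤ ‖x‖) : cutoff R x = 0 := by
  refine (cutoffBump N).zero_of_le_dist ?_
  rw [dist_zero_right, norm_smul, norm_inv, Real.norm_of_nonneg hR.le]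
  change 2 ≤ R⁻¹ * ‖x‖
  rwa [le_inv_mul_iff₀ hR, mul_comm]

theorem gradient_cutoff (R : ℝ) (x : E N) :
    gradient (cutoff R) x = R⁻¹ • gradient (cutoffBump N) (R⁻¹ • x) := by
  have hchain : HasFDerivAt (cutoff R : E N → ℝ)
      ((fderiv ℝ (cutoffBump N) (R⁻¹ • x)).comp (R⁻¹ • ContinuousLinearMap.id ℝ (E N))) x :=
    ((isTest_cutoffBump N).differentiable _).hasFDerivAt.comp x
      ((hasFDerivAt_id x).const_smul R⁻¹)
  refine ext_inner_right ℝ fun y => ?_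
  rw [inner_gradient_left, hchain.fderiv, real_inner_smul_left, inner_gradient_left]
  simp

theorem gradient_cutoff_eq_zero_of_lt (hR : 0 < R) (hx : ‖x‖ < R) :
    gradient (cutoff R) x = 0 := by
  have hone : (cutoff R : E N → ℝ) =ᶠ[𝓝 x] fun _ => 1 := by
    filter_upwards [(isOpen_lt continuous_norm continuous_const).mem_nhds hx] with z hz
    exact cutoff_eq_one hR (le_of_lt hz)
  rw [gradient, hone.fderiv_eq]
  simp

theorem gradient_cutoff_eq_zero_of_gt (hR : 0 < R) (hx : 2 * R < ‖x‖) :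
    gradient (cutoff R) x = 0 := by
  have hzero : (cutoff R : E N → ℝ) =ᶠ[𝓝 x] fun _ => 0 := by
    filter_upwards [(isOpen_lt continuous_const continuous_norm).mem_nhds hx] with z hz
    exact cutoff_eq_zero hR (le_of_lt hz)
  rw [gradient, hzero.fderiv_eq]
  simp

theorem exists_norm_gradient_cutoffBump_le (N : ℕ) :
    ∃ C : ℝ, 0 < C ∧ ∀ x, ‖gradient (cutoffBump N) x‖ ≤ C := by
  obtain ⟨C, hC⟩ := (isTest_cutoffBump N).continuous_gradient.bounded_above_of_compact_support
    (hasCompactSupport_gradient (isTest_cutoffBump N).2)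
  exact ⟨max C 1, by positivity, fun x => (hC x).trans (le_max_left _ _)⟩

theorem norm_gradient_cutoff_le {C : ℝ} (hC : ∀ x, ‖gradient (cutoffBump N) x‖ ≤ C)
    (hR : 0 < R) (x : E N) : ‖gradient (cutoff R) x‖ ≤ C / R := by
  rw [gradient_cutoff, norm_smul, norm_inv, Real.norm_of_nonneg hR.le, div_eq_inv_mul]
  gcongr
  exact hC _

theorem abs_cutoffBump_sub_le {C : ℝ} (hC : ∀ x, ‖gradient (cutoffBump N) x‖ ≤ C) (x y : E N) :
    |cutoffBump N x - cutoffBump N y| ≤ C * ‖x - y‖ :=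
  Convex.norm_image_sub_le_of_norm_fderiv_le (𝕜 := ℝ) (s := univ)
    (fun z _ => (isTest_cutoffBump N).differentiable z)
    (fun z _ => (norm_gradient _ z).symm.trans_le (hC z)) convex_univ trivial trivial

theorem tendsto_cutoff (x : E N) :
    Tendsto (fun n : ℕ => cutoff ((n : ℝ) + 1) x) atTop (𝓝 1) := by
  refine tendsto_const_nhds.congr' ?_
  filter_upwards [eventually_ge_atTop ⌈‖x‖⌉₊] with n hn
  have hxn : ‖x‖ ≤ n := Nat.ceil_le.1 hn
  exact (cutoff_eq_one (by positivity) (by linarith)).symm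

theorem tendsto_gradient_cutoff (x : E N) :
    Tendsto (fun n : ℕ => gradient (cutoff ((n : ℝ) + 1)) x) atTop (𝓝 0) := by
  refine tendsto_const_nhds.congr' ?_
  filter_upwards [eventually_ge_atTop ⌈‖x‖⌉₊] with n hn
  have hxn : ‖x‖ ≤ n := Nat.ceil_le.1 hn
  exact (gradient_cutoff_eq_zero_of_lt (by positivity) (by linarith)).symm

end Cutoff

section Density

variable {N : ℕ} {v : E N → ℝ} {w : E N → E N}

theorem MemH1.cutoff_mul (h : MemH1 v w) (n : ℕ) :
    MemH1 (fun x => cutoff ((n : ℝ) + 1) x * v x)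
      (fun x => cutoff ((n : ℝ) + 1) x • w x + v x • gradient (cutoff ((n : ℝ) + 1)) x) :=
  h.mul_isTest (isTest_cutoff (by positivity))

theorem MemH1.tendsto_eLpNorm_cutoff_mul_sub (h : MemH1 v w) :
    Tendsto (fun n : ℕ => eLpNorm (fun x => cutoff ((n : ℝ) + 1) x * v x - v x) 2 volume)
      atTop (𝓝 0) := by
  refine tendsto_eLpNorm_zero_of_dominated (b := fun x => 2 * ‖v x‖) two_ne_zero
    ENNReal.ofNat_ne_top (fun n => (h.cutoff_mul n).memLp.1.sub h.memLp.1)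
    (h.memLp.norm.const_mul 2) (fun n => ae_of_all _ fun x => ?_) (ae_of_all _ fun x => ?_)
  · calc ‖cutoff ((n : ℝ) + 1) x * v x - v x‖ ≤ ‖cutoff ((n : ℝ) + 1) x‖ * ‖v x‖ + ‖v x‖ := by
          rw [← norm_mul]
          exact norm_sub_le _ _
      _ ≤ 1 * ‖v x‖ + ‖v x‖ := by gcongr; exact norm_cutoff_le_one _ _
      _ = 2 * ‖v x‖ := by ring
  · simpa using ((tendsto_cutoff x).mul_const (v x)).sub_const (v x)

theorem MemH1.tendsto_eLpNorm_gradient_cutoff_mul_sub (h : MemH1 v w) :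
    Tendsto (fun n : ℕ => eLpNorm (fun x => cutoff ((n : ℝ) + 1) x • w x
      + v x • gradient (cutoff ((n : ℝ) + 1)) x - w x) 2 volume) atTop (𝓝 0) := by
  obtain ⟨C, hC0, hC⟩ := exists_norm_gradient_cutoffBump_le N
  have hgrad : ∀ (n : ℕ) (x : E N), ‖gradient (cutoff ((n : ℝ) + 1)) x‖ ≤ C := fun n x =>
    (norm_gradient_cutoff_le hC (by positivity) x).trans (div_le_self hC0.le (by simp))
  refine tendsto_eLpNorm_zero_of_dominated (b := fun x => 2 * ‖w x‖ + C * ‖v x‖) two_ne_zero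
    ENNReal.ofNat_ne_top (fun n => (h.cutoff_mul n).memLp_grad.1.sub h.memLp_grad.1)
    ((h.memLp_grad.norm.const_mul 2).add (h.memLp.norm.const_mul C))
    (fun n => ae_of_all _ fun x => ?_) (ae_of_all _ fun x => ?_)
  · calc _ ≤ ‖cutoff ((n : ℝ) + 1) x • w x‖ + ‖v x • gradient (cutoff ((n : ℝ) + 1)) x‖
          + ‖w x‖ := (norm_sub_le _ _).trans (by gcongr; exact norm_add_le _ _)
      _ ≤ 1 * ‖w x‖ + ‖v x‖ * C + ‖w x‖ := by
          rw [norm_smul, norm_smul]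
          gcongr
          · exact norm_cutoff_le_one _ _
          · exact hgrad n x
      _ = 2 * ‖w x‖ + C * ‖v x‖ := by ring
  · simpa using (((tendsto_cutoff x).smul_const (w x)).add
      ((tendsto_gradient_cutoff x).const_smul (v x))).sub_const (w x)

theorem MemH1.exists_isTest (h : MemH1 v w) {ε : ENNReal} (hε : 0 < ε) :
    ∃ φ : E N → ℝ, IsTest φ ∧ eLpNorm (fun x => φ x - v x) 2 volume ≤ ε ∧
      eLpNorm (fun x => gradient φ x - w x) 2 volume ≤ ε := by
  have hε2 : 0 < ε / 2 := ENNReal.half_pos hε.ne'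
  obtain ⟨n, hn, hn'⟩ := ((h.tendsto_eLpNorm_cutoff_mul_sub.eventually (gt_mem_nhds hε2)).and
    (h.tendsto_eLpNorm_gradient_cutoff_mul_sub.eventually (gt_mem_nhds hε2))).exists
  obtain ⟨φ, hφ, hφn, hφn'⟩ := (h.cutoff_mul n).exists_isTest_of_hasCompactSupport
    (isTest_cutoff (by positivity)).2.mul_right hε2
  refine ⟨φ, hφ, ?_, ?_⟩
  · calc eLpNorm (fun x => φ x - v x) 2 volume
        ≤ eLpNorm (fun x => φ x - cutoff ((n : ℝ) + 1) x * v x) 2 volume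
          + eLpNorm (fun x => cutoff ((n : ℝ) + 1) x * v x - v x) 2 volume := by
          convert! eLpNorm_add_le (μ := volume) (hφ.memLp.1.sub (h.cutoff_mul n).memLp.1)
            ((h.cutoff_mul n).memLp.1.sub h.memLp.1) one_le_two using 2
          ext x
          simp
      _ ≤ ε / 2 + ε / 2 := add_le_add hφn hn.le
      _ = ε := ENNReal.add_halves ε
  · set wn := fun x => cutoff ((n : ℝ) + 1) x • w x + v x • gradient (cutoff ((n : ℝ) + 1)) x
    calc eLpNorm (fun x => gradient φ x - w x) 2 volume
        ≤ eLpNorm (fun x => gradient φ x - wn x) 2 volume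
          + eLpNorm (fun x => wn x - w x) 2 volume := by
          convert! eLpNorm_add_le (μ := volume)
            (hφ.memH1.memLp_grad.1.sub (h.cutoff_mul n).memLp_grad.1)
            ((h.cutoff_mul n).memLp_grad.1.sub h.memLp_grad.1) one_le_two using 2
          ext1 x
          simp
      _ ≤ ε / 2 + ε / 2 := add_le_add hφn' hn'.le
      _ = ε := ENNReal.add_halves ε

theorem MemH1.exists_seq_isTest (h : MemH1 v w) :
    ∃ φ : ℕ → E N → ℝ, (∀ n, IsTest (φ n)) ∧
      Tendsto (fun n => eLpNorm (fun x => φ n x - v x) 2 volume) atTop (𝓝 0) ∧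
      Tendsto (fun n => eLpNorm (fun x => gradient (φ n) x - w x) 2 volume) atTop (𝓝 0) ∧
      ∀ᵐ x, Tendsto (fun n => φ n x) atTop (𝓝 (v x)) := by
  have hpos : ∀ n : ℕ, (0 : ENNReal) < ((n : ENNReal) + 1)⁻¹ := fun n => by simp
  have hlim : Tendsto (fun n : ℕ => ((n : ENNReal) + 1)⁻¹) atTop (𝓝 0) := by
    simpa using (tendsto_add_atTop_iff_nat 1).2 ENNReal.tendsto_inv_nat_nhds_zero
  choose φ hφ hle hle' using fun n : ℕ => h.exists_isTest (hpos n)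
  have hφv := tendsto_of_tendsto_of_tendsto_of_le_of_le tendsto_const_nhds hlim
    (fun _ => zero_le) hle
  have hφw := tendsto_of_tendsto_of_tendsto_of_le_of_le tendsto_const_nhds hlim
    (fun _ => zero_le) hle'
  obtain ⟨ns, hns, hae⟩ := (tendstoInMeasure_of_tendsto_eLpNorm (μ := volume) two_ne_zero
    (fun n => (hφ n).memLp.1) h.memLp.1 hφv).exists_seq_tendsto_ae
  exact ⟨fun n => φ (ns n), fun n => hφ _, hφv.comp hns.tendsto_atTop,
    hφw.comp hns.tendsto_atTop, hae⟩

end Density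

/-! ### The Sobolev inequality and the chain rule -/

/-- The critical Sobolev exponent `2* = 2N / (N - 2)`. -/
def crit (N : ℕ) : ℝ := 2 * N / (N - 2)

theorem two_lt_crit {N : ℕ} (hN : 3 ≤ N) : 2 < crit N := by
  have hN' : (3 : ℝ) ≤ N := by exact_mod_cast hN
  rw [crit, lt_div_iff₀ (by linarith)]
  linarith

/-- The constant of the Gagliardo–Nirenberg–Sobolev inequality `‖v‖_{2*} ≤ S ‖∇v‖₂`. -/
def sobolevConst (N : ℕ) : NNReal :=
  SNormLESNormFDerivOfEqConst ℝ (volume : Measure (E N)) 2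

section Sobolev

variable {N : ℕ} {v φ : E N → ℝ} {w : E N → E N}

theorem IsTest.eLpNorm_crit_le (hN : 3 ≤ N) (hφ : IsTest φ) :
    eLpNorm φ (ENNReal.ofReal (crit N)) volume
      ≤ sobolevConst N * eLpNorm (gradient φ) 2 volume := by
  have hN' : (N : ℝ) - 2 ≠ 0 := by
    have : (3 : ℝ) ≤ N := by exact_mod_cast hN
    linarith
  have hcrit : ((crit N).toNNReal : ℝ)⁻¹ = (2 : NNReal)⁻¹ - (Module.finrank ℝ (E N) : ℝ)⁻¹ := by
    rw [Real.coe_toNNReal _ (by linarith [two_lt_crit hN])]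
    simp only [crit, finrank_euclideanSpace, Fintype.card_fin]
    push_cast
    field_simp
  have hdim : 0 < Module.finrank ℝ (E N) := by
    simp only [finrank_euclideanSpace, Fintype.card_fin]
    omega
  calc eLpNorm φ (ENNReal.ofReal (crit N)) volume
      ≤ sobolevConst N * eLpNorm (fderiv ℝ φ) 2 volume :=
        eLpNorm_le_eLpNorm_fderiv_of_eq (μ := volume) hφ.contDiff_one hφ.2 one_le_two hdim hcrit
    _ = sobolevConst N * eLpNorm (gradient φ) 2 volume := by
        congr 1
        exact eLpNorm_congr_norm_ae (ae_of_all _ fun x => (norm_gradient φ x).symm)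

theorem MemH1.eLpNorm_crit_le (hN : 3 ≤ N) (h : MemH1 v w) :
    eLpNorm v (ENNReal.ofReal (crit N)) volume ≤ sobolevConst N * eLpNorm w 2 volume := by
  obtain ⟨φ, hφ, -, hφw, hae⟩ := h.exists_seq_isTest
  have hbound : ∀ n, eLpNorm (φ n) (ENNReal.ofReal (crit N)) volume ≤ sobolevConst N *
      (eLpNorm w 2 volume + eLpNorm (fun x => gradient (φ n) x - w x) 2 volume) := fun n => by
    refine ((hφ n).eLpNorm_crit_le hN).trans ?_
    gcongr
    convert! eLpNorm_add_le (μ := volume) h.memLp_grad.1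
      ((hφ n).memH1.memLp_grad.1.sub h.memLp_grad.1) one_le_two using 2
    ext1 x
    simp
  have hlim : Tendsto (fun n => (sobolevConst N : ENNReal) * (eLpNorm w 2 volume
      + eLpNorm (fun x => gradient (φ n) x - w x) 2 volume)) atTop
      (𝓝 (sobolevConst N * (eLpNorm w 2 volume + 0))) :=
    ENNReal.Tendsto.const_mul (tendsto_const_nhds.add hφw) (Or.inr ENNReal.coe_ne_top)
  rw [add_zero] at hlim
  calc eLpNorm v (ENNReal.ofReal (crit N)) volume
      ≤ liminf (fun n => eLpNorm (φ n) (ENNReal.ofReal (crit N)) volume) atTop :=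
        Lp.eLpNorm_lim_le_liminf_eLpNorm
          (fun n => (hφ n).1.continuous.aestronglyMeasurable) v hae
    _ ≤ sobolevConst N * eLpNorm w 2 volume :=
        (liminf_le_liminf (Eventually.of_forall hbound)).trans_eq hlim.liminf_eq

theorem MemH1.memLp_crit (hN : 3 ≤ N) (h : MemH1 v w) :
    MemLp v (ENNReal.ofReal (crit N)) volume :=
  ⟨h.memLp.1, (h.eLpNorm_crit_le hN).trans_lt
    (ENNReal.mul_lt_top ENNReal.coe_lt_top h.memLp_grad.2)⟩

end Sobolev

section Duality

variable {α H : Type*} [MeasurableSpace α] {μ : Measure α} [NormedAddCommGroup H]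
  [InnerProductSpace ℝ H] {p q : ENNReal} [ENNReal.HolderConjugate p q]

theorem integrable_inner_of_memLp {a b : α → H} (ha : MemLp a p μ) (hb : MemLp b q μ) :
    Integrable (fun x => inner ℝ (a x) (b x)) μ :=
  (ha.norm.integrable_mul hb.norm).mono' (ha.1.inner hb.1)
    (ae_of_all _ fun _ => norm_inner_le_norm _ _)

theorem eLpNorm_inner_le {a b : α → H} (ha : MemLp a p μ) (hb : MemLp b q μ) :
    eLpNorm (fun x => (inner ℝ (a x) (b x) : ℝ)) 1 μ ≤ eLpNorm a p μ * eLpNorm b q μ := by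
  simpa using eLpNorm_le_eLpNorm_mul_eLpNorm_of_nnnorm (p := p) (q := q) (r := 1) ha.1 hb.1
    (fun a b : H => (inner ℝ a b : ℝ)) 1
    (ae_of_all _ fun x => by simpa using nnnorm_inner_le_nnnorm (𝕜 := ℝ) (a x) (b x))

theorem tendsto_integral_inner {h φ' : α → H} (hh : MemLp h p μ) {φ : ℕ → α → H}
    (hφ : ∀ n, MemLp (φ n) q μ) (hφ' : MemLp φ' q μ)
    (hlim : Tendsto (fun n => eLpNorm (fun x => φ n x - φ' x) q μ) atTop (𝓝 0)) :
    Tendsto (fun n => ∫ x, inner ℝ (h x) (φ n x) ∂μ) atTop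
      (𝓝 (∫ x, inner ℝ (h x) (φ' x) ∂μ)) := by
  have hprod : Tendsto (fun n => eLpNorm h p μ * eLpNorm (fun x => φ n x - φ' x) q μ) atTop
      (𝓝 0) := by
    simpa using ENNReal.Tendsto.const_mul hlim (Or.inr hh.2.ne)
  refine tendsto_integral_of_L1' _ (integrable_inner_of_memLp hh hφ').1
    (Eventually.of_forall fun n => integrable_inner_of_memLp hh (hφ n)) ?_
  refine tendsto_of_tendsto_of_tendsto_of_le_of_le tendsto_const_nhds hprod
    (fun _ => zero_le) fun n => ?_
  convert! eLpNorm_inner_le hh ((hφ n).sub hφ') using 2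
  ext x
  simp [inner_sub_right]

end Duality

section WeakEquation

variable {N : ℕ} {w w' : E N → E N} {h₁ h₂ φ : E N → ℝ} {q : ENNReal}
  [ENNReal.HolderConjugate q (ENNReal.ofReal (crit N))]

theorem MemH1.integral_add_mul (hN : 3 ≤ N) (hφ : MemH1 φ w') (hh₁ : MemLp h₁ 2 volume)
    (hh₂ : MemLp h₂ q volume) :
    Integrable (fun x => (h₁ x + h₂ x) * φ x) volume ∧
      ∫ x, (h₁ x + h₂ x) * φ x = (∫ x, inner ℝ (h₁ x) (φ x)) + ∫ x, inner ℝ (h₂ x) (φ x) := by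
  have hi₁ : Integrable (fun x => h₁ x * φ x) volume := hh₁.integrable_mul hφ.memLp
  have hi₂ : Integrable (fun x => h₂ x * φ x) volume := hh₂.integrable_mul (hφ.memLp_crit hN)
  simp only [add_mul, RCLike.inner_apply', conj_trivial]
  exact ⟨hi₁.add hi₂, integral_add hi₁ hi₂⟩

theorem MemH1.weak_equation (hN : 3 ≤ N) (hw : MemLp w 2 volume) (hh₁ : MemLp h₁ 2 volume)
    (hh₂ : MemLp h₂ q volume)
    (heq : ∀ φ : E N → ℝ, IsTest φ →
      ∫ x, inner ℝ (w x) (gradient φ x) = ∫ x, (h₁ x + h₂ x) * φ x)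
    (hφ : MemH1 φ w') :
    ∫ x, inner ℝ (w x) (w' x) = ∫ x, (h₁ x + h₂ x) * φ x := by
  obtain ⟨ψ, hψ, hψφ, hψw', -⟩ := hφ.exists_seq_isTest
  have hψcrit : Tendsto (fun n => eLpNorm (fun x => ψ n x - φ x) (ENNReal.ofReal (crit N)) volume)
      atTop (𝓝 0) := by
    have hlim : Tendsto (fun n => sobolevConst N
        * eLpNorm (fun x => gradient (ψ n) x - w' x) 2 volume) atTop (𝓝 0) := by
      simpa using ENNReal.Tendsto.const_mul hψw' (Or.inr (ENNReal.coe_ne_top (r := sobolevConst N)))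
    exact tendsto_of_tendsto_of_tendsto_of_le_of_le tendsto_const_nhds hlim (fun _ => zero_le)
      (fun n => ((hψ n).memH1.sub hφ).eLpNorm_crit_le hN)
  have hleft := tendsto_integral_inner hw (fun n => (hψ n).memH1.memLp_grad) hφ.memLp_grad hψw'
  have hright₁ := tendsto_integral_inner hh₁ (fun n => (hψ n).memLp) hφ.memLp hψφ
  have hright₂ := tendsto_integral_inner hh₂ (fun n => (hψ n).memH1.memLp_crit hN)
    (hφ.memLp_crit hN) hψcrit
  rw [(hφ.integral_add_mul hN hh₁ hh₂).2]
  refine tendsto_nhds_unique hleft ((hright₁.add hright₂).congr fun n => ?_)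
  rw [heq _ (hψ n), ((hψ n).memH1.integral_add_mul hN hh₁ hh₂).2]

end WeakEquation

section ChainRule

variable {N : ℕ} {v : E N → ℝ} {w : E N → E N}

theorem MemH1.of_tendsto {u : ℕ → E N → ℝ} {u' : ℕ → E N → E N} (hu : ∀ n, MemH1 (u n) (u' n))
    (hv : MemLp v 2 volume) (hw : MemLp w 2 volume)
    (huv : Tendsto (fun n => eLpNorm (fun x => u n x - v x) 2 volume) atTop (𝓝 0))
    (huw : Tendsto (fun n => eLpNorm (fun x => u' n x - w x) 2 volume) atTop (𝓝 0)) :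
    MemH1 v w := by
  refine ⟨hv, hw, fun χ hχ y => ?_⟩
  have hχy : MemLp (fun x => χ x • y) 2 volume :=
    (hχ.1.continuous.smul continuous_const).memLp_of_hasCompactSupport hχ.2.smul_right
  have hleft := tendsto_integral_inner (hχ.memLp_fderiv y) (fun n => (hu n).memLp) hv huv
  have hright := tendsto_integral_inner hχy (fun n => (hu n).memLp_grad) hw huw
  simp only [RCLike.inner_apply', conj_trivial, mul_comm (fderiv ℝ χ _ y)] at hleft
  simp only [real_inner_smul_left] at hright
  simp only [real_inner_comm y]
  refine tendsto_nhds_unique hleft (hright.neg.congr fun n => ?_)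
  simpa only [real_inner_comm] using ((hu n).isWeakGradient χ hχ y).symm

theorem tendsto_eLpNorm_smul_sub {α H : Type*} [MeasurableSpace α] {μ : Measure α}
    [NormedAddCommGroup H] [NormedSpace ℝ H] {p : ENNReal} (hp1 : 1 ≤ p) (hp : p ≠ ⊤)
    {c : ℕ → α → ℝ} {c' : α → ℝ} {a : ℕ → α → H} {a' : α → H}
    (hc : ∀ n, AEStronglyMeasurable (c n) μ) (hc' : AEStronglyMeasurable c' μ)
    (hc1 : ∀ n x, ‖c n x‖ ≤ 1) (hc1' : ∀ x, ‖c' x‖ ≤ 1)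
    (hcc : ∀ᵐ x ∂μ, Tendsto (fun n => c n x) atTop (𝓝 (c' x)))
    (ha : ∀ n, AEStronglyMeasurable (a n) μ) (ha' : MemLp a' p μ)
    (haa : Tendsto (fun n => eLpNorm (fun x => a n x - a' x) p μ) atTop (𝓝 0)) :
    Tendsto (fun n => eLpNorm (fun x => c n x • a n x - c' x • a' x) p μ) atTop (𝓝 0) := by
  have hcoeff : Tendsto (fun n => eLpNorm (fun x => (c n x - c' x) • a' x) p μ) atTop (𝓝 0) := by
    refine tendsto_eLpNorm_zero_of_dominated (b := fun x => 2 * ‖a' x‖)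
      (one_pos.trans_le hp1).ne' hp (fun n => ((hc n).sub hc').smul ha'.1)
      (ha'.norm.const_mul 2) (fun n => ae_of_all _ fun x => ?_) ?_
    · rw [norm_smul]
      gcongr
      exact (norm_sub_le _ _).trans (by linarith [hc1 n x, hc1' x])
    · filter_upwards [hcc] with x hx
      simpa using (hx.sub_const (c' x)).smul_const (a' x)
  have hlim := haa.add hcoeff
  rw [add_zero] at hlim
  refine tendsto_of_tendsto_of_tendsto_of_le_of_le tendsto_const_nhds hlim (fun _ => zero_le)
    fun n => ?_
  calc eLpNorm (fun x => c n x • a n x - c' x • a' x) p μ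
      = eLpNorm ((fun x => c n x • (a n x - a' x)) + fun x => (c n x - c' x) • a' x) p μ := by
        congr 1
        ext1 x
        simp only [Pi.add_apply, smul_sub, sub_smul]
        abel
    _ ≤ eLpNorm (fun x => c n x • (a n x - a' x)) p μ
        + eLpNorm (fun x => (c n x - c' x) • a' x) p μ :=
      eLpNorm_add_le ((hc n).smul ((ha n).sub ha'.1)) (((hc n).sub hc').smul ha'.1) hp1
    _ ≤ eLpNorm (fun x => a n x - a' x) p μ + eLpNorm (fun x => (c n x - c' x) • a' x) p μ := by
      gcongr
      refine eLpNorm_mono fun x => ?_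
      rw [norm_smul]
      exact mul_le_of_le_one_left (norm_nonneg _) (hc1 n x)

theorem gradient_comp {V : Type*} [NormedAddCommGroup V] [InnerProductSpace ℝ V] [CompleteSpace V]
    {ψ : ℝ → ℝ} {u : V → ℝ} {d : ℝ} {x : V} (hψ : HasDerivAt ψ d (u x))
    (hu : DifferentiableAt ℝ u x) : gradient (fun x => ψ (u x)) x = d • gradient u x := by
  have hchain : fderiv ℝ (fun x => ψ (u x)) x = d • fderiv ℝ u x :=
    (hψ.comp_hasFDerivAt x hu.hasFDerivAt).fderiv
  refine ext_inner_right ℝ fun y => ?_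
  rw [inner_gradient_left, real_inner_smul_left, inner_gradient_left, hchain]
  simp

theorem abs_sub_le_of_abs_deriv_le_one {ψ θ : ℝ → ℝ} (hψ : ∀ s, HasDerivAt ψ (θ s) s)
    (hθ1 : ∀ s, |θ s| ≤ 1) (a b : ℝ) : |ψ a - ψ b| ≤ |a - b| := by
  simpa using Convex.norm_image_sub_le_of_norm_hasDerivWithin_le (s := univ) (C := 1)
    (fun x _ => (hψ x).hasDerivWithinAt) (fun x _ => hθ1 x) convex_univ (mem_univ b) (mem_univ a)

theorem IsTest.memH1_comp {φ : E N → ℝ} (hφ : IsTest φ) {ψ θ : ℝ → ℝ}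
    (hψ : ∀ s, HasDerivAt ψ (θ s) s) (hθ : Continuous θ) (hψ0 : ψ 0 = 0) :
    MemH1 (fun x => ψ (φ x)) (fun x => θ (φ x) • gradient φ x) := by
  have hψ1 : ContDiff ℝ 1 ψ :=
    contDiff_one_iff_deriv.2 ⟨fun s => (hψ s).differentiableAt, by
      rwa [show deriv ψ = θ from funext fun s => (hψ s).deriv]⟩
  have hgrad : gradient (fun x => ψ (φ x)) = fun x => θ (φ x) • gradient φ x :=
    funext fun x => gradient_comp (hψ (φ x)) (hφ.differentiable x)
  exact hgrad ▸ memH1_of_contDiff (hψ1.comp hφ.contDiff_one) (hφ.2.comp_left hψ0)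

theorem MemH1.comp (h : MemH1 v w) {ψ θ : ℝ → ℝ} (hψ : ∀ s, HasDerivAt ψ (θ s) s)
    (hθ : Continuous θ) (hθ1 : ∀ s, |θ s| ≤ 1) (hψ0 : ψ 0 = 0) :
    MemH1 (fun x => ψ (v x)) (fun x => θ (v x) • w x) := by
  have hlip := abs_sub_le_of_abs_deriv_le_one hψ hθ1
  have hψc : Continuous ψ := continuous_iff_continuousAt.2 fun s => (hψ s).continuousAt
  have hθm : AEStronglyMeasurable (fun x => θ (v x)) volume :=
    hθ.comp_aestronglyMeasurable h.memLp.1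
  obtain ⟨φ, hφ, hφv, hφw, hae⟩ := h.exists_seq_isTest
  refine MemH1.of_tendsto (fun n => (hφ n).memH1_comp hψ hθ hψ0) ?_ ?_ ?_ ?_
  · exact h.memLp.of_le (hψc.comp_aestronglyMeasurable h.memLp.1)
      (ae_of_all _ fun x => by simpa [hψ0] using hlip (v x) 0)
  · refine h.memLp_grad.of_le (hθm.smul h.memLp_grad.1) (ae_of_all _ fun x => ?_)
    rw [norm_smul]
    exact mul_le_of_le_one_left (norm_nonneg _) (hθ1 _)
  · exact tendsto_of_tendsto_of_tendsto_of_le_of_le tendsto_const_nhds hφv (fun _ => zero_le)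
      (fun n => eLpNorm_mono fun x => hlip _ _)
  · refine tendsto_eLpNorm_smul_sub one_le_two ENNReal.ofNat_ne_top
      (fun n => hθ.comp_aestronglyMeasurable (hφ n).memLp.1) hθm (fun _ _ => hθ1 _)
      (fun _ => hθ1 _) ?_ (fun n => (hφ n).memH1.memLp_grad.1) h.memLp_grad hφw
    filter_upwards [hae] with x hx using (hθ.tendsto _).comp hx

end ChainRule

section Ramp

theorem hasDerivAt_max_zero_sq (s : ℝ) :
    HasDerivAt (fun s : ℝ => max s 0 ^ 2) (2 * max s 0) s := by
  rcases lt_trichotomy s 0 with hs | rfl | hs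
  · have hzero : (fun s : ℝ => max s 0 ^ 2) =ᶠ[𝓝 s] fun _ => 0 := by
      filter_upwards [gt_mem_nhds hs] with t ht
      simp [max_eq_right ht.le]
    rw [max_eq_right hs.le, mul_zero]
    exact (hasDerivAt_const s (0 : ℝ)).congr_of_eventuallyEq hzero
  · have hsq : (fun t : ℝ => max t 0 ^ 2) =O[𝓝 0] fun t : ℝ => t ^ 2 :=
      Asymptotics.isBigO_of_le _ fun t => by
        simpa only [norm_pow, Real.norm_eq_abs] using pow_le_pow_left₀ (abs_nonneg _)
          (by simpa using abs_max_sub_max_le_abs t 0 0) 2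
    simpa [hasDerivAt_iff_isLittleO_nhds_zero] using!
      hsq.trans_isLittleO (Asymptotics.isLittleO_pow_id one_lt_two)
  · have hid : (fun s : ℝ => max s 0 ^ 2) =ᶠ[𝓝 s] fun t => t ^ 2 := by
      filter_upwards [lt_mem_nhds hs] with t ht
      simp [max_eq_left ht.le]
    rw [max_eq_left hs.le]
    simpa using (hasDerivAt_pow 2 s).congr_of_eventuallyEq hid

/-- The continuous ramp: zero below `a`, one above `b`, affine in between. -/
def ramp (a b s : ℝ) : ℝ := (max (s - a) 0 - max (s - b) 0) / (b - a)

/-- The primitive of `ramp` vanishing below `a`; a `C¹` truncation from below at the level `a`. -/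
def rampPrim (a b s : ℝ) : ℝ := (max (s - a) 0 ^ 2 - max (s - b) 0 ^ 2) / (2 * (b - a))

variable {a b s : ℝ}

theorem hasDerivAt_rampPrim (hab : a < b) (s : ℝ) :
    HasDerivAt (rampPrim a b) (ramp a b s) s := by
  have hba : b - a ≠ 0 := by linarith
  have hderiv := (((hasDerivAt_max_zero_sq (s - a)).comp s ((hasDerivAt_id s).sub_const a)).sub
    ((hasDerivAt_max_zero_sq (s - b)).comp s ((hasDerivAt_id s).sub_const b))).div_const
      (2 * (b - a))
  convert! hderiv using 1
  rw [ramp]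
  field_simp

theorem continuous_ramp (a b : ℝ) : Continuous (ramp a b) := by
  unfold ramp
  fun_prop

theorem ramp_nonneg (hab : a ≤ b) (s : ℝ) : 0 ≤ ramp a b s :=
  div_nonneg (sub_nonneg.2 (max_le_max_right _ (by linarith))) (by linarith)

theorem ramp_le_one (hab : a < b) (s : ℝ) : ramp a b s ≤ 1 := by
  rw [ramp, div_le_one (by linarith)]
  rcases le_total (s - a) 0 with ha | ha <;> rcases le_total (s - b) 0 with hb | hb <;>
    simp only [max_eq_left, max_eq_right, ha, hb] <;> linarith

theorem rampPrim_of_le (hab : a ≤ b) (hs : s ≤ a) : rampPrim a b s = 0 := by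
  rw [rampPrim, max_eq_right (by linarith), max_eq_right (by linarith)]
  simp

theorem rampPrim_nonneg (hab : a ≤ b) (s : ℝ) : 0 ≤ rampPrim a b s := by
  refine div_nonneg (sub_nonneg.2 ?_) (by linarith)
  gcongr

theorem rampPrim_le (ha : 0 ≤ a) (hab : a < b) (hs : 0 ≤ s) : rampPrim a b s ≤ s := by
  rw [rampPrim, div_le_iff₀ (by linarith)]
  rcases le_total (s - a) 0 with hsa | hsa <;> rcases le_total (s - b) 0 with hsb | hsb <;>
    simp only [max_eq_left, max_eq_right, hsa, hsb] <;> nlinarith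

theorem le_rampPrim (ha : 0 ≤ a) (hab : a < b) (hs : b < s) :
    (b - a) / (2 * b) * s ≤ rampPrim a b s := by
  have hba : b - a ≠ 0 := by linarith
  have hval : rampPrim a b s = s - (a + b) / 2 := by
    rw [rampPrim, max_eq_left (by linarith), max_eq_left (by linarith)]
    field_simp
    ring
  rw [hval, div_mul_eq_mul_div, div_le_iff₀ (by linarith)]
  nlinarith

end Ramp

/-! ### De Giorgi iteration -/

section LevelIteration

theorem tendsto_zero_of_superlinear {y : ℕ → ℝ} {B Y δ : ℝ} (hδ : 0 < δ) (hY : 0 ≤ Y)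
    (hB : 0 ≤ B) (hy : ∀ n, 0 ≤ y n) (h0 : y 0 ≤ Y)
    (hrec : ∀ n, y (n + 1) ≤ B * 2 ^ n * y n ^ (1 + δ)) (hBY : B * Y ^ δ ≤ 2 ^ (-1 / δ)) :
    Tendsto y atTop (𝓝 0) := by
  set r : ℝ := 2 ^ (-1 / δ) with hr
  have hr0 : 0 < r := by positivity
  have hr1 : r < 1 :=
    Real.rpow_lt_one_of_one_lt_of_neg one_lt_two (div_neg_of_neg_of_pos (by norm_num) hδ)
  have hrδ : r ^ δ = 2⁻¹ := by
    rw [hr, ← Real.rpow_mul (by norm_num), div_mul_cancel₀ _ hδ.ne', Real.rpow_neg_one]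
  have hgeom : ∀ n, y n ≤ Y * r ^ n := by
    intro n
    induction n with
    | zero => simpa using h0
    | succ n ih =>
      calc y (n + 1) ≤ B * 2 ^ n * y n ^ (1 + δ) := hrec n
        _ ≤ B * 2 ^ n * (Y * r ^ n) ^ (1 + δ) := by
            gcongr
            exact hy n
        _ = B * 2 ^ n * ((Y * r ^ n) * (Y ^ δ * (r ^ δ) ^ n)) := by
            rw [Real.rpow_add_of_nonneg (by positivity) (by norm_num) hδ.le, Real.rpow_one,
              Real.mul_rpow hY (by positivity), ← Real.rpow_natCast r n, ← Real.rpow_mul hr0.le,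
              ← Real.rpow_natCast (r ^ δ) n, ← Real.rpow_mul hr0.le, mul_comm (n : ℝ) δ]
        _ = (B * Y ^ δ) * (Y * r ^ n) := by
            rw [hrδ, inv_pow]
            field_simp
        _ ≤ r * (Y * r ^ n) := by gcongr
        _ = Y * r ^ (n + 1) := by ring
  refine squeeze_zero hy hgeom ?_
  simpa using (tendsto_pow_atTop_nhds_zero_of_lt_one hr0.le hr1).const_mul Y

theorem exists_pos_mul_rpow_neg_mul_le {B σ c ε : ℝ} (hσ : 0 < σ) (hε : 0 < ε) :
    ∃ M : ℝ, 0 < M ∧ B * M ^ (-σ) * c ≤ ε := by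
  have hlim : Tendsto (fun M : ℝ => B * M ^ (-σ) * c) atTop (𝓝 0) := by
    simpa using ((tendsto_rpow_neg_atTop hσ).const_mul B).mul_const c
  obtain ⟨M, hM, hM0⟩ := ((hlim.eventually (gt_mem_nhds hε)).and (eventually_gt_atTop 0)).exists
  exact ⟨M, hM0, hM.le⟩

/-- The levels `M (2 - 2⁻ⁿ)` of the De Giorgi iteration, increasing from `M` to `2 M`. -/
def level (M : ℝ) (n : ℕ) : ℝ := M * (2 - (2 ^ n)⁻¹)

variable {M : ℝ}

theorem le_level (hM : 0 ≤ M) (n : ℕ) : M ≤ level M n := by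
  have hinv : ((2 : ℝ) ^ n)⁻¹ ≤ 1 := inv_le_one_of_one_le₀ (one_le_pow₀ one_le_two)
  rw [level]
  nlinarith

theorem level_le (hM : 0 ≤ M) (n : ℕ) : level M n ≤ 2 * M := by
  have hinv : (0 : ℝ) ≤ (2 ^ n)⁻¹ := by positivity
  rw [level]
  nlinarith

theorem level_succ_sub (M : ℝ) (n : ℕ) :
    level M (n + 1) - level M n = M * (2 ^ n)⁻¹ / 2 := by
  simp only [level, pow_succ]
  field_simp
  ring

theorem level_lt_level_succ (hM : 0 < M) (n : ℕ) : level M n < level M (n + 1) := by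
  have hgap : 0 < M * (2 ^ n)⁻¹ / 2 := by positivity
  linarith [level_succ_sub M n]

theorem inv_two_pow_div_le_level_gap (hM : 0 < M) (n : ℕ) :
    ((2 : ℝ) ^ n)⁻¹ / 8 ≤ (level M (n + 1) - level M n) / (2 * level M (n + 1)) := by
  have hinv : (0 : ℝ) < (2 ^ n)⁻¹ := by positivity
  rw [level_succ_sub, div_le_div_iff₀ (by norm_num) (by linarith [le_level hM.le (n + 1)])]
  nlinarith [level_le hM.le (n + 1)]

theorem exists_eq_zero_of_level_inequality {C Y σ δ : ℝ} (hC : 0 ≤ C) (hY : 0 ≤ Y) (hσ : 0 < σ)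
    (hδ : 0 < δ) : ∃ L : ℝ, 0 < L ∧ ∀ y : ℝ → ℝ, Antitone y → (∀ a, 0 ≤ y a) → (∀ a, y a ≤ Y) →
      (∀ a b, 0 < a → a < b → (b - a) / (2 * b) * y b ≤ C * a ^ (-σ) * y a ^ (1 + δ)) →
      y L = 0 := by
  obtain ⟨M, hM, hMY⟩ := exists_pos_mul_rpow_neg_mul_le (B := 8 * C) (c := Y ^ δ) hσ
    (show (0 : ℝ) < 2 ^ (-1 / δ) by positivity)
  refine ⟨2 * M, by positivity, fun y hanti hy0 hyY hstep => ?_⟩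
  have hrec : ∀ n, y (level M (n + 1))
      ≤ 8 * C * M ^ (-σ) * 2 ^ n * y (level M n) ^ (1 + δ) := by
    intro n
    have hpos : 0 < level M n := hM.trans_le (le_level hM.le n)
    have hgap : ((2 : ℝ) ^ n)⁻¹ / 8 * y (level M (n + 1))
        ≤ C * M ^ (-σ) * y (level M n) ^ (1 + δ) :=
      calc _ ≤ (level M (n + 1) - level M n) / (2 * level M (n + 1)) * y (level M (n + 1)) :=
            mul_le_mul_of_nonneg_right (inv_two_pow_div_le_level_gap hM n) (hy0 _)
        _ ≤ C * level M n ^ (-σ) * y (level M n) ^ (1 + δ) :=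
            hstep _ _ hpos (level_lt_level_succ hM n)
        _ ≤ C * M ^ (-σ) * y (level M n) ^ (1 + δ) := by
            have := hy0 (level M n)
            gcongr C * ?_ * _
            exact Real.rpow_le_rpow_of_nonpos hM (le_level hM.le n) (by linarith)
    calc y (level M (n + 1)) = 8 * 2 ^ n * (((2 : ℝ) ^ n)⁻¹ / 8 * y (level M (n + 1))) := by
          field_simp
      _ ≤ 8 * 2 ^ n * (C * M ^ (-σ) * y (level M n) ^ (1 + δ)) := by gcongr
      _ = 8 * C * M ^ (-σ) * 2 ^ n * y (level M n) ^ (1 + δ) := by ring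
  have hlim := tendsto_zero_of_superlinear (y := fun n => y (level M n)) hδ hY (by positivity)
    (fun n => hy0 _) (hyY _) hrec hMY
  exact le_antisymm (ge_of_tendsto' hlim fun n => hanti (level_le hM.le n)) (hy0 _)

end LevelIteration

section Above

/-- The part of a function above a level, `v · 1_{v > a}`. -/
def above {α : Type*} (v : α → ℝ) (a : ℝ) : α → ℝ := {x | a < v x}.indicator v

variable {α : Type*} {v : α → ℝ} {a b : ℝ} {x : α}

theorem above_of_lt (h : a < v x) : above v a x = v x := indicator_of_mem (s := {x | a < v x}) h v

theorem above_of_le (h : v x ≤ a) : above v a x = 0 :=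
  indicator_of_notMem (s := {x | a < v x}) h.not_gt v

theorem norm_above_anti (v : α → ℝ) (hab : a ≤ b) (x : α) : ‖above v b x‖ ≤ ‖above v a x‖ := by
  by_cases h : b < v x
  · rw [above_of_lt h, above_of_lt (hab.trans_lt h)]
  · rw [above_of_le (not_lt.1 h), norm_zero]
    exact norm_nonneg _

theorem rpow_mul_rampPrim_le {p q : ℝ} (hqp : q ≤ p) (ha : 0 < a) (hab : a < b) (x : α) :
    ENNReal.ofReal (v x ^ (q - 1) * rampPrim a b (v x))
      ≤ ENNReal.ofReal (a ^ (q - p)) * ‖above v a x‖ₑ ^ p := by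
  by_cases hax : a < v x
  · have hvx : 0 < v x := ha.trans hax
    rw [above_of_lt hax, Real.enorm_of_nonneg hvx.le, ENNReal.ofReal_rpow_of_pos hvx,
      ← ENNReal.ofReal_mul (by positivity)]
    refine ENNReal.ofReal_le_ofReal ?_
    calc v x ^ (q - 1) * rampPrim a b (v x) ≤ v x ^ (q - 1) * v x := by
          gcongr
          exact rampPrim_le ha.le hab hvx.le
      _ = v x ^ (q - p) * v x ^ p := by
          rw [← Real.rpow_add hvx, ← Real.rpow_add_one hvx.ne']
          ring_nf
      _ ≤ a ^ (q - p) * v x ^ p := by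
          gcongr ?_ * _
          exact Real.rpow_le_rpow_of_nonpos ha hax.le (by linarith)
  · simp [rampPrim_of_le hab.le (not_lt.1 hax)]

variable [MeasurableSpace α] {μ : Measure α} {p : ENNReal}

theorem eLpNorm_above_le (v : α → ℝ) (a : ℝ) : eLpNorm (above v a) p μ ≤ eLpNorm v p μ :=
  eLpNorm_mono fun _ => norm_indicator_le_norm_self _ _

theorem ofReal_mul_eLpNorm_above_le (ha : 0 ≤ a) (hab : a < b) :
    ENNReal.ofReal ((b - a) / (2 * b)) * eLpNorm (above v b) p μ
      ≤ eLpNorm (fun x => rampPrim a b (v x)) p μ := by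
  have hc : 0 ≤ (b - a) / (2 * b) := div_nonneg (by linarith) (by linarith)
  rw [← Real.enorm_of_nonneg hc, ← eLpNorm_const_smul]
  refine eLpNorm_mono fun x => ?_
  rw [Real.norm_of_nonneg (rampPrim_nonneg hab.le _), Pi.smul_apply, norm_smul,
    Real.norm_of_nonneg hc]
  by_cases hx : b < v x
  · rw [above_of_lt hx, Real.norm_of_nonneg (by linarith)]
    exact le_rampPrim ha hab hx
  · rw [above_of_le (not_lt.1 hx), norm_zero, mul_zero]
    exact rampPrim_nonneg hab.le _

theorem ae_le_of_eLpNorm_above_eq_zero (hv : AEStronglyMeasurable v μ) (hp : p ≠ 0) (ha : 0 ≤ a)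
    (h : eLpNorm (above v a) p μ = 0) : ∀ᵐ x ∂μ, v x ≤ a := by
  have hmeas : AEStronglyMeasurable (above v a) μ :=
    hv.indicator₀ (nullMeasurableSet_lt aemeasurable_const hv.aemeasurable)
  filter_upwards [(eLpNorm_eq_zero_iff hmeas hp).1 h] with x hx
  by_contra! hax
  rw [above_of_lt hax, Pi.zero_apply] at hx
  linarith

end Above

section DeGiorgi

variable {N : ℕ} {K q : ℝ} {v : E N → ℝ} {w : E N → E N} {a b : ℝ}

/-- `v`, with weak gradient `w`, is a weak subsolution of `-Δv ≤ K v^(q-1)`, tested against the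
functions `ψ ∘ v` with `ψ` of class `C¹`, `0 ≤ ψ' ≤ 1` and `ψ(0) = 0`. -/
def IsPowerSubsolution (K q : ℝ) (v : E N → ℝ) (w : E N → E N) : Prop :=
  ∀ ψ θ : ℝ → ℝ, (∀ s, HasDerivAt ψ (θ s) s) → Continuous θ → (∀ s, 0 ≤ θ s) → (∀ s, θ s ≤ 1) →
    ψ 0 = 0 → ∫⁻ x, ENNReal.ofReal (θ (v x)) * ‖w x‖ₑ ^ 2
      ≤ ENNReal.ofReal K * ∫⁻ x, ENNReal.ofReal (v x ^ (q - 1) * ψ (v x))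

theorem IsPowerSubsolution.eLpNorm_ramp_smul_sq_le (hsub : IsPowerSubsolution K q v w) {p : ℝ}
    (hp : 0 < p) (hqp : q ≤ p) (ha : 0 < a) (hab : a < b) :
    eLpNorm (fun x => ramp a b (v x) • w x) 2 volume ^ 2 ≤ ENNReal.ofReal K *
      (ENNReal.ofReal (a ^ (q - p)) * eLpNorm (above v a) (ENNReal.ofReal p) volume ^ p) := by
  calc eLpNorm (fun x => ramp a b (v x) • w x) 2 volume ^ 2
      = ∫⁻ x, ‖ramp a b (v x) • w x‖ₑ ^ 2 := eLpNorm_two_pow_two _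
    _ ≤ ∫⁻ x, ENNReal.ofReal (ramp a b (v x)) * ‖w x‖ₑ ^ 2 := by
        refine lintegral_mono fun x => ?_
        rw [enorm_smul, mul_pow, Real.enorm_of_nonneg (ramp_nonneg hab.le _)]
        gcongr
        exact pow_le_of_le_one zero_le (ENNReal.ofReal_le_one.2 (ramp_le_one hab _)) two_ne_zero
    _ ≤ ENNReal.ofReal K * ∫⁻ x, ENNReal.ofReal (v x ^ (q - 1) * rampPrim a b (v x)) :=
        hsub _ _ (hasDerivAt_rampPrim hab) (continuous_ramp a b) (ramp_nonneg hab.le)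
          (ramp_le_one hab) (rampPrim_of_le hab.le ha.le)
    _ ≤ ENNReal.ofReal K * ∫⁻ x, ENNReal.ofReal (a ^ (q - p)) * ‖above v a x‖ₑ ^ p := by
        gcongr with x
        exact rpow_mul_rampPrim_le hqp ha hab x
    _ = _ := by
        have hnorm := eLpNorm_rpow_toReal_eq_lintegral (μ := volume)
          (ENNReal.ofReal_pos.2 hp).ne' ENNReal.ofReal_ne_top (above v a)
        rw [ENNReal.toReal_ofReal hp.le] at hnorm
        rw [lintegral_const_mul' _ _ ENNReal.ofReal_ne_top, hnorm]

theorem IsPowerSubsolution.level_inequality (hN : 3 ≤ N) (hK : 0 ≤ K) (hqp : q ≤ crit N)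
    (h : MemH1 v w) (hsub : IsPowerSubsolution K q v w) (ha : 0 < a) (hab : a < b) :
    (b - a) / (2 * b) * (eLpNorm (above v b) (ENNReal.ofReal (crit N)) volume).toReal
      ≤ sobolevConst N * √K * a ^ (-((crit N - q) / 2))
        * (eLpNorm (above v a) (ENNReal.ofReal (crit N)) volume).toReal
          ^ (1 + (crit N / 2 - 1)) := by
  have hp : 0 < crit N := by linarith [two_lt_crit hN]
  have hψ : MemH1 (fun x => rampPrim a b (v x)) (fun x => ramp a b (v x) • w x) :=
    h.comp (hasDerivAt_rampPrim hab) (continuous_ramp a b)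
      (fun s => (abs_of_nonneg (ramp_nonneg hab.le s)).trans_le (ramp_le_one hab s))
      (rampPrim_of_le hab.le ha.le)
  have hfin : eLpNorm (above v a) (ENNReal.ofReal (crit N)) volume ≠ ⊤ :=
    ((eLpNorm_above_le v a).trans_lt (h.memLp_crit hN).2).ne
  set y := (eLpNorm (above v a) (ENNReal.ofReal (crit N)) volume).toReal
  set z := (eLpNorm (fun x => ramp a b (v x) • w x) 2 volume).toReal
  have hy : 0 ≤ y := ENNReal.toReal_nonneg
  have hsobolev : (b - a) / (2 * b) * (eLpNorm (above v b) (ENNReal.ofReal (crit N)) volume).toReal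
      ≤ sobolevConst N * z := by
    have hle := (ofReal_mul_eLpNorm_above_le ha.le hab).trans (hψ.eLpNorm_crit_le hN)
    have := ENNReal.toReal_mono (ENNReal.mul_ne_top ENNReal.coe_ne_top hψ.memLp_grad.2.ne) hle
    rwa [ENNReal.toReal_mul, ENNReal.toReal_mul, ENNReal.coe_toReal,
      ENNReal.toReal_ofReal (div_nonneg (by linarith) (by linarith))] at this
  have henergy : z ^ 2 ≤ K * (a ^ (q - crit N) * y ^ crit N) := by
    have := ENNReal.toReal_mono (by finiteness) (hsub.eLpNorm_ramp_smul_sq_le hp hqp ha hab)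
    rwa [ENNReal.toReal_pow, ENNReal.toReal_mul, ENNReal.toReal_mul, ENNReal.toReal_ofReal hK,
      ENNReal.toReal_ofReal (by positivity), ← ENNReal.toReal_rpow] at this
  have hsquare : (√K * a ^ (-((crit N - q) / 2)) * y ^ (1 + (crit N / 2 - 1))) ^ 2
      = K * (a ^ (q - crit N) * y ^ crit N) := by
    rw [mul_pow, mul_pow, Real.sq_sqrt hK, ← Real.rpow_mul_natCast ha.le,
      ← Real.rpow_mul_natCast hy]
    push_cast
    ring_nf
  have hz : z ≤ √K * a ^ (-((crit N - q) / 2)) * y ^ (1 + (crit N / 2 - 1)) :=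
    le_of_sq_le_sq (henergy.trans_eq hsquare.symm) (by positivity)
  calc _ ≤ sobolevConst N * z := hsobolev
    _ ≤ sobolevConst N * (√K * a ^ (-((crit N - q) / 2)) * y ^ (1 + (crit N / 2 - 1))) := by gcongr
    _ = _ := by ring

theorem exists_bound_of_isPowerSubsolution (hN : 3 ≤ N) (hK : 0 ≤ K) (hqp : q < crit N) (A : ℝ) :
    ∃ M : ℝ, 0 < M ∧ ∀ (v : E N → ℝ) (w : E N → E N), MemH1 v w →
      eLpNorm w 2 volume ≤ ENNReal.ofReal A → IsPowerSubsolution K q v w → ∀ᵐ x, v x ≤ M := by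
  have hp : 2 < crit N := two_lt_crit hN
  obtain ⟨M, hM, hzero⟩ := exists_eq_zero_of_level_inequality
    (C := sobolevConst N * √K) (Y := sobolevConst N * (ENNReal.ofReal A).toReal)
    (σ := (crit N - q) / 2) (δ := crit N / 2 - 1) (by positivity) (by positivity) (by linarith)
    (by linarith)
  refine ⟨M, hM, fun v w h hA hsub => ?_⟩
  have hfin : ∀ a, eLpNorm (above v a) (ENNReal.ofReal (crit N)) volume ≠ ⊤ := fun a =>
    ((eLpNorm_above_le v a).trans_lt (h.memLp_crit hN).2).ne
  have hbound : ∀ a, (eLpNorm (above v a) (ENNReal.ofReal (crit N)) volume).toReal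
      ≤ sobolevConst N * (ENNReal.ofReal A).toReal := fun a => by
    rw [← ENNReal.coe_toReal, ← ENNReal.toReal_mul]
    exact ENNReal.toReal_mono (by finiteness)
      ((eLpNorm_above_le v a).trans ((h.eLpNorm_crit_le hN).trans (by gcongr)))
  have hyM := hzero (fun a => (eLpNorm (above v a) (ENNReal.ofReal (crit N)) volume).toReal)
    (fun a b hab => ENNReal.toReal_mono (hfin a) (eLpNorm_mono (norm_above_anti v hab)))
    (fun _ => ENNReal.toReal_nonneg) hbound
    (fun a b ha hab => hsub.level_inequality hN hK hqp.le h ha hab)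
  exact ae_le_of_eLpNorm_above_eq_zero h.memLp.1 (ENNReal.ofReal_pos.2 (by linarith)).ne' hM.le
    (((ENNReal.toReal_eq_zero_iff _).1 hyM).resolve_right (hfin M))

end DeGiorgi

/-! ### The change of variable and the nonlinearity -/

theorem abs_sqrt_sub_sqrt_le {a b c : ℝ} (hc : 0 < c) (ha : c ^ 2 ≤ a) (hb : c ^ 2 ≤ b) :
    |√a - √b| ≤ |a - b| / (2 * c) := by
  have hca : c ≤ √a := Real.le_sqrt_of_sq_le ha
  have hcb : c ≤ √b := Real.le_sqrt_of_sq_le hb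
  have hfactor : |a - b| = |√a - √b| * (√a + √b) := by
    rw [← abs_of_pos (show 0 < √a + √b by linarith), ← abs_mul]
    congr 1
    linear_combination
      -Real.sq_sqrt ((sq_nonneg c).trans ha) + Real.sq_sqrt ((sq_nonneg c).trans hb)
  rw [le_div_iff₀ (by positivity), hfactor]
  gcongr
  linarith

theorem abs_inv_sub_inv_le {a b c : ℝ} (hc : 0 < c) (ha : c ≤ a) (hb : c ≤ b) :
    |a⁻¹ - b⁻¹| ≤ |a - b| / c ^ 2 := by
  have ha0 : 0 < a := hc.trans_le ha
  have hb0 : 0 < b := hc.trans_le hb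
  rw [inv_sub_inv ha0.ne' hb0.ne', abs_div, abs_sub_comm, abs_of_pos (mul_pos ha0 hb0), sq]
  gcongr

theorem sqrt_two_thirds : √(2 / 3 : ℝ) = 2 * √(1 / 6) := by
  rw [show (2 / 3 : ℝ) = 2 ^ 2 * (1 / 6) by norm_num, Real.sqrt_mul (by norm_num),
    Real.sqrt_sq (by norm_num)]

theorem third_le_sqrt_sixth : (1 / 3 : ℝ) ≤ √(1 / 6) :=
  Real.le_sqrt_of_sq_le (by norm_num)

theorem sqrt_sixth_le_half : √(1 / 6 : ℝ) ≤ 1 / 2 := by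
  rw [Real.sqrt_le_left (by norm_num)]
  norm_num

/-- The point `√(1 / (3k))` at which the two branches of `g` are glued. -/
def joint (k : ℝ) : ℝ := √(1 / (3 * k))

section Profile

variable {k : ℝ} (hk : 0 < k)
include hk

theorem joint_pos : 0 < joint k := Real.sqrt_pos.2 (by positivity)

theorem mul_joint_sq : k * joint k ^ 2 = 1 / 3 := by
  rw [joint, Real.sq_sqrt (by positivity)]
  field_simp

theorem tail_at_joint : 1 / (3 * √(2 * k)) / joint k = √(1 / 6) := by
  rw [joint, div_div, mul_assoc, ← Real.sqrt_mul (by positivity),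
    show 2 * k * (1 / (3 * k)) = 2 / 3 by field_simp, sqrt_two_thirds]
  have hsq := Real.sq_sqrt (show (0 : ℝ) ≤ 1 / 6 by norm_num)
  rw [div_eq_iff (by positivity)]
  linarith

theorem mul_sq_le_third {t : ℝ} (ht : |t| ≤ joint k) : k * t ^ 2 ≤ 1 / 3 := by
  rw [← mul_joint_sq hk, ← sq_abs t]
  gcongr

theorem g_eq (t : ℝ) :
    g k t = √(1 - k * min |t| (joint k) ^ 2)
      + (1 / (3 * √(2 * k)) * (max |t| (joint k))⁻¹ - √(1 / 6)) := by
  rw [g, ← joint]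
  split_ifs with h
  · rw [min_eq_left h.le, max_eq_right h.le, ← div_eq_mul_inv, tail_at_joint hk, sq_abs]
    ring
  · rw [not_lt] at h
    rw [min_eq_right h, max_eq_left h, mul_joint_sq hk,
      show (1 - 1 / 3 : ℝ) = 2 / 3 by norm_num, sqrt_two_thirds, ← div_eq_mul_inv, div_div]
    ring

theorem third_le_g (t : ℝ) : 1 / 3 ≤ g k t := by
  rw [g, ← joint]
  split_ifs with h
  · exact Real.le_sqrt_of_sq_le (by linarith [mul_sq_le_third hk h.le])
  · have htail : 0 ≤ 1 / (3 * √(2 * k) * |t|) := by positivity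
    linarith [third_le_sqrt_sixth]

theorem g_pos (t : ℝ) : 0 < g k t := by linarith [third_le_g hk t]

theorem inv_g_nonneg (t : ℝ) : 0 ≤ (g k t)⁻¹ := (inv_pos.2 (g_pos hk t)).le

theorem inv_g_le_three (t : ℝ) : (g k t)⁻¹ ≤ 3 := by
  rw [inv_le_comm₀ (g_pos hk t) (by norm_num)]
  linarith [third_le_g hk t]

theorem g_le_one (t : ℝ) : g k t ≤ 1 := by
  rw [g, ← joint]
  split_ifs with h
  · have hsq : 0 ≤ k * t ^ 2 := by positivity
    exact Real.sqrt_le_one.2 (by linarith)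
  · rw [not_lt] at h
    have hj := joint_pos hk
    have htail : 1 / (3 * √(2 * k) * |t|) ≤ 1 / (3 * √(2 * k)) / joint k := by
      rw [div_div]
      gcongr
    rw [tail_at_joint hk] at htail
    linarith [sqrt_sixth_le_half]

theorem abs_sqrt_branch_sub_le (s t : ℝ) :
    |√(1 - k * min |s| (joint k) ^ 2) - √(1 - k * min |t| (joint k) ^ 2)|
      ≤ 3 * k * joint k * |s - t| := by
  have hj := joint_pos hk
  have hbound (t : ℝ) : (1 / 3) ^ 2 ≤ 1 - k * min |t| (joint k) ^ 2 := by
    have hmin : |min |t| (joint k)| ≤ joint k := by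
      rw [abs_of_nonneg (le_min (abs_nonneg _) hj.le)]
      exact min_le_right _ _
    linarith [mul_sq_le_third hk hmin]
  have hmin : |min |s| (joint k) - min |t| (joint k)| ≤ |s - t| := by
    have h := abs_min_sub_min_le_max |s| (joint k) |t| (joint k)
    rw [sub_self, abs_zero, max_eq_left (abs_nonneg _)] at h
    exact h.trans (abs_abs_sub_abs_le_abs_sub s t)
  have hsum : 0 ≤ min |s| (joint k) + min |t| (joint k) := by positivity
  calc _ ≤ |1 - k * min |s| (joint k) ^ 2 - (1 - k * min |t| (joint k) ^ 2)| / (2 * (1 / 3)) :=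
        abs_sqrt_sub_sqrt_le (by norm_num) (hbound s) (hbound t)
    _ = 3 / 2 * k * (min |s| (joint k) + min |t| (joint k))
          * |min |s| (joint k) - min |t| (joint k)| := by
        rw [show 1 - k * min |s| (joint k) ^ 2 - (1 - k * min |t| (joint k) ^ 2)
            = -(k * ((min |s| (joint k) + min |t| (joint k))
              * (min |s| (joint k) - min |t| (joint k)))) by ring,
          abs_neg, abs_mul, abs_mul, abs_of_pos hk, abs_of_nonneg hsum]
        ring
    _ ≤ 3 / 2 * k * (joint k + joint k) * |s - t| := by
        gcongr <;> exact min_le_right _ _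
    _ = 3 * k * joint k * |s - t| := by ring

theorem abs_inv_max_joint_sub_le (s t : ℝ) :
    |(max |s| (joint k))⁻¹ - (max |t| (joint k))⁻¹| ≤ |s - t| / joint k ^ 2 := by
  have hmax : |max |s| (joint k) - max |t| (joint k)| ≤ |s - t| := by
    have h := abs_max_sub_max_le_max |s| (joint k) |t| (joint k)
    rw [sub_self, abs_zero, max_eq_left (abs_nonneg (|s| - |t|))] at h
    exact h.trans (abs_abs_sub_abs_le_abs_sub s t)
  refine (abs_inv_sub_inv_le (joint_pos hk) (le_max_right _ _) (le_max_right _ _)).trans ?_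
  gcongr

theorem exists_lipschitzWith_g : ∃ L, LipschitzWith L (g k) := by
  have hj := joint_pos hk
  let L : ℝ := 3 * k * joint k + 1 / (3 * √(2 * k)) / joint k ^ 2
  have hL : 0 ≤ L := by positivity
  refine ⟨L.toNNReal, LipschitzWith.of_dist_le_mul fun s t => ?_⟩
  rw [Real.dist_eq, Real.dist_eq, Real.coe_toNNReal L hL, g_eq hk, g_eq hk]
  calc _ = |(√(1 - k * min |s| (joint k) ^ 2) - √(1 - k * min |t| (joint k) ^ 2))
          + 1 / (3 * √(2 * k)) * ((max |s| (joint k))⁻¹ - (max |t| (joint k))⁻¹)| := by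
        congr 1
        ring
    _ ≤ 3 * k * joint k * |s - t| + 1 / (3 * √(2 * k)) * (|s - t| / joint k ^ 2) := by
        refine (abs_add_le _ _).trans (add_le_add (abs_sqrt_branch_sub_le hk s t) ?_)
        rw [abs_mul, abs_of_nonneg (by positivity)]
        gcongr
        exact abs_inv_max_joint_sub_le hk s t
    _ = L * |s - t| := by ring

theorem continuous_g : Continuous (g k) :=
  (exists_lipschitzWith_g hk).choose_spec.continuous

theorem hasDerivAt_G (t : ℝ) : HasDerivAt (G k) (g k t) t :=
  ((continuous_g hk).integral_hasStrictDerivAt 0 t).hasDerivAt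

theorem continuous_G : Continuous (G k) :=
  continuous_iff_continuousAt.2 fun t => (hasDerivAt_G hk t).continuousAt

theorem G_sub (a b : ℝ) : G k b - G k a = ∫ s in a..b, g k s :=
  intervalIntegral.integral_interval_sub_left ((continuous_g hk).intervalIntegrable _ _)
    ((continuous_g hk).intervalIntegrable _ _)

theorem le_G_sub {a b : ℝ} (hab : a ≤ b) : (b - a) / 3 ≤ G k b - G k a := by
  have h := intervalIntegral.integral_mono_on (μ := volume) hab
    (intervalIntegrable_const (c := (1 / 3 : ℝ)))
    ((continuous_g hk).intervalIntegrable a b) fun s _ => third_le_g hk s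
  rw [intervalIntegral.integral_const, smul_eq_mul] at h
  rw [G_sub hk]
  linarith

theorem G_sub_le {a b : ℝ} (hab : a ≤ b) : G k b - G k a ≤ b - a := by
  have h := intervalIntegral.integral_mono_on (μ := volume) hab
    ((continuous_g hk).intervalIntegrable a b)
    (intervalIntegrable_const (c := (1 : ℝ))) fun s _ => g_le_one hk s
  rw [intervalIntegral.integral_const, smul_eq_mul] at h
  rw [G_sub hk]
  linarith

omit hk in
theorem G_zero : G k 0 = 0 := intervalIntegral.integral_same

theorem strictMono_G : StrictMono (G k) := fun a b hab => by
  linarith [le_G_sub hk hab.le]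

theorem surjective_G : Function.Surjective (G k) := by
  have hthird : (0 : ℝ) < 3 := by norm_num
  refine (continuous_G hk).surjective
    (tendsto_atTop_mono' _ ?_ (tendsto_id.atTop_div_const hthird))
    (tendsto_atBot_mono' _ ?_ (tendsto_id.atBot_div_const hthird))
  · filter_upwards [eventually_ge_atTop 0] with t ht
    simpa [G_zero] using le_G_sub hk ht
  · filter_upwards [eventually_le_atBot 0] with t ht
    have h := le_G_sub hk ht
    rw [G_zero] at h
    simp only [id]
    linarith

theorem G_Ginv (s : ℝ) : G k (Ginv k s) = s :=
  Function.rightInverse_invFun (surjective_G hk) s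

theorem Ginv_zero : Ginv k 0 = 0 :=
  (strictMono_G hk).injective (by rw [G_Ginv hk, G_zero])

theorem strictMono_Ginv : StrictMono (Ginv k) := fun a b hab => by
  rwa [← (strictMono_G hk).lt_iff_lt, G_Ginv hk, G_Ginv hk]

theorem Ginv_sub_le {a b : ℝ} (hab : a ≤ b) : Ginv k b - Ginv k a ≤ 3 * (b - a) := by
  have h := le_G_sub hk ((strictMono_Ginv hk).monotone hab)
  rw [G_Ginv hk, G_Ginv hk] at h
  linarith

theorem lipschitzWith_Ginv : LipschitzWith 3 (Ginv k) :=
  LipschitzWith.of_le_add_mul 3 fun a b => by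
    rcases le_total b a with hab | hab
    · rw [Real.dist_eq, abs_of_nonneg (by linarith)]
      push_cast
      linarith [Ginv_sub_le hk hab]
    · have hmono := (strictMono_Ginv hk).monotone hab
      have hdist : 0 ≤ ((3 : NNReal) : ℝ) * dist a b := by positivity
      linarith

theorem continuous_Ginv : Continuous (Ginv k) := (lipschitzWith_Ginv hk).continuous

theorem abs_Ginv_le (s : ℝ) : |Ginv k s| ≤ 3 * |s| := by
  simpa [Ginv_zero hk] using (lipschitzWith_Ginv hk).dist_le_mul s 0

theorem Ginv_nonneg {s : ℝ} (hs : 0 ≤ s) : 0 ≤ Ginv k s := by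
  have h := (strictMono_Ginv hk).monotone hs
  rwa [Ginv_zero hk] at h

theorem Ginv_le {s : ℝ} (hs : 0 ≤ s) : Ginv k s ≤ 3 * s := by
  simpa [Ginv_zero hk] using Ginv_sub_le hk hs

theorem le_Ginv {s : ℝ} (hs : 0 ≤ s) : s ≤ Ginv k s := by
  have h := G_sub_le hk (Ginv_nonneg hk hs)
  rw [G_Ginv hk, G_zero] at h
  linarith

theorem hasDerivAt_Ginv (s : ℝ) : HasDerivAt (Ginv k) (g k (Ginv k s))⁻¹ s :=
  HasDerivAt.of_local_left_inverse (continuous_Ginv hk).continuousAt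
    (hasDerivAt_G hk _) (g_pos hk _).ne' (Eventually.of_forall fun t => G_Ginv hk t)

end Profile

theorem tendsto_atTop_of_one_le_deriv {u u' : ℝ → ℝ}
    (h : ∀ᶠ t in atTop, HasDerivAt u (u' t) t ∧ 1 ≤ u' t) : Tendsto u atTop atTop := by
  obtain ⟨T, hT⟩ := eventually_atTop.1 h
  have hmono : MonotoneOn (fun t => u t - t) (Ici T) := by
    have hd (t : ℝ) (ht : T ≤ t) : HasDerivAt (fun t => u t - t) (u' t - 1) t :=
      (hT t ht).1.sub (hasDerivAt_id t)
    refine monotoneOn_of_hasDerivWithinAt_nonneg (convex_Ici T)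
      (fun t ht => (hd t ht).continuousAt.continuousWithinAt)
      (fun t ht => (hd t (interior_subset ht)).hasDerivWithinAt)
      fun t ht => sub_nonneg.2 (hT t (interior_subset ht)).2
  refine tendsto_atTop_mono' _ ?_ (tendsto_atTop_add_const_right _ (u T - T) tendsto_id)
  filter_upwards [eventually_ge_atTop T] with t ht
  have ht' := hmono self_mem_Ici (mem_Ici.2 ht) ht
  simp only [id] at ht' ⊢
  linarith

theorem exists_le_mul_add_mul_rpow {f : ℝ → ℝ} (hf : ContinuousOn f (Ici 0)) {a C δ p : ℝ}
    (ha : 0 ≤ a) (hδ : 0 < δ) (hp : 0 ≤ p) (hzero : ∀ u ∈ Icc 0 δ, f u ≤ a * u)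
    (htop : ∀ᶠ u in atTop, f u ≤ C * u ^ p) :
    ∃ K, 0 < K ∧ ∀ u, 0 ≤ u → f u ≤ a * u + K * u ^ p := by
  obtain ⟨T, hT⟩ := eventually_atTop.1 htop
  obtain ⟨B, hB⟩ := (isCompact_Icc (a := δ) (b := T)).exists_bound_of_continuousOn
    (hf.mono fun x hx => hδ.le.trans hx.1)
  refine ⟨|C| + |B| / δ ^ p + 1, by positivity, fun u hu => ?_⟩
  have hlin : 0 ≤ a * u := by positivity
  have hpow : 0 ≤ u ^ p := by positivity
  have hCu : C * u ^ p ≤ |C| * u ^ p := by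
    gcongr
    exact le_abs_self C
  have hCnonneg : 0 ≤ |C| * u ^ p := by positivity
  have hBnonneg : 0 ≤ |B| / δ ^ p * u ^ p := by positivity
  rcases le_total u δ with huδ | huδ
  · linarith [hzero u ⟨hu, huδ⟩]
  rcases le_total T u with huT | huT
  · linarith [hT u huT]
  · have hfB : f u ≤ |B| := ((le_abs_self _).trans (hB u ⟨huδ, huT⟩)).trans (le_abs_self B)
    have hBu : |B| ≤ |B| / δ ^ p * u ^ p := by
      rw [div_mul_eq_mul_div, le_div_iff₀ (by positivity)]
      gcongr
    linarith

theorem ext_of_nonneg (f : ℝ → ℝ) {s : ℝ} (hs : 0 ≤ s) : ext f s = f s := by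
  rw [ext, max_eq_left hs]

theorem F_zero (f : ℝ → ℝ) : F f 0 = 0 := intervalIntegral.integral_same

section Nonlinearity

variable {f : ℝ → ℝ} (h₁ : CondF1 f)
include h₁

theorem CondF1.nonneg {s : ℝ} (hs : 0 ≤ s) : 0 ≤ f s := by
  rcases hs.eq_or_lt with rfl | hs
  · exact h₁.2.1.ge
  · exact (h₁.2.2 s hs).le

theorem CondF1.ext_nonneg (s : ℝ) : 0 ≤ ext f s := h₁.nonneg (le_max_right _ _)

theorem CondF1.hasDerivAt {s : ℝ} (hs : 0 < s) : HasDerivAt f (deriv f s) s :=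
  ((h₁.1.differentiableOn (by simp)).differentiableAt (Ici_mem_nhds hs)).hasDerivAt

theorem CondF1.locallyLipschitz_ext : LocallyLipschitz (ext f) := by
  have hf := locallyLipschitzOn_iff_restrict.1 (h₁.1.locallyLipschitzOn (convex_Ici 0))
  have hmax : LocallyLipschitz fun s : ℝ =>
      (⟨max s 0, mem_Ici.2 (le_max_right _ _)⟩ : Ici (0 : ℝ)) :=
    (LipschitzWith.id.max_const 0).subtype_mk _ |>.locallyLipschitz
  exact hf.comp hmax

theorem CondF1.continuous_ext : Continuous (ext f) := h₁.locallyLipschitz_ext.continuous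

theorem CondF1.hasDerivAt_F (s : ℝ) : HasDerivAt (F f) (ext f s) s :=
  (h₁.continuous_ext.integral_hasStrictDerivAt 0 s).hasDerivAt

theorem CondF1.continuous_F : Continuous (F f) :=
  continuous_iff_continuousAt.2 fun s => (h₁.hasDerivAt_F s).continuousAt

theorem CondF1.monotone_F : Monotone (F f) :=
  monotone_of_hasDerivAt_nonneg h₁.hasDerivAt_F h₁.ext_nonneg

theorem CondF1.F_nonneg {s : ℝ} (hs : 0 ≤ s) : 0 ≤ F f s := by
  simpa [F_zero] using h₁.monotone_F hs

omit h₁ in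
theorem tendsto_deriv_nhdsGT_zero {N : ℕ} (h₂ : CondF2 N f) :
    Tendsto (deriv f) (𝓝[>] 0) (𝓝 0) := by
  obtain ⟨α, _, μ₁, _, -, -, hα, -, -, -, hlim, -⟩ := h₂
  have hpow : Tendsto (fun t : ℝ => t ^ (α - 2)) (𝓝[>] 0) (𝓝 0) := by
    have h := (Real.continuousAt_rpow_const 0 (α - 2) (Or.inr (by linarith))).tendsto
    rw [Real.zero_rpow (by linarith)] at h
    exact h.mono_left nhdsWithin_le_nhds
  have hprod := hlim.mul hpow
  rw [mul_zero] at hprod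
  refine hprod.congr' ?_
  filter_upwards [self_mem_nhdsWithin] with t ht
  exact div_mul_cancel₀ _ (Real.rpow_pos_of_pos ht _).ne'

omit h₁ in
theorem tendsto_deriv_atTop {N : ℕ} (h₂ : CondF2 N f) : Tendsto (deriv f) atTop atTop := by
  obtain ⟨_, β, _, μ₂, -, hμ₂, -, -, hβ, -, -, hlim⟩ := h₂
  refine (hlim.pos_mul_atTop (mul_pos hμ₂ (by linarith))
    (tendsto_rpow_atTop (show 0 < β - 2 by linarith))).congr' ?_
  filter_upwards [eventually_gt_atTop 0] with t ht
  exact div_mul_cancel₀ _ (Real.rpow_pos_of_pos ht _).ne'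

theorem exists_le_mul_of_tendsto_deriv (hlim : Tendsto (deriv f) (𝓝[>] 0) (𝓝 0)) {a : ℝ}
    (ha : 0 < a) : ∃ δ, 0 < δ ∧ ∀ u ∈ Icc 0 δ, f u ≤ a * u := by
  obtain ⟨δ, hδ, hderiv⟩ := mem_nhdsGT_iff_exists_Ioo_subset.1 (hlim.eventually (gt_mem_nhds ha))
  refine ⟨δ, hδ, fun u hu => ?_⟩
  have hslope := (convex_Icc (0 : ℝ) δ).image_sub_le_mul_sub_of_deriv_le
    (h₁.1.continuousOn.mono fun x hx => hx.1)
    (fun x hx => (h₁.hasDerivAt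
      (interior_Icc (a := (0 : ℝ)) ▸ hx).1).differentiableAt.differentiableWithinAt)
    (fun x hx => (hderiv (interior_Icc (a := (0 : ℝ)) ▸ hx)).le)
    0 (left_mem_Icc.2 (le_of_lt hδ)) u hu hu.1
  simpa [h₁.2.1] using hslope

theorem eventually_le_mul_rpow {β c : ℝ} (hβ : 2 < β)
    (hlim : Tendsto (fun t : ℝ => deriv f t / t ^ (β - 2)) atTop (𝓝 c)) :
    ∀ᶠ u in atTop, f u ≤ (|c| + 2) * u ^ (β - 1) := by
  have htend : Tendsto (fun t => (|c| + 2) * t ^ (β - 1) - f t) atTop atTop := by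
    refine tendsto_atTop_of_one_le_deriv
      (u' := fun t => (|c| + 2) * ((β - 1) * t ^ (β - 1 - 1)) - deriv f t) ?_
    filter_upwards [eventually_ge_atTop 1, hlim.eventually (gt_mem_nhds (lt_add_one c))]
      with t ht hderiv
    have ht0 : 0 < t := one_pos.trans_le ht
    refine ⟨((Real.hasDerivAt_rpow_const (Or.inl ht0.ne')).const_mul _).sub
      (h₁.hasDerivAt ht0), ?_⟩
    rw [div_lt_iff₀ (by positivity)] at hderiv
    rw [show β - 1 - 1 = β - 2 by ring]
    have hpow : 1 ≤ t ^ (β - 2) := Real.one_le_rpow ht (by linarith)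
    nlinarith [mul_nonneg (show 0 ≤ |c| + 2 by positivity)
      (mul_nonneg (show 0 ≤ β - 2 by linarith) (zero_le_one.trans hpow)),
      mul_le_mul_of_nonneg_right (le_abs_self c) (zero_le_one.trans hpow)]
  filter_upwards [htend.eventually_ge_atTop 0] with u hu
  exact sub_nonneg.1 hu

theorem exists_subcritical_growth {N : ℕ} (h₂ : CondF2 N f) {lam : ℝ} (hlam : 0 < lam) :
    ∃ q, 2 < q ∧ q < crit N ∧ ∃ K, 0 < K ∧ ∀ u, 0 ≤ u → f u ≤ lam * u + K * u ^ (q - 1) := by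
  obtain ⟨δ, hδ, hzero⟩ := exists_le_mul_of_tendsto_deriv h₁ (tendsto_deriv_nhdsGT_zero h₂) hlam
  obtain ⟨_, β, _, _, -, -, -, -, hβ, hβN, -, hlim⟩ := h₂
  exact ⟨β, hβ, hβN, exists_le_mul_add_mul_rpow h₁.1.continuousOn hlam.le hδ (by linarith)
    hzero (eventually_le_mul_rpow h₁ hβ hlim)⟩

theorem tendsto_sub_mul_atTop (hlim : Tendsto (deriv f) atTop atTop) (a : ℝ) :
    Tendsto (fun t => f t - a * t) atTop atTop := by
  refine tendsto_atTop_of_one_le_deriv (u' := fun t => deriv f t - a) ?_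
  filter_upwards [eventually_gt_atTop 0, hlim.eventually_ge_atTop (a + 1)] with t ht hderiv
  exact ⟨(h₁.hasDerivAt ht).sub (by simpa using (hasDerivAt_id t).const_mul a), by linarith⟩

theorem tendsto_F_sub_mul_sq_atTop (hlim : Tendsto (deriv f) atTop atTop) (a : ℝ) :
    Tendsto (fun s => F f s - a * s ^ 2) atTop atTop := by
  refine tendsto_atTop_of_one_le_deriv (u' := fun s => ext f s - a * (2 * s)) ?_
  filter_upwards [eventually_ge_atTop 0,
    (tendsto_sub_mul_atTop h₁ hlim (2 * a)).eventually_ge_atTop 1] with s hs hsup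
  refine ⟨(h₁.hasDerivAt_F s).sub (by simpa using (hasDerivAt_pow 2 s).const_mul a), ?_⟩
  rw [ext_of_nonneg f hs]
  linarith

end Nonlinearity

theorem exists_lipschitzWith_inv_g {k : ℝ} (hk : 0 < k) :
    ∃ L, LipschitzWith L fun t => (g k t)⁻¹ := by
  obtain ⟨L, hL⟩ := exists_lipschitzWith_g hk
  refine ⟨9 * L, LipschitzWith.of_dist_le_mul fun s t => ?_⟩
  have hinv := abs_inv_sub_inv_le (by norm_num) (third_le_g hk s) (third_le_g hk t)
  have hg := hL.dist_le_mul s t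
  rw [Real.dist_eq, Real.dist_eq] at *
  calc |(g k s)⁻¹ - (g k t)⁻¹| ≤ |g k s - g k t| / (1 / 3) ^ 2 := hinv
    _ ≤ L * |s - t| / (1 / 3) ^ 2 := by gcongr
    _ = (9 * L : NNReal) * |s - t| := by
        push_cast
        ring

theorem locallyLipschitz_mul {u v : ℝ → ℝ} (hu : LocallyLipschitz u) (hv : LocallyLipschitz v) :
    LocallyLipschitz fun s => u s * v s :=
  (contDiff_mul (𝕜 := ℝ) (𝔸 := ℝ) (n := 1)).locallyLipschitz.comp (hu.prodMk hv)

/-- The nonlinearity `(f(G⁻¹(s)) - lam * G⁻¹(s)) / g(G⁻¹(s))` for which the equation reads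
`-Δv = rhs v`. -/
def rhs (f : ℝ → ℝ) (lam k s : ℝ) : ℝ :=
  (ext f (Ginv k s) - lam * Ginv k s) / g k (Ginv k s)

/-- The primitive of `rhs` vanishing at `0`. -/
def rhsPrim (f : ℝ → ℝ) (lam k s : ℝ) : ℝ := F f (Ginv k s) - lam / 2 * Ginv k s ^ 2

section Rhs

variable {f : ℝ → ℝ} (lam : ℝ) {k : ℝ} (hk : 0 < k)
include hk

theorem rhsPrim_zero : rhsPrim f lam k 0 = 0 := by
  simp [rhsPrim, Ginv_zero hk, F_zero]

variable (hf : CondF1 f)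
include hf

theorem rhs_zero : rhs f lam k 0 = 0 := by
  simp [rhs, Ginv_zero hk, ext, hf.2.1]

theorem hasDerivAt_rhsPrim (s : ℝ) : HasDerivAt (rhsPrim f lam k) (rhs f lam k s) s := by
  have hG := hasDerivAt_Ginv hk s
  refine (((hf.hasDerivAt_F (Ginv k s)).comp s hG).sub
    ((hG.pow 2).const_mul (lam / 2))).congr_deriv ?_
  rw [rhs]
  simp only [Nat.cast_ofNat, Nat.add_one_sub_one, pow_one, div_eq_mul_inv]
  ring

theorem locallyLipschitz_rhs : LocallyLipschitz (rhs f lam k) := by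
  obtain ⟨L, hL⟩ := exists_lipschitzWith_inv_g hk
  have hlin : LocallyLipschitz fun u : ℝ => lam * u := (lipschitzWith_smul lam).locallyLipschitz
  have hquot : LocallyLipschitz fun u => (ext f u - lam * u) * (g k u)⁻¹ :=
    locallyLipschitz_mul (hf.locallyLipschitz_ext.sub hlin) hL.locallyLipschitz
  exact hquot.comp (lipschitzWith_Ginv hk).locallyLipschitz

theorem continuous_rhs : Continuous (rhs f lam k) := (locallyLipschitz_rhs lam hk hf).continuous

end Rhs

theorem abs_sub_sub_mul_le {φ ψ : ℝ → ℝ} {s : Set ℝ} (hs : Convex ℝ s)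
    (hφ : ∀ x ∈ s, HasDerivAt φ (ψ x) x) {L : NNReal} (hL : LipschitzOnWith L ψ s) {a b : ℝ}
    (ha : a ∈ s) (hb : b ∈ s) : |φ b - φ a - ψ a * (b - a)| ≤ L * (b - a) ^ 2 := by
  have hsub : uIcc a b ⊆ s := hs.ordConnected.uIcc_subset ha hb
  have hmvt : ‖(φ b - ψ a * b) - (φ a - ψ a * a)‖ ≤ L * |b - a| * ‖b - a‖ := by
    refine (convex_uIcc a b).norm_image_sub_le_of_norm_hasDerivWithin_le
      (f := fun x => φ x - ψ a * x) (f' := fun x => ψ x - ψ a) (fun x hx => ?_) (fun x hx => ?_)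
      left_mem_uIcc right_mem_uIcc
    · exact (((hφ x (hsub hx)).sub ((hasDerivAt_id x).const_mul (ψ a))).congr_deriv
        (by simp)).hasDerivWithinAt
    · calc ‖ψ x - ψ a‖ ≤ L * |x - a| := hL.norm_sub_le (hsub hx) ha
        _ ≤ L * |b - a| := mul_le_mul_of_nonneg_left (abs_sub_left_of_mem_uIcc hx) L.2
  calc |φ b - φ a - ψ a * (b - a)| = ‖(φ b - ψ a * b) - (φ a - ψ a * a)‖ := by
        rw [Real.norm_eq_abs]
        ring_nf
    _ ≤ L * |b - a| * ‖b - a‖ := hmvt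
    _ = L * (b - a) ^ 2 := by rw [Real.norm_eq_abs, mul_assoc, ← sq, sq_abs]

/-! ### The Pohozaev identity -/

section Dilation

variable {V : Type*} [NormedAddCommGroup V] [NormedSpace ℝ V] [FiniteDimensional ℝ V]
  [MeasurableSpace V] [BorelSpace V] {μ : Measure V} [μ.IsAddHaarMeasure] {t : ℝ}

theorem ae_comp_smul {P : V → Prop} (hP : ∀ᵐ x ∂μ, P x) (ht : t ≠ 0) : ∀ᵐ x ∂μ, P (t • x) := by
  refine ae_of_ae_map (f := (t • ·)) (measurable_const_smul t).aemeasurable ?_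
  rw [Measure.map_addHaar_smul _ ht]
  exact Measure.ae_smul_measure hP _

theorem memLp_comp_smul {F : Type*} [NormedAddCommGroup F] {p : ENNReal} {w : V → F}
    (hw : MemLp w p μ) (ht : t ≠ 0) : MemLp (fun x => w (t • x)) p μ := by
  have he : MeasurableEmbedding fun x : V => t • x :=
    (Homeomorph.smulOfNeZero t ht).measurableEmbedding
  have hmap : MemLp w p (μ.map (t • ·)) := by
    rw [Measure.map_addHaar_smul _ ht]
    exact hw.smul_measure ENNReal.ofReal_ne_top
  exact he.memLp_map_measure_iff.1 hmap

theorem enorm_integral_sq_le_lintegral {α F : Type*} [MeasurableSpace α] {μ : Measure α}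
    [IsProbabilityMeasure μ] [NormedAddCommGroup F] [NormedSpace ℝ F] {u : α → F}
    (hu : AEStronglyMeasurable u μ) : ‖∫ s, u s ∂μ‖ₑ ^ 2 ≤ ∫⁻ s, ‖u s‖ₑ ^ 2 ∂μ :=
  calc ‖∫ s, u s ∂μ‖ₑ ^ 2 ≤ eLpNorm u 1 μ ^ 2 := by
        gcongr
        rw [eLpNorm_one_eq_lintegral_enorm]
        exact enorm_integral_le_lintegral_enorm _
    _ ≤ eLpNorm u 2 μ ^ 2 := by
        gcongr
        exact eLpNorm_le_eLpNorm_of_exponent_le (by norm_num) hu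
    _ = ∫⁻ s, ‖u s‖ₑ ^ 2 ∂μ := eLpNorm_two_pow_two u

end Dilation

section SobolevDilation

variable {N : ℕ} {v φ : E N → ℝ} {w : E N → E N} {t : ℝ}

theorem integral_comp_smul_of_pos (a : E N → ℝ) (ht : 0 < t) :
    ∫ x, a (t • x) = (t ^ N)⁻¹ * ∫ x, a x := by
  rw [Measure.integral_comp_smul_of_nonneg volume a t (hR := ht.le), finrank_euclideanSpace,
    Fintype.card_fin, smul_eq_mul]

theorem lintegral_comp_smul_of_pos {a : E N → ENNReal} (ha : Measurable a) (ht : 0 < t) :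
    ∫⁻ x, a (t • x) = ENNReal.ofReal (t ^ N)⁻¹ * ∫⁻ x, a x := by
  rw [← lintegral_map (g := (t • ·)) ha (measurable_const_smul t),
    Measure.map_addHaar_smul _ ht.ne', lintegral_smul_measure, abs_of_nonneg (by positivity),
    finrank_euclideanSpace, Fintype.card_fin, smul_eq_mul]

theorem IsTest.comp_smul (hφ : IsTest φ) (ht : t ≠ 0) : IsTest fun x => φ (t • x) :=
  ⟨hφ.1.comp (contDiff_const_smul t), hφ.2.comp_homeomorph (Homeomorph.smulOfNeZero t ht)⟩

theorem MemH1.comp_smul (h : MemH1 v w) (ht : 0 < t) :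
    MemH1 (fun x => v (t • x)) (fun x => t • w (t • x)) where
  memLp := memLp_comp_smul h.memLp ht.ne'
  memLp_grad := (memLp_comp_smul h.memLp_grad ht.ne').const_smul t
  isWeakGradient := by
    intro φ hφ y
    let χ : E N → ℝ := fun z => φ (t⁻¹ • z)
    have hχ : IsTest χ := hφ.comp_smul (inv_ne_zero ht.ne')
    have hφχ : φ = fun x => χ (t • x) := by
      ext x
      simp only [χ, inv_smul_smul₀ ht.ne']
    have hderiv (x : E N) : fderiv ℝ φ x y = t * fderiv ℝ χ (t • x) y := by
      rw [hφχ, fderiv_comp_smul]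
      rfl
    calc ∫ x, v (t • x) * fderiv ℝ φ x y
        = ∫ x, t * (v (t • x) * fderiv ℝ χ (t • x) y) := by
          simp only [hderiv, mul_left_comm]
      _ = (t ^ N)⁻¹ * (t * ∫ z, v z * fderiv ℝ χ z y) := by
          rw [integral_comp_smul_of_pos (fun z => t * (v z * fderiv ℝ χ z y)) ht,
            integral_const_mul]
      _ = -((t ^ N)⁻¹ * ∫ z, t * (χ z * inner ℝ (w z) y)) := by
          rw [h.isWeakGradient χ hχ y, integral_const_mul]
          ring
      _ = -∫ x, φ x * inner ℝ (t • w (t • x)) y := by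
          rw [← integral_comp_smul_of_pos (fun z => t * (χ z * inner ℝ (w z) y)) ht]
          simp only [hφχ, real_inner_smul_left, mul_left_comm]

theorem IsTest.dilate_sub_eq_integral (hφ : IsTest φ) (t : ℝ) (x : E N) :
    φ (t • x) - φ x =
      ∫ s in Ioc (0 : ℝ) 1, inner ℝ (gradient φ ((1 + s * (t - 1)) • x)) ((t - 1) • x) := by
  let c : ℝ → E N := fun s => (1 + s * (t - 1)) • x
  have hc (s : ℝ) : HasDerivAt c ((t - 1) • x) s := by
    have hlin : HasDerivAt (fun s : ℝ => 1 + s * (t - 1)) (t - 1) s := by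
      simpa only [one_mul, id_eq] using ((hasDerivAt_id s).mul_const (t - 1)).const_add 1
    exact hlin.smul_const x
  have hderiv (s : ℝ) :
      HasDerivAt (fun s => φ (c s)) (inner ℝ (gradient φ (c s)) ((t - 1) • x)) s := by
    rw [inner_gradient_left]
    exact (hφ.differentiable (c s)).hasFDerivAt.comp_hasDerivAt s (hc s)
  have hcont : Continuous fun s => inner ℝ (gradient φ (c s)) ((t - 1) • x) :=
    (hφ.continuous_gradient.comp (by fun_prop)).inner continuous_const
  rw [← intervalIntegral.integral_of_le zero_le_one,
    intervalIntegral.integral_eq_sub_of_hasDerivAt (f := fun s => φ (c s)) (fun s _ => hderiv s)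
      (hcont.intervalIntegrable _ _)]
  simp [c]

theorem IsTest.enorm_dilate_sub_sq_le (hφ : IsTest φ) (t : ℝ) (x : E N) :
    ‖φ (t • x) - φ x‖ₑ ^ 2 ≤ ENNReal.ofReal ((‖x‖ * |t - 1|) ^ 2)
      * ∫⁻ s in Ioc (0 : ℝ) 1, ‖gradient φ ((1 + s * (t - 1)) • x)‖ₑ ^ 2 := by
  have hprob : IsProbabilityMeasure (volume.restrict (Ioc (0 : ℝ) 1)) := ⟨by simp⟩
  have hcont : Continuous fun s : ℝ => gradient φ ((1 + s * (t - 1)) • x) :=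
    hφ.continuous_gradient.comp (by fun_prop)
  rw [hφ.dilate_sub_eq_integral t x, ← lintegral_const_mul' _ _ ENNReal.ofReal_ne_top]
  refine (enorm_integral_sq_le_lintegral
    (hcont.inner continuous_const).aestronglyMeasurable).trans (lintegral_mono fun s => ?_)
  rw [ENNReal.ofReal_pow (by positivity), ← mul_pow]
  gcongr
  rw [← ofReal_norm, ← ofReal_norm, ← ENNReal.ofReal_mul (by positivity)]
  refine ENNReal.ofReal_le_ofReal ((norm_inner_le_norm _ _).trans_eq ?_)
  rw [norm_smul, Real.norm_eq_abs]
  ring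

theorem IsTest.lintegral_lintegral_gradient_dilate_le (hφ : IsTest φ) (ht : 1 / 2 ≤ t) :
    ∫⁻ x, ∫⁻ s in Ioc (0 : ℝ) 1, ‖gradient φ ((1 + s * (t - 1)) • x)‖ₑ ^ 2
      ≤ ENNReal.ofReal (2 ^ N) * eLpNorm (gradient φ) 2 volume ^ 2 := by
  have hmeas : Measurable fun x => ‖gradient φ x‖ₑ ^ 2 :=
    hφ.continuous_gradient.enorm.measurable.pow_const 2
  have hdilate {s : ℝ} (hs : s ∈ Ioc (0 : ℝ) 1) :
      ∫⁻ x, ‖gradient φ ((1 + s * (t - 1)) • x)‖ₑ ^ 2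
        ≤ ENNReal.ofReal (2 ^ N) * ∫⁻ x, ‖gradient φ x‖ₑ ^ 2 := by
    have hs2 : 1 / 2 ≤ 1 + s * (t - 1) := by nlinarith [hs.1, hs.2]
    rw [lintegral_comp_smul_of_pos hmeas (by linarith), ← inv_pow]
    gcongr
    rw [inv_le_comm₀ (by linarith) two_pos]
    linarith
  rw [lintegral_lintegral_swap, eLpNorm_two_pow_two]
  · refine (setLIntegral_mono' measurableSet_Ioc fun s hs => hdilate hs).trans_eq ?_
    simp
  · have hcont : Continuous fun p : E N × ℝ => gradient φ ((1 + p.2 * (t - 1)) • p.1) :=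
      hφ.continuous_gradient.comp (by fun_prop)
    exact (hcont.enorm.measurable.pow_const 2).aemeasurable

theorem IsTest.eLpNorm_dilate_sub_le (hφ : IsTest φ) (ht : 1 / 2 ≤ t) {r : ℝ} (hr : 0 ≤ r) :
    eLpNorm (fun x => φ (t • x) - φ x) 2 (volume.restrict (Metric.closedBall 0 r))
      ≤ ENNReal.ofReal (r * |t - 1| * 2 ^ N) * eLpNorm (gradient φ) 2 volume := by
  refine (ENNReal.pow_le_pow_left_iff two_ne_zero).1 ?_
  calc eLpNorm (fun x => φ (t • x) - φ x) 2 (volume.restrict (Metric.closedBall 0 r)) ^ 2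
      = ∫⁻ x in Metric.closedBall 0 r, ‖φ (t • x) - φ x‖ₑ ^ 2 := eLpNorm_two_pow_two _
    _ ≤ ∫⁻ x in Metric.closedBall 0 r, ENNReal.ofReal ((r * |t - 1|) ^ 2)
        * ∫⁻ s in Ioc (0 : ℝ) 1, ‖gradient φ ((1 + s * (t - 1)) • x)‖ₑ ^ 2 := by
        refine setLIntegral_mono' measurableSet_closedBall fun x hx => ?_
        refine (hφ.enorm_dilate_sub_sq_le t x).trans ?_
        gcongr
        exact mem_closedBall_zero_iff.1 hx
    _ ≤ ENNReal.ofReal ((r * |t - 1|) ^ 2)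
        * ∫⁻ x, ∫⁻ s in Ioc (0 : ℝ) 1, ‖gradient φ ((1 + s * (t - 1)) • x)‖ₑ ^ 2 := by
        rw [lintegral_const_mul' _ _ ENNReal.ofReal_ne_top]
        gcongr
        exact Measure.restrict_le_self
    _ ≤ ENNReal.ofReal ((r * |t - 1|) ^ 2)
        * (ENNReal.ofReal (2 ^ N) * eLpNorm (gradient φ) 2 volume ^ 2) := by
        gcongr
        exact hφ.lintegral_lintegral_gradient_dilate_le ht
    _ ≤ ENNReal.ofReal ((r * |t - 1|) ^ 2)
        * (ENNReal.ofReal ((2 ^ N) ^ 2) * eLpNorm (gradient φ) 2 volume ^ 2) := by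
        gcongr
        exact le_self_pow₀ (one_le_pow₀ one_le_two) two_ne_zero
    _ = (ENNReal.ofReal (r * |t - 1| * 2 ^ N) * eLpNorm (gradient φ) 2 volume) ^ 2 := by
        rw [← mul_assoc, ← ENNReal.ofReal_mul (by positivity), ← mul_pow,
          ENNReal.ofReal_pow (by positivity), mul_pow]

theorem MemH1.eLpNorm_dilate_sub_le (h : MemH1 v w) (ht : 1 / 2 ≤ t) {r : ℝ} (hr : 0 ≤ r) :
    eLpNorm (fun x => v (t • x) - v x) 2 (volume.restrict (Metric.closedBall 0 r))
      ≤ ENNReal.ofReal (r * |t - 1| * 2 ^ N) * eLpNorm w 2 volume := by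
  obtain ⟨φ, hφ, -, hgrad, hae⟩ := h.exists_seq_isTest
  have hbound (n : ℕ) :
      eLpNorm (fun x => φ n (t • x) - φ n x) 2 (volume.restrict (Metric.closedBall 0 r))
        ≤ ENNReal.ofReal (r * |t - 1| * 2 ^ N) * (eLpNorm w 2 volume
          + eLpNorm (fun x => gradient (φ n) x - w x) 2 volume) := by
    refine ((hφ n).eLpNorm_dilate_sub_le ht hr).trans ?_
    gcongr
    convert! eLpNorm_add_le (p := 2) (μ := volume) h.memLp_grad.1
      ((hφ n).memH1.memLp_grad.1.sub h.memLp_grad.1) (by norm_num) using 2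
    ext x
    simp
  have hlim := ENNReal.Tendsto.const_mul (a := ENNReal.ofReal (r * |t - 1| * 2 ^ N))
    (hgrad.const_add (eLpNorm w 2 volume)) (Or.inr ENNReal.ofReal_ne_top)
  rw [add_zero] at hlim
  refine (Lp.eLpNorm_lim_le_liminf_eLpNorm (f := fun n x => φ n (t • x) - φ n x)
    (fun n => ?_) _ (ae_restrict_of_ae ?_)).trans
    ((liminf_le_liminf (Eventually.of_forall hbound)).trans_eq hlim.liminf_eq)
  · have hcont := (hφ n).1.continuous
    exact (by fun_prop : Continuous fun x => φ n (t • x) - φ n x).aestronglyMeasurable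
  · filter_upwards [hae, ae_comp_smul hae (by linarith : t ≠ 0)] with x hx hxt
    exact hxt.sub hx

theorem MemH1.setIntegral_dilate_sub_sq_le (h : MemH1 v w) (ht : 1 / 2 ≤ t) {r : ℝ}
    (hr : 0 ≤ r) :
    ∫ x in Metric.closedBall 0 r, (v (t • x) - v x) ^ 2
      ≤ (r * |t - 1| * 2 ^ N) ^ 2 * ∫ x, ‖w x‖ ^ 2 := by
  have hmem : MemLp (fun x => v (t • x) - v x) 2 (volume.restrict (Metric.closedBall 0 r)) :=
    ((memLp_comp_smul h.memLp (by linarith)).sub h.memLp).restrict _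
  have hsq := pow_le_pow_left' (h.eLpNorm_dilate_sub_le ht hr) 2
  rw [mul_pow, ← ofReal_integral_norm_sq hmem, ← ofReal_integral_norm_sq h.memLp_grad,
    ← ENNReal.ofReal_pow (by positivity), ← ENNReal.ofReal_mul (by positivity),
    ENNReal.ofReal_le_ofReal_iff (by positivity)] at hsq
  simpa only [Real.norm_eq_abs, sq_abs] using hsq

end SobolevDilation

section OneSided

variable {Q : ℝ → ℝ} {q a A D : ℝ}

theorem deriv_le_of_sub_le (hQ : HasDerivAt Q q a)
    (h : ∀ᶠ t in 𝓝[>] a, Q t - Q a ≤ A * |t - a| + D * |t - a| ^ 2) : q ≤ A := by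
  have hslope : Tendsto (slope Q a) (𝓝[>] a) (𝓝 q) :=
    (hasDerivAt_iff_tendsto_slope.1 hQ).mono_left (nhdsWithin_mono _ fun t ht => ne_of_gt ht)
  have hbound : Tendsto (fun t => A + D * (t - a)) (𝓝[>] a) (𝓝 A) := by
    have hcont : Continuous fun t => A + D * (t - a) := by fun_prop
    simpa only [sub_self, mul_zero, add_zero] using
      (hcont.tendsto a).mono_left nhdsWithin_le_nhds
  refine le_of_tendsto_of_tendsto hslope hbound ?_
  filter_upwards [h, self_mem_nhdsWithin] with t ht hta
  have hpos : 0 < t - a := sub_pos.2 hta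
  rw [abs_of_pos hpos] at ht
  rw [slope_def_field, div_le_iff₀ hpos]
  linarith

theorem abs_deriv_le_of_sub_le (hQ : HasDerivAt Q q a)
    (h : ∀ᶠ t in 𝓝 a, Q t - Q a ≤ A * |t - a| + D * |t - a| ^ 2) : |q| ≤ A := by
  refine abs_le'.2 ⟨deriv_le_of_sub_le hQ (h.filter_mono nhdsWithin_le_nhds), ?_⟩
  have hreflect : Tendsto (fun t => 2 * a - t) (𝓝 a) (𝓝 a) := by
    have hcont : Continuous fun t => 2 * a - t := by fun_prop
    simpa only [two_mul, add_sub_cancel_right] using hcont.tendsto a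
  refine deriv_le_of_sub_le (Q := fun t => Q (2 * a - t)) (a := a) (D := D) ?_ ?_
  · exact HasDerivAt.comp_const_sub (2 * a) a (by simpa only [two_mul, add_sub_cancel_right])
  · filter_upwards [(hreflect.eventually h).filter_mono nhdsWithin_le_nhds] with t ht
    have habs : |2 * a - t - a| = |t - a| := by
      rw [← abs_neg]
      ring_nf
    have hQa : Q (2 * a - a) = Q a := by ring_nf
    rw [habs] at ht
    simpa only [hQa] using ht

end OneSided

section CutoffDilation

variable {N : ℕ} {C R t : ℝ}

theorem abs_cutoff_inv_smul_sub_le (hC : ∀ x, ‖gradient (cutoffBump N) x‖ ≤ C) (hR : 0 < R)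
    (ht : t ∈ Icc (1 / 2 : ℝ) 2) (x : E N) :
    |cutoff R (t⁻¹ • x) - cutoff R x|
      ≤ 8 * C * |t - 1| * (Metric.closedBall 0 (R / 2))ᶜ.indicator 1 x := by
  have ht0 : 0 < t := by linarith [ht.1]
  have hC0 : 0 ≤ C := (norm_nonneg _).trans (hC 0)
  have hle : t⁻¹ ≤ 2 := (inv_le_comm₀ ht0 two_pos).2 (by linarith [ht.1])
  have hge : 1 / 2 ≤ t⁻¹ := (le_inv_comm₀ one_half_pos ht0).2 (by linarith [ht.2])
  have hnorm : ‖t⁻¹ • x‖ = t⁻¹ * ‖x‖ := by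
    rw [norm_smul, norm_inv, Real.norm_of_nonneg ht0.le]
  have hx0 := norm_nonneg x
  by_cases hx : x ∈ Metric.closedBall 0 (R / 2)
  · have hxR : ‖x‖ ≤ R / 2 := mem_closedBall_zero_iff.1 hx
    rw [cutoff_eq_one hR (by rw [hnorm]; nlinarith), cutoff_eq_one hR (by linarith),
      indicator_of_notMem (notMem_compl_iff.2 hx), sub_self, abs_zero, mul_zero]
  rw [indicator_of_mem (mem_compl hx), Pi.one_apply, mul_one]
  rcases le_or_gt (4 * R) ‖x‖ with hx4 | hx4
  · rw [cutoff_eq_zero hR (by rw [hnorm]; nlinarith), cutoff_eq_zero hR (by linarith), sub_self,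
      abs_zero]
    positivity
  calc |cutoff R (t⁻¹ • x) - cutoff R x| ≤ C * ‖R⁻¹ • t⁻¹ • x - R⁻¹ • x‖ :=
        abs_cutoffBump_sub_le hC _ _
    _ = C * (R⁻¹ * (t⁻¹ * |t - 1|) * ‖x‖) := by
        have hsmul : R⁻¹ • t⁻¹ • x - R⁻¹ • x = (R⁻¹ * (t⁻¹ * (1 - t))) • x := by
          rw [smul_smul, ← sub_smul]
          congr 1
          field_simp
        rw [hsmul, norm_smul, norm_mul, norm_mul, norm_inv, norm_inv, Real.norm_of_nonneg ht0.le,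
          Real.norm_of_nonneg hR.le, Real.norm_eq_abs, abs_sub_comm]
    _ ≤ C * (R⁻¹ * (2 * |t - 1|) * (4 * R)) := by gcongr
    _ = 8 * C * |t - 1| := by
        field_simp
        ring

theorem integrable_cutoff_mul (hR : 0 < R) {a : E N → ℝ} (ha : Integrable a volume) :
    Integrable (fun x => cutoff R x * a x) volume :=
  ha.bdd_mul (c := 1) (isTest_cutoff hR).1.continuous.aestronglyMeasurable
    (ae_of_all _ fun _ => norm_cutoff_le_one _ _)

theorem abs_integral_cutoff_comp_smul_sub_le (hC : ∀ x, ‖gradient (cutoffBump N) x‖ ≤ C)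
    (hR : 0 < R) (ht : t ∈ Icc (1 / 2 : ℝ) 2) {a : E N → ℝ} (ha : Integrable a volume) :
    |(∫ x, cutoff R x * a (t • x)) - (t ^ N)⁻¹ * ∫ x, cutoff R x * a x|
      ≤ 2 ^ N * (8 * C * |t - 1| * ∫ x in (Metric.closedBall 0 (R / 2))ᶜ, |a x|) := by
  have ht0 : 0 < t := by linarith [ht.1]
  have hmeas : MeasurableSet (Metric.closedBall (0 : E N) (R / 2))ᶜ :=
    measurableSet_closedBall.compl
  have hint : Integrable (fun x => cutoff R (t⁻¹ • x) * a x) volume :=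
    ha.bdd_mul (c := 1) ((isTest_cutoff hR).1.continuous.comp
      (continuous_const_smul t⁻¹)).aestronglyMeasurable
      (ae_of_all _ fun _ => norm_cutoff_le_one _ _)
  have hscale : ∫ x, cutoff R x * a (t • x) = (t ^ N)⁻¹ * ∫ x, cutoff R (t⁻¹ • x) * a x := by
    rw [← integral_comp_smul_of_pos (fun x => cutoff R (t⁻¹ • x) * a x) ht0]
    simp only [inv_smul_smul₀ ht0.ne']
  have hpow : (t ^ N)⁻¹ ≤ 2 ^ N := by
    rw [← inv_pow]
    exact pow_le_pow_left₀ (by positivity) ((inv_le_comm₀ ht0 two_pos).2 (by linarith [ht.1])) N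
  rw [hscale, ← mul_sub, ← integral_sub hint (integrable_cutoff_mul hR ha), abs_mul,
    abs_of_pos (by positivity), ← integral_indicator hmeas, ← integral_const_mul]
  gcongr
  refine abs_integral_le_integral_abs.trans (integral_mono_of_nonneg
    (ae_of_all _ fun _ => abs_nonneg _) ((ha.abs.indicator hmeas).const_mul _)
    (ae_of_all _ fun x => ?_))
  calc |cutoff R (t⁻¹ • x) * a x - cutoff R x * a x|
      = |cutoff R (t⁻¹ • x) - cutoff R x| * |a x| := by rw [← sub_mul, abs_mul]
    _ ≤ 8 * C * |t - 1| * (Metric.closedBall 0 (R / 2))ᶜ.indicator 1 x * |a x| := by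
        gcongr
        exact abs_cutoff_inv_smul_sub_le hC hR ht x
    _ = 8 * C * |t - 1| * (Metric.closedBall 0 (R / 2))ᶜ.indicator (fun x => |a x|) x := by
        rw [mul_assoc, ← indicator_mul_left _ _ (fun x => |a x|)]
        simp only [Pi.one_apply, one_mul]

theorem tendsto_integral_cutoff {a : E N → ℝ} (ha : Integrable a volume) :
    Tendsto (fun n : ℕ => ∫ x, cutoff ((n : ℝ) + 1) x * a x) atTop (𝓝 (∫ x, a x)) := by
  refine tendsto_integral_of_dominated_convergence (fun x => ‖a x‖)
    (fun n => (integrable_cutoff_mul (by positivity) ha).1) ha.norm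
    (fun n => ae_of_all _ fun x => ?_) (ae_of_all _ fun x => ?_)
  · rw [norm_mul]
    exact mul_le_of_le_one_left (norm_nonneg _) (norm_cutoff_le_one _ _)
  · simpa only [one_mul] using (tendsto_cutoff x).mul_const (a x)

theorem tendsto_setIntegral_compl_closedBall {a : E N → ℝ} (ha : Integrable a volume) :
    Tendsto (fun n : ℕ => ∫ x in (Metric.closedBall 0 (((n : ℝ) + 1) / 2))ᶜ, a x) atTop (𝓝 0) := by
  have hempty : ⋂ n : ℕ, (Metric.closedBall (0 : E N) (((n : ℝ) + 1) / 2))ᶜ = ∅ := by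
    refine eq_empty_of_forall_notMem fun x hx => ?_
    obtain ⟨n, hn⟩ := exists_nat_gt (2 * ‖x‖)
    exact mem_iInter.1 hx n (mem_closedBall_zero_iff.2 (by linarith))
  have hlim := tendsto_setIntegral_of_antitone (μ := volume) (f := a)
    (s := fun n : ℕ => (Metric.closedBall (0 : E N) (((n : ℝ) + 1) / 2))ᶜ)
    (fun _ => measurableSet_closedBall.compl)
    (fun m n hmn => compl_subset_compl.2 (Metric.closedBall_subset_closedBall (by gcongr)))
    ⟨0, ha.integrableOn⟩
  rwa [hempty, setIntegral_empty] at hlim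

end CutoffDilation

section Pohozaev

variable {N : ℕ} {v v' : E N → ℝ} {w w' : E N → E N} {h H : ℝ → ℝ} {M R η C t : ℝ} {L : NNReal}

theorem mul_le_mul_sq_add_sq_div (hη : 0 < η) (a b : ℝ) : a * b ≤ η * a ^ 2 + b ^ 2 / η := by
  have hsq : η * a ^ 2 + b ^ 2 / η - a * b
      = η * ((a - b / (2 * η)) ^ 2 + 3 * (b / (2 * η)) ^ 2) := by
    field_simp
    ring
  have hnonneg : 0 ≤ η * ((a - b / (2 * η)) ^ 2 + 3 * (b / (2 * η)) ^ 2) := by positivity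
  linarith

theorem cutoff_mul_le_indicator (hR : 0 < R) {d : E N → ℝ} (hd : ∀ x, 0 ≤ d x) (x : E N) :
    cutoff R x * d x ≤ (Metric.closedBall 0 (2 * R)).indicator d x := by
  by_cases hx : x ∈ Metric.closedBall (0 : E N) (2 * R)
  · rw [indicator_of_mem hx]
    exact mul_le_of_le_one_left (hd x) (cutoff_le_one R x)
  · rw [indicator_of_notMem hx, cutoff_eq_zero hR (le_of_lt (by simpa using hx)), zero_mul]

theorem abs_mul_norm_mul_norm_gradient_cutoff_le (hC : ∀ x, ‖gradient (cutoffBump N) x‖ ≤ C)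
    (hR : 0 < R) (hη : 0 < η) (d : E N → ℝ) (w : E N → E N) (x : E N) :
    |d x| * (‖w x‖ * ‖gradient (cutoff R) x‖)
      ≤ η * (Metric.closedBall 0 (2 * R)).indicator (fun x => d x ^ 2) x
        + (C / R) ^ 2 / η * (Metric.closedBall 0 (R / 2))ᶜ.indicator (fun x => ‖w x‖ ^ 2) x := by
  have hball : 0 ≤ (Metric.closedBall 0 (2 * R)).indicator (fun x => d x ^ 2) x :=
    indicator_nonneg (fun _ _ => sq_nonneg _) x
  have htail : 0 ≤ (Metric.closedBall 0 (R / 2))ᶜ.indicator (fun x => ‖w x‖ ^ 2) x :=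
    indicator_nonneg (fun _ _ => sq_nonneg _) x
  rcases lt_or_ge ‖x‖ R with hxR | hxR
  · rw [gradient_cutoff_eq_zero_of_lt hR hxR, norm_zero, mul_zero, mul_zero]
    positivity
  rcases lt_or_ge (2 * R) ‖x‖ with hx2R | hx2R
  · rw [gradient_cutoff_eq_zero_of_gt hR hx2R, norm_zero, mul_zero, mul_zero]
    positivity
  rw [indicator_of_mem (mem_closedBall_zero_iff.2 hx2R),
    indicator_of_mem (mt mem_closedBall_zero_iff.1 (by linarith : ¬‖x‖ ≤ R / 2))]
  calc |d x| * (‖w x‖ * ‖gradient (cutoff R) x‖)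
      ≤ η * |d x| ^ 2 + (‖w x‖ * ‖gradient (cutoff R) x‖) ^ 2 / η :=
        mul_le_mul_sq_add_sq_div hη _ _
    _ ≤ η * |d x| ^ 2 + (‖w x‖ * (C / R)) ^ 2 / η := by
        gcongr
        exact norm_gradient_cutoff_le hC hR x
    _ = η * d x ^ 2 + (C / R) ^ 2 / η * ‖w x‖ ^ 2 := by
        rw [sq_abs]
        ring

theorem inner_cutoff_smul_sub_add_le (a b c : E N) {s : ℝ} (hs : 0 ≤ s) (d : ℝ) :
    inner ℝ a (s • (b - a) + d • c)
      ≤ 1 / 2 * (s * ‖b‖ ^ 2 - s * ‖a‖ ^ 2) + |d| * (‖a‖ * ‖c‖) := by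
  have hcross : inner ℝ a (d • c) ≤ |d| * (‖a‖ * ‖c‖) := by
    refine (real_inner_le_norm _ _).trans_eq ?_
    rw [norm_smul, Real.norm_eq_abs]
    ring
  have hdiff : inner ℝ a (b - a) ≤ 1 / 2 * (‖b‖ ^ 2 - ‖a‖ ^ 2) := by
    have hsq := norm_sub_sq_real b a
    rw [inner_sub_right, real_inner_self_eq_norm_sq, real_inner_comm]
    linarith [sq_nonneg ‖b - a‖]
  rw [inner_add_right, real_inner_smul_right]
  linarith [mul_le_mul_of_nonneg_left hdiff hs]

theorem MemH1.integral_inner_cutoff_mul_sub_le (hC : ∀ x, ‖gradient (cutoffBump N) x‖ ≤ C)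
    (hR : 0 < R) (hη : 0 < η) (hv : MemH1 v w) (hv' : MemH1 v' w') :
    ∫ x, inner ℝ (w x) (cutoff R x • (w' x - w x) + (v' x - v x) • gradient (cutoff R) x)
      ≤ 1 / 2 * ((∫ x, cutoff R x * ‖w' x‖ ^ 2) - ∫ x, cutoff R x * ‖w x‖ ^ 2)
        + (η * (∫ x in Metric.closedBall 0 (2 * R), (v' x - v x) ^ 2)
          + (C / R) ^ 2 / η * ∫ x in (Metric.closedBall 0 (R / 2))ᶜ, ‖w x‖ ^ 2) := by
  have hmeas : MeasurableSet (Metric.closedBall (0 : E N) (R / 2))ᶜ :=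
    measurableSet_closedBall.compl
  have hsq := integrable_cutoff_mul hR hv.memLp_grad.norm.integrable_sq
  have hsq' := integrable_cutoff_mul hR hv'.memLp_grad.norm.integrable_sq
  have hball := ((hv'.sub hv).memLp.integrable_sq.indicator
    (measurableSet_closedBall (x := (0 : E N)) (ε := 2 * R))).const_mul η
  have htail := (hv.memLp_grad.norm.integrable_sq.indicator hmeas).const_mul ((C / R) ^ 2 / η)
  have hdiff : Integrable (fun x => 1 / 2 * (cutoff R x * ‖w' x‖ ^ 2 - cutoff R x * ‖w x‖ ^ 2))
    volume := (hsq'.sub hsq).const_mul _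
  rw [← integral_indicator hmeas, ← integral_indicator measurableSet_closedBall,
    ← integral_const_mul, ← integral_const_mul, ← integral_sub hsq' hsq, ← integral_const_mul,
    ← integral_add hball htail, ← integral_add hdiff (by exact hball.add htail)]
  refine integral_mono (integrable_inner_of_memLp hv.memLp_grad
    ((hv'.sub hv).mul_isTest (isTest_cutoff hR)).memLp_grad)
    (hdiff.add (hball.add htail)) fun x => ?_
  exact (inner_cutoff_smul_sub_add_le _ _ _ (cutoff_nonneg R x) _).trans (add_le_add_right
    (abs_mul_norm_mul_norm_gradient_cutoff_le hC hR hη (fun x => v' x - v x) w x) _)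

/-- `v ∈ H¹`, with gradient `w` and `|v| ≤ M`, is a weak solution of `-Δv = h(v)` for a locally
Lipschitz `h` with `h(0) = 0`; `H` is the primitive of `h` vanishing at `0`. -/
structure IsBoundedSolution (h H : ℝ → ℝ) (M : ℝ) (v : E N → ℝ) (w : E N → E N) : Prop where
  memH1 : MemH1 v w
  mem_Icc : ∀ᵐ x, v x ∈ Icc (-M) M
  locallyLipschitz : LocallyLipschitz h
  hasDerivAt : ∀ s, HasDerivAt H (h s) s
  rhs_zero : h 0 = 0
  prim_zero : H 0 = 0
  equation : ∀ (φ : E N → ℝ) (w' : E N → E N), MemH1 φ w' →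
    ∫ x, inner ℝ (w x) (w' x) = ∫ x, h (v x) * φ x

namespace IsBoundedSolution

theorem exists_lipschitzOnWith (s : IsBoundedSolution h H M v w) :
    ∃ L, LipschitzOnWith L h (Icc (-M) M) :=
  s.locallyLipschitz.locallyLipschitzOn.exists_lipschitzOnWith_of_compact isCompact_Icc

theorem continuous_prim (s : IsBoundedSolution h H M v w) : Continuous H :=
  continuous_iff_continuousAt.2 fun x => (s.hasDerivAt x).continuousAt

theorem zero_mem_Icc {a : ℝ} (ha : a ∈ Icc (-M) M) : (0 : ℝ) ∈ Icc (-M) M :=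
  ⟨by linarith [ha.1, ha.2], by linarith [ha.1, ha.2]⟩

theorem integrable_prim_comp (s : IsBoundedSolution h H M v w) (hv' : MemLp v' 2 volume)
    (hM : ∀ᵐ x, v' x ∈ Icc (-M) M) : Integrable (fun x => H (v' x)) volume := by
  obtain ⟨L, hL⟩ := s.exists_lipschitzOnWith
  refine (hv'.integrable_sq.const_mul L).mono'
    (s.continuous_prim.comp_aestronglyMeasurable hv'.1) ?_
  filter_upwards [hM] with x hx
  simpa only [s.prim_zero, s.rhs_zero, sub_zero, zero_mul, Real.norm_eq_abs] using
    abs_sub_sub_mul_le (convex_Icc _ _) (fun x _ => s.hasDerivAt x) hL (zero_mem_Icc hx) hx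

theorem memLp_rhs_comp (s : IsBoundedSolution h H M v w) : MemLp (fun x => h (v x)) 2 volume := by
  obtain ⟨L, hL⟩ := s.exists_lipschitzOnWith
  refine MemLp.of_le_mul (c := L) s.memH1.memLp
    (s.locallyLipschitz.continuous.comp_aestronglyMeasurable s.memH1.memLp.1) ?_
  filter_upwards [s.mem_Icc] with x hx
  simpa only [s.rhs_zero, sub_zero] using hL.norm_sub_le hx (zero_mem_Icc hx)

theorem sub_le_integral_rhs_mul (s : IsBoundedSolution h H M v w)
    (hL : LipschitzOnWith L h (Icc (-M) M)) (hR : 0 < R) (hv' : MemH1 v' w')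
    (hM : ∀ᵐ x, v' x ∈ Icc (-M) M) :
    (∫ x, cutoff R x * H (v' x)) - (∫ x, cutoff R x * H (v x))
        - L * ∫ x in Metric.closedBall 0 (2 * R), (v' x - v x) ^ 2
      ≤ ∫ x, h (v x) * (cutoff R x * (v' x - v x)) := by
  have hH := integrable_cutoff_mul hR (s.integrable_prim_comp s.memH1.memLp s.mem_Icc)
  have hH' := integrable_cutoff_mul hR (s.integrable_prim_comp hv'.memLp hM)
  have hball := ((hv'.sub s.memH1).memLp.integrable_sq.indicator
    (measurableSet_closedBall (x := (0 : E N)) (ε := 2 * R))).const_mul (L : ℝ)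
  rw [← integral_indicator measurableSet_closedBall, ← integral_const_mul,
    ← integral_sub hH' hH, ← integral_sub (by exact hH'.sub hH) hball]
  refine integral_mono_ae ((hH'.sub hH).sub hball) (s.memLp_rhs_comp.integrable_mul
    ((hv'.sub s.memH1).mul_isTest (isTest_cutoff hR)).memLp) ?_
  filter_upwards [s.mem_Icc, hM] with x hx hx'
  have htaylor := (abs_le.1 (abs_sub_sub_mul_le (convex_Icc _ _) (fun x _ => s.hasDerivAt x) hL
    hx hx')).2
  have hcut := mul_le_mul_of_nonneg_left
    (cutoff_mul_le_indicator hR (fun x => sq_nonneg (v' x - v x)) x) L.coe_nonneg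
  have hmul := mul_le_mul_of_nonneg_left htaylor (cutoff_nonneg R x)
  linarith

theorem integral_cutoff_prim_sub_le (s : IsBoundedSolution h H M v w)
    (hL : LipschitzOnWith L h (Icc (-M) M)) (hC : ∀ x, ‖gradient (cutoffBump N) x‖ ≤ C)
    (hR : 0 < R) (hη : 0 < η) (hv' : MemH1 v' w') (hM : ∀ᵐ x, v' x ∈ Icc (-M) M) :
    (∫ x, cutoff R x * H (v' x)) - (∫ x, cutoff R x * H (v x))
      ≤ 1 / 2 * ((∫ x, cutoff R x * ‖w' x‖ ^ 2) - ∫ x, cutoff R x * ‖w x‖ ^ 2)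
        + (η + L) * (∫ x in Metric.closedBall 0 (2 * R), (v' x - v x) ^ 2)
        + (C / R) ^ 2 / η * ∫ x in (Metric.closedBall 0 (R / 2))ᶜ, ‖w x‖ ^ 2 := by
  have hlower := s.sub_le_integral_rhs_mul hL hR hv' hM
  rw [← s.equation _ _ ((hv'.sub s.memH1).mul_isTest (isTest_cutoff hR))] at hlower
  linarith [s.memH1.integral_inner_cutoff_mul_sub_le hC hR hη hv']

theorem integral_cutoff_prim_dilate_sub_le (s : IsBoundedSolution h H M v w)
    (hL : LipschitzOnWith L h (Icc (-M) M)) (hC : ∀ x, ‖gradient (cutoffBump N) x‖ ≤ C)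
    (hR : 0 < R) (ht : 1 / 2 ≤ t) (hη : 0 < η) :
    (∫ x, cutoff R x * H (v (t • x))) - (∫ x, cutoff R x * H (v x))
      ≤ 1 / 2 * (t ^ 2 * (∫ x, cutoff R x * ‖w (t • x)‖ ^ 2) - ∫ x, cutoff R x * ‖w x‖ ^ 2)
        + (η + L) * ((2 * R * |t - 1| * 2 ^ N) ^ 2 * ∫ x, ‖w x‖ ^ 2)
        + (C / R) ^ 2 / η * ∫ x in (Metric.closedBall 0 (R / 2))ᶜ, ‖w x‖ ^ 2 := by
  have ht0 : 0 < t := by linarith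
  have hscale : ∫ x, cutoff R x * ‖t • w (t • x)‖ ^ 2
      = t ^ 2 * ∫ x, cutoff R x * ‖w (t • x)‖ ^ 2 := by
    rw [← integral_const_mul]
    refine integral_congr_ae (ae_of_all _ fun x => ?_)
    simp only [norm_smul, Real.norm_of_nonneg ht0.le]
    ring
  have hdiff := s.integral_cutoff_prim_sub_le hL hC hR hη (s.memH1.comp_smul ht0)
    (ae_comp_smul s.mem_Icc ht0.ne')
  rw [← hscale]
  refine hdiff.trans ?_
  gcongr
  exact s.memH1.setIntegral_dilate_sub_sq_le ht (by positivity)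

theorem hasDerivAt_pohozaev (N : ℕ) (A B : ℝ) :
    HasDerivAt (fun t : ℝ => (t ^ N)⁻¹ * B - 1 / 2 * (t ^ 2 * (t ^ N)⁻¹ * A))
      (-(N : ℝ) * B - 1 / 2 * ((2 - N) * A)) 1 := by
  have hinv : HasDerivAt (fun t : ℝ => (t ^ N)⁻¹) (-(N : ℝ)) 1 :=
    ((hasDerivAt_pow N (1 : ℝ)).inv (by simp)).congr_deriv (by simp)
  have hmul : HasDerivAt (fun t : ℝ => t ^ 2 * (t ^ N)⁻¹) (2 - (N : ℝ)) 1 :=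
    ((hasDerivAt_pow 2 (1 : ℝ)).mul hinv).congr_deriv (by simp; ring)
  exact (hinv.mul_const B).sub ((hmul.mul_const A).const_mul (1 / 2))

theorem abs_pohozaev_cutoff_le (s : IsBoundedSolution h H M v w)
    (hC : ∀ x, ‖gradient (cutoffBump N) x‖ ≤ C) (hR : 0 < R) {ε : ℝ} (hε : 0 < ε) :
    |-(N : ℝ) * (∫ x, cutoff R x * H (v x)) - 1 / 2 * ((2 - N) * ∫ x, cutoff R x * ‖w x‖ ^ 2)|
      ≤ ε * ((2 * 2 ^ N) ^ 2 * ∫ x, ‖w x‖ ^ 2)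
        + (C ^ 2 / ε + 8 * (2 ^ N * C) * 2)
          * (∫ x in (Metric.closedBall 0 (R / 2))ᶜ, ‖w x‖ ^ 2)
        + 8 * (2 ^ N * C) * ∫ x in (Metric.closedBall 0 (R / 2))ᶜ, |H (v x)| := by
  obtain ⟨L, hL⟩ := s.exists_lipschitzOnWith
  refine abs_deriv_le_of_sub_le (D := L * ((2 * R * 2 ^ N) ^ 2 * ∫ x, ‖w x‖ ^ 2))
    (hasDerivAt_pohozaev N _ _) ?_
  filter_upwards [Icc_mem_nhds (by norm_num : (1 / 2 : ℝ) < 1) one_lt_two] with t ht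
  rcases eq_or_ne t 1 with rfl | ht1
  · simp
  have : 0 < |t - 1| := abs_pos.2 (sub_ne_zero.2 ht1)
  -- the weight that balances the two errors, both of order `|t - 1|`
  have hdiff := s.integral_cutoff_prim_dilate_sub_le hL hC hR ht.1
    (by positivity : 0 < ε / (R ^ 2 * |t - 1|))
  have hprim := (abs_le.1 (abs_integral_cutoff_comp_smul_sub_le hC hR ht
    (s.integrable_prim_comp s.memH1.memLp s.mem_Icc))).1
  have hgrad := (abs_le.1 (abs_integral_cutoff_comp_smul_sub_le hC hR ht
    s.memH1.memLp_grad.norm.integrable_sq)).2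
  simp only [abs_pow, abs_norm] at hgrad
  set T := ∫ x in (Metric.closedBall (0 : E N) (R / 2))ᶜ, ‖w x‖ ^ 2
  have hC0 : 0 ≤ C := (norm_nonneg _).trans (hC 0)
  have hT : 0 ≤ T := integral_nonneg fun x => sq_nonneg _
  have hquad : t ^ 2 * (2 ^ N * (8 * C * |t - 1| * T)) ≤ 4 * (2 ^ N * (8 * C * |t - 1| * T)) := by
    gcongr
    nlinarith [ht.1, ht.2]
  have hball : (ε / (R ^ 2 * |t - 1|) + L) * ((2 * R * |t - 1| * 2 ^ N) ^ 2 * ∫ x, ‖w x‖ ^ 2)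
      = ε * ((2 * 2 ^ N) ^ 2 * ∫ x, ‖w x‖ ^ 2) * |t - 1|
        + L * ((2 * R * 2 ^ N) ^ 2 * ∫ x, ‖w x‖ ^ 2) * |t - 1| ^ 2 := by
    field_simp
  have htail : (C / R) ^ 2 / (ε / (R ^ 2 * |t - 1|)) * T = C ^ 2 / ε * T * |t - 1| := by
    field_simp
  rw [hball, htail] at hdiff
  simp only [one_pow, inv_one, one_mul]
  linarith [mul_le_mul_of_nonneg_left hgrad (sq_nonneg t)]

theorem pohozaev (s : IsBoundedSolution h H M v w) :
    (N : ℝ) * ∫ x, H (v x) = (N - 2) / 2 * ∫ x, ‖w x‖ ^ 2 := by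
  obtain ⟨C, -, hC⟩ := exists_norm_gradient_cutoffBump_le N
  have hw := s.memH1.memLp_grad.norm.integrable_sq
  have hH := s.integrable_prim_comp s.memH1.memLp s.mem_Icc
  set P := -(N : ℝ) * (∫ x, H (v x)) - 1 / 2 * ((2 - N) * ∫ x, ‖w x‖ ^ 2) with hP
  have hlocal : ∀ ε : ℝ, 0 < ε → |P| ≤ ε * ((2 * 2 ^ N) ^ 2 * ∫ x, ‖w x‖ ^ 2) := by
    intro ε hε
    have hleft := (((tendsto_integral_cutoff hH).const_mul (-(N : ℝ))).sub
      (((tendsto_integral_cutoff hw).const_mul (2 - (N : ℝ))).const_mul (1 / 2))).abs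
    have hright := (((tendsto_setIntegral_compl_closedBall hw).const_mul
      (C ^ 2 / ε + 8 * (2 ^ N * C) * 2)).const_add (ε * ((2 * 2 ^ N) ^ 2 * ∫ x, ‖w x‖ ^ 2))).add
      ((tendsto_setIntegral_compl_closedBall hH.abs).const_mul (8 * (2 ^ N * C)))
    simp only [mul_zero, add_zero] at hright
    exact le_of_tendsto_of_tendsto' hleft hright fun n =>
      s.abs_pohozaev_cutoff_le hC (by positivity) hε
  have hlim : Tendsto (fun ε : ℝ => ε * ((2 * 2 ^ N) ^ 2 * ∫ x, ‖w x‖ ^ 2)) (𝓝[>] 0) (𝓝 0) := by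
    simpa only [zero_mul, id_eq] using
      (tendsto_id.mul_const ((2 * 2 ^ N) ^ 2 * ∫ x, ‖w x‖ ^ 2)).mono_left
        (nhdsWithin_le_nhds (a := (0 : ℝ)))
  have hzero : |P| ≤ 0 := ge_of_tendsto hlim (eventually_mem_nhdsWithin.mono hlocal)
  linarith [abs_nonpos_iff.1 hzero]

end IsBoundedSolution

end Pohozaev

/-! ### The mountain pass level -/

section MountainPass

variable {N : ℕ} {f : ℝ → ℝ} {lam k : ℝ} {v : E N → ℝ} {w : E N → E N}

theorem memH1_fn_grad (v : H1 N) : MemH1 (fn v) (grad v) :=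
  ⟨Lp.memLp _, Lp.memLp _, v.2⟩

/-- The class in `H¹` of a function with its weak gradient. -/
def MemH1.toH1 (h : MemH1 v w) : H1 N :=
  ⟨(h.memLp.toLp v, h.memLp_grad.toLp w),
    (h.congr h.memLp.coeFn_toLp.symm h.memLp_grad.coeFn_toLp.symm).isWeakGradient⟩

theorem MemH1.fn_smul_toH1 (h : MemH1 v w) (c : ℝ) :
    fn (c • h.toH1) =ᵐ[volume] fun x => c * v x := by
  filter_upwards [Lp.coeFn_smul c (h.memLp.toLp v), h.memLp.coeFn_toLp] with x hsmul hx
  exact hsmul.trans (congrArg (c * ·) hx)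

theorem MemH1.grad_smul_toH1 (h : MemH1 v w) (c : ℝ) :
    grad (c • h.toH1) =ᵐ[volume] fun x => c • w x := by
  filter_upwards [Lp.coeFn_smul c (h.memLp_grad.toLp w), h.memLp_grad.coeFn_toLp] with x hsmul hx
  exact hsmul.trans (congrArg (c • ·) hx)

theorem MemH1.energy_smul_toH1 (h : MemH1 v w) (f : ℝ → ℝ) (lam k c : ℝ) :
    energy f lam k (c • h.toH1) = 1 / 2 * (c ^ 2 * ∫ x, ‖w x‖ ^ 2)
      + lam / 2 * (∫ x, Ginv k (c * v x) ^ 2) - ∫ x, F f (Ginv k (c * v x)) := by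
  have hgrad : ∫ x, ‖grad (c • h.toH1) x‖ ^ 2 = c ^ 2 * ∫ x, ‖w x‖ ^ 2 := by
    rw [← integral_const_mul]
    refine integral_congr_ae ?_
    filter_upwards [h.grad_smul_toH1 c] with x hx
    rw [hx, norm_smul, mul_pow, Real.norm_eq_abs, sq_abs]
  have hcomp (b : ℝ → ℝ) : ∫ x, b (fn (c • h.toH1) x) = ∫ x, b (c * v x) :=
    integral_congr_ae ((h.fn_smul_toH1 c).fun_comp b)
  rw [energy, hgrad, hcomp fun s => Ginv k s ^ 2, hcomp fun s => F f (Ginv k s)]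

theorem memLp_Ginv_comp {α : Type*} [MeasurableSpace α] {μ : Measure α} {p : ENNReal} {v : α → ℝ}
    (hk : 0 < k) (hv : MemLp v p μ) : MemLp (fun x => Ginv k (v x)) p μ :=
  hv.of_le_mul (c := 3) ((continuous_Ginv hk).comp_aestronglyMeasurable hv.1)
    (ae_of_all _ fun _ => abs_Ginv_le hk _)

theorem integral_Ginv_sq_le {α : Type*} [MeasurableSpace α] {μ : Measure α} {v : α → ℝ}
    (hk : 0 < k) (hv : MemLp v 2 μ) : ∫ x, Ginv k (v x) ^ 2 ∂μ ≤ 9 * ∫ x, v x ^ 2 ∂μ := by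
  rw [← integral_const_mul]
  refine integral_mono (memLp_Ginv_comp hk hv).integrable_sq (hv.integrable_sq.const_mul _)
    fun x => ?_
  calc Ginv k (v x) ^ 2 ≤ (3 * |v x|) ^ 2 := sq_le_sq' (abs_le.1 (abs_Ginv_le hk _)).1
        (abs_le.1 (abs_Ginv_le hk _)).2
    _ = 9 * v x ^ 2 := by
        rw [mul_pow, sq_abs]
        norm_num

theorem MemH1.energy_smul_toH1_le (h : MemH1 v w) (f : ℝ → ℝ) (hlam : 0 ≤ lam) (hk : 0 < k)
    (c : ℝ) : energy f lam k (c • h.toH1)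
      ≤ c ^ 2 * (1 / 2 * (∫ x, ‖w x‖ ^ 2) + 9 / 2 * lam * ∫ x, v x ^ 2)
        - ∫ x, F f (Ginv k (c * v x)) := by
  have hG := integral_Ginv_sq_le hk (h.memLp.const_mul c)
  simp only [mul_pow, integral_const_mul] at hG
  rw [h.energy_smul_toH1]
  linarith [mul_le_mul_of_nonneg_left hG (by positivity : 0 ≤ lam / 2)]

theorem mpLevel_le {γ : C(unitInterval, H1 N)} (hγ : γ ∈ paths N f lam k) {D : ℝ} (hD : 0 ≤ D)
    (h : ∀ t, energy f lam k (γ t) ≤ D) : mpLevel N f lam k ≤ D := by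
  by_cases hbdd : BddBelow (range fun γ : paths N f lam k =>
      ⨆ t : unitInterval, energy f lam k (γ.1 t))
  · exact (ciInf_le hbdd ⟨γ, hγ⟩).trans (Real.iSup_le h hD)
  · rwa [mpLevel, Real.iInf_of_not_bddBelow hbdd]

theorem mpLevel_le_of_ray (u : H1 N) {S D : ℝ} (hS : 0 ≤ S) (hneg : energy f lam k (S • u) < 0)
    (hD : 0 ≤ D) (hle : ∀ c ∈ Icc 0 S, energy f lam k (c • u) ≤ D) : mpLevel N f lam k ≤ D := by
  let γ : C(unitInterval, H1 N) := ⟨fun t => ((t : ℝ) * S) • u, by fun_prop⟩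
  have hγ : γ ∈ paths N f lam k := by
    have hone : γ 1 = S • u := by simp [γ]
    exact ⟨by simp [γ], by rwa [hone]⟩
  exact mpLevel_le hγ hD fun t =>
    hle _ ⟨mul_nonneg t.2.1 hS, mul_le_of_le_one_left hS t.2.2⟩

theorem measureReal_closedBall_mul_F_le (N : ℕ) (h₁ : CondF1 f) (hk : 0 < k) {S : ℝ}
    (hS : 0 ≤ S) : (volume : Measure (E N)).real (Metric.closedBall 0 1) * F f S
      ≤ ∫ x, F f (Ginv k (S * cutoffBump N x)) := by
  have hint : Integrable (fun x => F f (Ginv k (S * cutoffBump N x))) volume := by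
    refine (h₁.continuous_F.comp ((continuous_Ginv hk).comp
      ((cutoffBump N).continuous.const_mul S))).integrable_of_hasCompactSupport ?_
    exact (cutoffBump N).hasCompactSupport.comp_left (g := fun s => F f (Ginv k (S * s)))
      (by simp only [mul_zero, Ginv_zero hk, F_zero])
  calc (volume : Measure (E N)).real (Metric.closedBall 0 1) * F f S
      = ∫ _ in Metric.closedBall (0 : E N) 1, F f S := by rw [setIntegral_const, smul_eq_mul]
    _ ≤ ∫ x in Metric.closedBall (0 : E N) 1, F f (Ginv k (S * cutoffBump N x)) := by
        refine setIntegral_mono_on (integrableOn_const measure_closedBall_lt_top.ne)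
          hint.integrableOn measurableSet_closedBall fun x hx => ?_
        rw [(cutoffBump N).one_of_mem_closedBall hx, mul_one]
        exact h₁.monotone_F (le_Ginv hk hS)
    _ ≤ ∫ x, F f (Ginv k (S * cutoffBump N x)) :=
        setIntegral_le_integral hint (ae_of_all _ fun _ =>
          h₁.F_nonneg (Ginv_nonneg hk (mul_nonneg hS (cutoffBump N).nonneg)))

theorem exists_mpLevel_le (h₁ : CondF1 f) (h₂ : CondF2 N f) (hlam : 0 ≤ lam) :
    ∃ C, 0 ≤ C ∧ ∀ k, 0 < k → mpLevel N f lam k ≤ C := by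
  have hφ := (isTest_cutoffBump N).memH1
  set D := 1 / 2 * (∫ x, ‖gradient (cutoffBump N) x‖ ^ 2)
    + 9 / 2 * lam * ∫ x, cutoffBump N x ^ 2
  set V := (volume : Measure (E N)).real (Metric.closedBall 0 1)
  have : 0 ≤ D := add_nonneg
    (mul_nonneg (by norm_num) (integral_nonneg fun _ => sq_nonneg _))
    (mul_nonneg (by positivity) (integral_nonneg fun _ => sq_nonneg _))
  have hV : 0 < V := ENNReal.toReal_pos (Metric.measure_closedBall_pos _ _ one_pos).ne'
    measure_closedBall_lt_top.ne
  obtain ⟨S, hFS, hS⟩ := (((tendsto_F_sub_mul_sq_atTop h₁ (tendsto_deriv_atTop h₂)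
    (D / V)).eventually_gt_atTop 0).and (eventually_ge_atTop 0)).exists
  refine ⟨S ^ 2 * D, by positivity, fun k hk => ?_⟩
  have henergy (c : ℝ) : energy f lam k (c • hφ.toH1)
      ≤ c ^ 2 * D - ∫ x, F f (Ginv k (c * cutoffBump N x)) := hφ.energy_smul_toH1_le f hlam hk c
  refine mpLevel_le_of_ray hφ.toH1 hS ?_ (by positivity) fun c hc => ?_
  · have hVF : S ^ 2 * D < V * F f S := by
      have hVD : S ^ 2 * D = V * (D / V * S ^ 2) := by field_simp
      rw [hVD]
      gcongr
      linarith
    have hball : V * F f S ≤ ∫ x, F f (Ginv k (S * cutoffBump N x)) :=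
      measureReal_closedBall_mul_F_le N h₁ hk hS
    linarith [henergy S]
  · have hF : 0 ≤ ∫ x, F f (Ginv k (c * cutoffBump N x)) := integral_nonneg fun x =>
      h₁.F_nonneg (Ginv_nonneg hk (mul_nonneg hc.1 (cutoffBump N).nonneg))
    have hcS : c ^ 2 * D ≤ S ^ 2 * D := by
      have := hc.1
      gcongr
      exact hc.2
    linarith [henergy c]

end MountainPass

section Growth

theorem exists_memLp_add_memLp {α : Type*} [MeasurableSpace α] {μ : Measure α} {v : α → ℝ}
    {r : ENNReal} {p q C : ℝ} (hq : 2 ≤ q) (hqp : q ≤ p) (hvr : MemLp v r μ)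
    (hvp : MemLp v (ENNReal.ofReal p) μ) {b : ℝ → ℝ} (hb : Continuous b)
    (hbC : ∀ s, |b s| ≤ C * (|s| + |s| ^ (q - 1))) :
    ∃ h₁ h₂ : α → ℝ, MemLp h₁ r μ ∧ MemLp h₂ (ENNReal.ofReal (p / (p - 1))) μ ∧
      ∀ x, h₁ x + h₂ x = b (v x) := by
  have hC : 0 ≤ C := by
    have hone := (abs_nonneg _).trans (hbC 1)
    simp only [abs_one, Real.one_rpow] at hone
    linarith
  let small : Set ℝ := {s | |s| ≤ 1}
  have hsmall : MeasurableSet small := measurableSet_le measurable_id.abs measurable_const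
  have hmeas {t : Set ℝ} (ht : MeasurableSet t) :
      AEStronglyMeasurable (fun x => t.indicator b (v x)) μ :=
    ((hb.measurable.indicator ht).comp_aemeasurable hvr.1.aemeasurable).aestronglyMeasurable
  refine ⟨fun x => small.indicator b (v x), fun x => smallᶜ.indicator b (v x), ?_, ?_,
    fun x => congrFun (indicator_self_add_compl small b) (v x)⟩
  · refine hvr.of_le_mul (c := 2 * C) (hmeas hsmall) (ae_of_all _ fun x => ?_)
    by_cases hx : |v x| ≤ 1
    · rw [indicator_of_mem (s := small) hx, Real.norm_eq_abs, Real.norm_eq_abs]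
      have hpow : |v x| ^ (q - 1) ≤ |v x| := Real.rpow_le_self_of_le_one (abs_nonneg _) hx
        (by linarith)
      linarith [hbC (v x), mul_le_mul_of_nonneg_left hpow hC]
    · rw [indicator_of_notMem (s := small) hx, norm_zero]
      positivity
  · have hvp' := hvp.norm_rpow_div (ENNReal.ofReal (p - 1))
    rw [← ENNReal.ofReal_div_of_pos (by linarith), ENNReal.toReal_ofReal (by linarith)] at hvp'
    refine hvp'.of_le_mul (c := 2 * C) (hmeas hsmall.compl) (ae_of_all _ fun x => ?_)
    rw [Real.norm_of_nonneg (by positivity : 0 ≤ ‖v x‖ ^ (p - 1)), Real.norm_eq_abs (v x)]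
    by_cases hx : |v x| ≤ 1
    · rw [indicator_of_notMem (fun h => h hx : v x ∉ smallᶜ), norm_zero]
      positivity
    · rw [indicator_of_mem (hx : v x ∈ smallᶜ), Real.norm_eq_abs]
      have hx1 : 1 ≤ |v x| := (not_le.1 hx).le
      have hlin : |v x| ≤ |v x| ^ (p - 1) := Real.self_le_rpow_of_one_le hx1 (by linarith)
      have hpow : |v x| ^ (q - 1) ≤ |v x| ^ (p - 1) :=
        Real.rpow_le_rpow_of_exponent_le hx1 (by linarith)
      linarith [hbC (v x), mul_le_mul_of_nonneg_left hlin hC, mul_le_mul_of_nonneg_left hpow hC]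

theorem holderConjugate_crit {N : ℕ} (hN : 3 ≤ N) : ENNReal.HolderConjugate
    (ENNReal.ofReal (crit N / (crit N - 1))) (ENNReal.ofReal (crit N)) :=
  (Real.HolderConjugate.conjExponent (by linarith [two_lt_crit hN])).symm.ennrealOfReal

variable {f : ℝ → ℝ} {lam k q K : ℝ}

theorem abs_rhs_le (hf : CondF1 f) (hlam : 0 ≤ lam) (hk : 0 < k) (hq : 1 ≤ q) (hK : 0 ≤ K)
    (hfK : ∀ u, 0 ≤ u → f u ≤ lam * u + K * u ^ (q - 1)) (s : ℝ) :
    |rhs f lam k s| ≤ (18 * lam + 3 * K * 3 ^ (q - 1)) * (|s| + |s| ^ (q - 1)) := by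
  set u := Ginv k s
  have hu : |u| ≤ 3 * |s| := abs_Ginv_le hk s
  have hext : ext f u ≤ lam * |u| + K * |u| ^ (q - 1) := by
    have hmax : max u 0 ≤ |u| := max_le (le_abs_self u) (abs_nonneg u)
    have hmax0 : 0 ≤ max u 0 := le_max_right _ _
    refine (hfK _ hmax0).trans ?_
    gcongr
  have hpow : |u| ^ (q - 1) ≤ 3 ^ (q - 1) * |s| ^ (q - 1) := by
    rw [← Real.mul_rpow (by norm_num) (abs_nonneg s)]
    gcongr
  have : 0 ≤ |s| ^ (q - 1) := by positivity
  have hcross : 0 ≤ lam * |s| ^ (q - 1) := by positivity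
  have hcross' : 0 ≤ K * 3 ^ (q - 1) * |s| := by positivity
  have hnum : |ext f u - lam * u| ≤ ext f u + lam * |u| := by
    refine (abs_sub _ _).trans_eq ?_
    rw [abs_of_nonneg (hf.ext_nonneg u), abs_mul, abs_of_nonneg hlam]
  rw [rhs, div_eq_mul_inv, abs_mul, abs_of_nonneg (inv_g_nonneg hk _)]
  calc |ext f u - lam * u| * (g k u)⁻¹
      ≤ (2 * (lam * |u|) + K * |u| ^ (q - 1)) * 3 :=
        mul_le_mul (by linarith) (inv_g_le_three hk u) (inv_g_nonneg hk u) (by positivity)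
    _ ≤ (2 * (lam * (3 * |s|)) + K * (3 ^ (q - 1) * |s| ^ (q - 1))) * 3 := by gcongr
    _ ≤ (18 * lam + 3 * K * 3 ^ (q - 1)) * (|s| + |s| ^ (q - 1)) := by linarith

theorem rhs_le_of_nonneg (hk : 0 < k) (hq : 1 ≤ q) (hK : 0 ≤ K)
    (hfK : ∀ u, 0 ≤ u → f u ≤ lam * u + K * u ^ (q - 1)) {s : ℝ} (hs : 0 ≤ s) :
    rhs f lam k s ≤ 3 * K * 3 ^ (q - 1) * s ^ (q - 1) := by
  have hu := Ginv_nonneg hk hs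
  rw [rhs, ext_of_nonneg f hu, div_eq_mul_inv]
  calc (f (Ginv k s) - lam * Ginv k s) * (g k (Ginv k s))⁻¹
      ≤ K * Ginv k s ^ (q - 1) * (g k (Ginv k s))⁻¹ :=
        mul_le_mul_of_nonneg_right (by linarith [hfK _ hu]) (inv_g_nonneg hk _)
    _ ≤ K * (3 * s) ^ (q - 1) * 3 := by
        gcongr
        · exact inv_g_nonneg hk _
        · exact Ginv_le hk hs
        · exact inv_g_le_three hk _
    _ = 3 * K * 3 ^ (q - 1) * s ^ (q - 1) := by
        rw [Real.mul_rpow (by norm_num) hs]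
        ring

theorem memLp_Ginv_div_g {α : Type*} [MeasurableSpace α] {μ : Measure α} {p : ENNReal}
    {v : α → ℝ} (hk : 0 < k) (hv : MemLp v p μ) :
    MemLp (fun x => Ginv k (v x) / g k (Ginv k (v x))) p μ := by
  have hcont : Continuous fun s => (g k (Ginv k s))⁻¹ :=
    ((continuous_g hk).comp (continuous_Ginv hk)).inv₀ fun s => (g_pos hk _).ne'
  refine (memLp_Ginv_comp hk hv).of_le_mul (c := 3)
    (((continuous_Ginv hk).mul hcont).comp_aestronglyMeasurable hv.1) (ae_of_all _ fun x => ?_)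
  rw [div_eq_mul_inv, norm_mul, mul_comm, Real.norm_of_nonneg (inv_g_nonneg hk _)]
  gcongr
  exact inv_g_le_three hk _

end Growth

section WeakSolution

theorem ofReal_integral_le_lintegral {α : Type*} [MeasurableSpace α] {μ : Measure α} {a : α → ℝ}
    (ha : Integrable a μ) : ENNReal.ofReal (∫ x, a x ∂μ) ≤ ∫⁻ x, ENNReal.ofReal (a x) ∂μ := by
  rw [integral_eq_lintegral_pos_part_sub_lintegral_neg_part ha]
  exact (ENNReal.ofReal_le_ofReal (sub_le_self _ ENNReal.toReal_nonneg)).trans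
    ENNReal.ofReal_toReal_le

variable {N : ℕ} {f : ℝ → ℝ} {lam k q K : ℝ} {v : H1 N} {φ : E N → ℝ} {w : E N → E N}

theorem IsWeakSolution.integral_inner_gradient (hv : IsWeakSolution f lam k v) (hk : 0 < k)
    (hφ : IsTest φ) (hint : Integrable (fun x => rhs f lam k (fn v x) * φ x) volume) :
    ∫ x, inner ℝ (grad v x) (gradient φ x) = ∫ x, rhs f lam k (fn v x) * φ x := by
  have hlin : Integrable (fun x => lam * (Ginv k (fn v x) / g k (Ginv k (fn v x))) * φ x)
      volume := ((memLp_Ginv_div_g hk (memH1_fn_grad v).memLp).const_mul lam).integrable_mul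
    hφ.memLp
  have hgrad : Integrable (fun x => inner ℝ (grad v x) (gradient φ x)) volume :=
    integrable_inner_of_memLp (memH1_fn_grad v).memLp_grad hφ.memH1.memLp_grad
  have hright : ∫ x, ext f (Ginv k (fn v x)) / g k (Ginv k (fn v x)) * φ x
      = (∫ x, rhs f lam k (fn v x) * φ x)
        + ∫ x, lam * (Ginv k (fn v x) / g k (Ginv k (fn v x))) * φ x := by
    rw [← integral_add hint hlin]
    refine integral_congr_ae (ae_of_all _ fun x => ?_)
    simp only [rhs]
    ring
  have hsol := hv φ hφ
  rw [hright] at hsol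
  simp only [← inner_gradient_left, real_inner_comm (grad v _)] at hsol
  rw [integral_add hgrad hlin] at hsol
  exact add_right_cancel hsol

variable (hN : 3 ≤ N) (hf : CondF1 f) (hlam : 0 ≤ lam) (hk : 0 < k) (hq : 2 ≤ q)
  (hK : 0 ≤ K) (hfK : ∀ u, 0 ≤ u → f u ≤ lam * u + K * u ^ (q - 1))
include hN hf hlam hk hq hK hfK

theorem IsWeakSolution.integrable_and_integral_inner (hqp : q ≤ crit N)
    (hv : IsWeakSolution f lam k v) (hφ : MemH1 φ w) :
    Integrable (fun x => rhs f lam k (fn v x) * φ x) volume ∧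
      ∫ x, inner ℝ (grad v x) (w x) = ∫ x, rhs f lam k (fn v x) * φ x := by
  have hH1 := memH1_fn_grad v
  have := holderConjugate_crit hN
  obtain ⟨h₁, h₂, hh₁, hh₂, hsum⟩ := exists_memLp_add_memLp hq hqp hH1.memLp (hH1.memLp_crit hN)
    (continuous_rhs lam hk hf) (abs_rhs_le hf hlam hk (by linarith) hK hfK)
  simp only [← hsum]
  refine ⟨(hφ.integral_add_mul hN hh₁ hh₂).1,
    MemH1.weak_equation hN hH1.memLp_grad hh₁ hh₂ (fun ψ hψ => ?_) hφ⟩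
  have hint := (hψ.memH1.integral_add_mul hN hh₁ hh₂).1
  simp only [hsum] at hint ⊢
  exact hv.integral_inner_gradient hk hψ hint

theorem IsWeakSolution.isPowerSubsolution (hqp : q ≤ crit N) (hv : IsWeakSolution f lam k v)
    (hv0 : ∀ᵐ x, 0 ≤ fn v x) :
    IsPowerSubsolution (3 * K * 3 ^ (q - 1)) q (fn v) (grad v) := by
  intro ψ θ hψ hθ hθ0 hθ1 hψ0
  have hH1 := memH1_fn_grad v
  have hcomp := hH1.comp hψ hθ (fun s => (abs_of_nonneg (hθ0 s)).trans_le (hθ1 s)) hψ0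
  obtain ⟨hint, heq⟩ := hv.integrable_and_integral_inner hN hf hlam hk hq hK hfK hqp hcomp
  have hψ_nonneg {s : ℝ} (hs : 0 ≤ s) : 0 ≤ ψ s :=
    hψ0.ge.trans (monotone_of_hasDerivAt_nonneg hψ hθ0 hs)
  have hgrad := integrable_inner_of_memLp hH1.memLp_grad hcomp.memLp_grad
  simp only [real_inner_smul_right, real_inner_self_eq_norm_sq] at heq hgrad
  calc ∫⁻ x, ENNReal.ofReal (θ (fn v x)) * ‖grad v x‖ₑ ^ 2
      = ENNReal.ofReal (∫ x, θ (fn v x) * ‖grad v x‖ ^ 2) := by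
        rw [ofReal_integral_eq_lintegral_ofReal hgrad
          (ae_of_all _ fun x => mul_nonneg (hθ0 _) (sq_nonneg _))]
        refine lintegral_congr fun x => ?_
        rw [ENNReal.ofReal_mul (hθ0 _), ENNReal.ofReal_pow (norm_nonneg _), ofReal_norm]
    _ ≤ ∫⁻ x, ENNReal.ofReal (rhs f lam k (fn v x) * ψ (fn v x)) := by
        rw [heq]
        exact ofReal_integral_le_lintegral hint
    _ ≤ ∫⁻ x, ENNReal.ofReal (3 * K * 3 ^ (q - 1))
          * ENNReal.ofReal (fn v x ^ (q - 1) * ψ (fn v x)) := by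
        refine lintegral_mono_ae ?_
        filter_upwards [hv0] with x hx
        rw [← ENNReal.ofReal_mul (by positivity), ← mul_assoc]
        exact ENNReal.ofReal_le_ofReal (mul_le_mul_of_nonneg_right
          (rhs_le_of_nonneg hk (by linarith) hK hfK hx) (hψ_nonneg hx))
    _ = _ := lintegral_const_mul' _ _ ENNReal.ofReal_ne_top

theorem IsWeakSolution.exists_isBoundedSolution (hqp : q < crit N)
    (hv : IsWeakSolution f lam k v) (hv0 : ∀ᵐ x, 0 ≤ fn v x) :
    ∃ M, IsBoundedSolution (rhs f lam k) (rhsPrim f lam k) M (fn v) (grad v) := by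
  have hH1 := memH1_fn_grad v
  obtain ⟨M, hM, hbound⟩ := exists_bound_of_isPowerSubsolution hN
    (by positivity : 0 ≤ 3 * K * 3 ^ (q - 1)) hqp (eLpNorm (grad v) 2 volume).toReal
  have hle := hbound _ _ hH1 (ENNReal.ofReal_toReal hH1.memLp_grad.2.ne).ge
    (hv.isPowerSubsolution hN hf hlam hk hq hK hfK hqp.le hv0)
  refine ⟨M, hH1, ?_, locallyLipschitz_rhs lam hk hf, hasDerivAt_rhsPrim lam hk hf,
    rhs_zero lam hk hf, rhsPrim_zero lam hk, fun φ w hφ =>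
      (hv.integrable_and_integral_inner hN hf hlam hk hq hK hfK hqp.le hφ).2⟩
  filter_upwards [hle, hv0] with x hxM hx0
  exact ⟨by linarith, hxM⟩

theorem IsWeakSolution.integral_norm_grad_sq (hqp : q < crit N) (hv : IsWeakSolution f lam k v)
    (hv0 : ∀ᵐ x, 0 ≤ fn v x) : ∫ x, ‖grad v x‖ ^ 2 = N * energy f lam k v := by
  obtain ⟨M, hsol⟩ := hv.exists_isBoundedSolution hN hf hlam hk hq hK hfK hqp hv0
  have hprim := hsol.integrable_prim_comp hsol.memH1.memLp hsol.mem_Icc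
  have hG := (memLp_Ginv_comp hk hsol.memH1.memLp).integrable_sq.const_mul (lam / 2)
  have hF : ∫ x, F f (Ginv k (fn v x))
      = (∫ x, rhsPrim f lam k (fn v x)) + lam / 2 * ∫ x, Ginv k (fn v x) ^ 2 := by
    rw [← integral_const_mul, ← integral_add hprim hG]
    exact integral_congr_ae (ae_of_all _ fun x => (sub_add_cancel _ _).symm)
  rw [energy, hF]
  linarith [hsol.pohozaev]

end WeakSolution

end QLS

end

theorem proposition6p1 (N : ℕ) (hN : 3 ≤ N) (f : ℝ → ℝ) (hF1 : QLS.CondF1 f)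
    (hF2 : QLS.CondF2 N f) (lam : ℝ) (hlam : 0 < lam) :
    ∃ C₁ : ℝ, 0 < C₁ ∧ ∀ k : ℝ, 0 < k → ∀ v : QLS.H1 N, QLS.IsMPSolution f lam k v →
      MeasureTheory.eLpNorm (QLS.fn v) ⊤ MeasureTheory.volume ≤ ENNReal.ofReal C₁ := by
  obtain ⟨q, hq, hqp, K, hK, hfK⟩ := QLS.exists_subcritical_growth hF1 hF2 hlam
  obtain ⟨C, hC, hlevel⟩ := QLS.exists_mpLevel_le hF1 hF2 hlam.le
  obtain ⟨M, hM, hbound⟩ := QLS.exists_bound_of_isPowerSubsolution hN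
    (by positivity : 0 ≤ 3 * K * 3 ^ (q - 1)) hqp √(N * C)
  refine ⟨M, hM, fun k hk v hv => ?_⟩
  have hv0 : ∀ᵐ x, 0 ≤ QLS.fn v x := hv.pos.mono fun _ => le_of_lt
  have hH1 := QLS.memH1_fn_grad v
  have hgrad : eLpNorm (QLS.grad v) 2 volume ≤ ENNReal.ofReal √(N * C) := by
    rw [← ENNReal.pow_le_pow_left_iff two_ne_zero, ← QLS.ofReal_integral_norm_sq hH1.memLp_grad,
      ← ENNReal.ofReal_pow (Real.sqrt_nonneg _), Real.sq_sqrt (by positivity),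
      hv.sol.integral_norm_grad_sq hN hF1 hlam.le hk hq.le hK.le hfK hqp hv0, hv.level]
    exact ENNReal.ofReal_le_ofReal (mul_le_mul_of_nonneg_left (hlevel k hk) N.cast_nonneg)
  have hle := hbound _ _ hH1 hgrad
    (hv.sol.isPowerSubsolution hN hF1 hlam.le hk hq.le hK.le hfK hqp.le hv0)
  rw [eLpNorm_exponent_top]
  refine eLpNormEssSup_le_of_ae_bound ?_
  filter_upwards [hle, hv0] with x hxM hx0
  rwa [Real.norm_of_nonneg hx0]
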